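/- Graphs are finite, have at least one vertex, have no loops, and may have parallel edges. A unique shortest path in a graph $H$ is a path from a vertex $u$ to a vertex $v$ such that no other path from $u$ to $v$ in $H$ has the same or a smaller length; two paths with different edge sequences count as different even if their vertex sequences agree, so no edge of a unique shortest path has another edge parallel to it. Let $\mathrm{usp}(H)$ be the largest number of vertices of a unique shortest path in $H$. The spectator number of $H$ is $|V(H)|-\mathrm{usp}(H)$. A minor of $H$ is a graph (isomorphic to one) obtained from $H$ by a sequence of deletions of isolated vertices, deletions of edges, and contractions of edges that have no other edge parallel to them; a minor obtained by a nonempty sequence of these operations is called proper. The spectator floor of a graph $G$ is the minimum of the spectator numbers of all graphs $H$ of which $G$ is a minor. A graph is minor-minimal with spectator floor $2$ if it has spectator floor $2$ and none of its proper minors has spectator floor $2$. Let $C_2$ be the graph with two vertices joined by two parallel edges, $C_4$ the cycle on four vertices, and $K_{1,n}$ the star with $n$ edges. Let $H_1$ be obtained from the triangle $K_3$ by doubling every edge; let $H_2$ be obtained from $K_{1,3}$ by doubling two of its edges; let $H_3$ be the union of a triangle and a $C_2$ that share exactly one vertex; let $H_4$ be obtained from the $3$-sun (a triangle with one pendant edge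 attached at each of its three vertices) by contracting one edge of the triangle; let $H_5$ be the graph with vertices $a,b,c,d,e$, single edges $ac$, $bc$, $cd$, and two parallel edges joining $d$ and $e$. The long $Y$ is obtained from $K_{1,3}$ by subdividing each edge once. **Theorem.** A graph is minor-minimal with spectator floor $2$ if and only if it is isomorphic to one of $$C_2\sqcup C_2,\quad C_2\sqcup K_{1,3},\quad K_{1,3}\sqcup K_{1,3},\quad C_4,\quad H_1,\quad H_2,\quad H_3,\quad H_4,\quad H_5,\quad K_{1,4},\quad \text{the long } Y.$$ -/

import Mathlib

namespace Graph

/-- The standing conventions on graphs: finite and nonempty, without loops. Parallel edges are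
allowed. -/
structure IsMultigraph {α β : Type*} (G : Graph α β) : Prop where
  loopless : G.Loopless
  finite_vertexSet : G.vertexSet.Finite
  finite_edgeSet : G.edgeSet.Finite
  nonempty : G.vertexSet.Nonempty

/-- `G` and `H` are isomorphic: there are bijections between their vertices and between their edges
that preserve and reflect incidence. -/
def Isomorphic {α β α' β' : Type*} (G : Graph α β) (H : Graph α' β') : Prop :=
  ∃ (φ : G.vertexSet ≃ H.vertexSet) (ψ : G.edgeSet ≃ H.edgeSet),
    ∀ (e : G.edgeSet) (x y : G.vertexSet), G.IsLink e x y ↔ H.IsLink (ψ e) (φ x) (φ y)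

/-! ### Paths, parades and the spectator number -/

/-- The vertex sequence `p 0, …, p k` and the edge sequence `q 0, …, q (k - 1)` form a path of
length `k` (that is, of order `k + 1`) in `G` from `u` to `v`. -/
structure IsPathFromTo {α β : Type*} (G : Graph α β) (u v : α) (k : ℕ)
    (p : Fin (k + 1) → α) (q : Fin k → β) : Prop where
  mem_vertexSet : ∀ i, p i ∈ G.vertexSet
  isLink : ∀ i : Fin k, G.IsLink (q i) (p i.castSucc) (p i.succ)
  first : p 0 = u
  last : p (Fin.last k) = v
  injective : Function.Injective p

/-- A shortest path from `u` to `v`. -/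
def IsShortestPath {α β : Type*} (G : Graph α β) (u v : α) (k : ℕ)
    (p : Fin (k + 1) → α) (q : Fin k → β) : Prop :=
  G.IsPathFromTo u v k p q ∧
    ∀ (l : ℕ) (p' : Fin (l + 1) → α) (q' : Fin l → β), G.IsPathFromTo u v l p' q' → k ≤ l

/-- A unique shortest path from `u` to `v`: every path from `u` to `v` of the same length has the
same vertex sequence and the same edge sequence. -/
def IsUniqueShortestPath {α β : Type*} (G : Graph α β) (u v : α) (k : ℕ)
    (p : Fin (k + 1) → α) (q : Fin k → β) : Prop :=
  G.IsShortestPath u v k p q ∧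
    ∀ (p' : Fin (k + 1) → α) (q' : Fin k → β), G.IsPathFromTo u v k p' q' → p' = p ∧ q' = q

/-- The parade number: the largest number of vertices of a unique shortest path. -/
noncomputable def paradeNumber {α β : Type*} (G : Graph α β) : ℕ :=
  sSup {m | ∃ (u v : α) (k : ℕ) (p : Fin (k + 1) → α) (q : Fin k → β),
    G.IsUniqueShortestPath u v k p q ∧ m = k + 1}

/-- The spectator number: the number of vertices outside a parade. -/
noncomputable def spectatorNumber {α β : Type*} (G : Graph α β) : ℕ :=
  G.vertexSet.ncard - G.paradeNumber

/-! ### Minors -/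

open Classical in
/-- The contraction of the edge `e`, which joins `u` and `v`: delete `e`, then identify `v`
with `u`. -/
noncomputable def contractLink {α β : Type*} (H : Graph α β) (e : β) (u v : α) : Graph α β :=
  (H.deleteEdges {e}).map (fun x => if x = v then u else x)

/-- `G` is obtained from `H` by deleting an isolated vertex, by deleting an edge, or by contracting
an edge that has no other edges in parallel with it. -/
inductive IsElementaryMinor {α β : Type*} (G H : Graph α β) : Prop
  | deleteIsolated (v : α) (hv : v ∈ H.vertexSet) (isolated : ∀ e, ¬ H.Inc e v)
      (eq : G = H.deleteVerts {v})
  | deleteEdge (e : β) (he : e ∈ H.edgeSet) (eq : G = H.deleteEdges {e})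
  | contractEdge (e : β) (u v : α) (he : H.IsLink e u v) (noParallel : ∀ f, H.IsLink f u v → f = e)
      (eq : G = H.contractLink e u v)

/-- `G` is (isomorphic to) a minor of `H`, that is, to a graph obtained from `H` by a possibly empty
sequence of elementary operations. -/
def IsMinorOf {α β α' β' : Type*} (G : Graph α β) (H : Graph α' β') : Prop :=
  ∃ G' : Graph α' β', Relation.ReflTransGen IsElementaryMinor G' H ∧ G.Isomorphic G'

/-- `G` is a proper minor of `H`: it is nonempty and obtained from `H` by a nonempty sequence of
elementary operations. -/
def IsProperMinorOf {α β : Type*} (G H : Graph α β) : Prop :=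
  G.vertexSet.Nonempty ∧ Relation.TransGen IsElementaryMinor G H

/-- The spectator floor: the minimum of the spectator numbers of all graphs of which `G` is a minor.
Every finite graph is isomorphic to one whose vertices and edges are natural numbers, so it is
enough to let `H` range over these. -/
noncomputable def spectatorFloor {α β : Type*} (G : Graph α β) : ℕ :=
  sInf {s | ∃ H : Graph ℕ ℕ, H.IsMultigraph ∧ G.IsMinorOf H ∧ s = H.spectatorNumber}

/-- `G` is minor-minimal among the graphs with spectator floor `k`. -/
def IsMinorMinimalWithSpectatorFloor {α β : Type*} (G : Graph α β) (k : ℕ) : Prop :=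
  G.spectatorFloor = k ∧ ∀ G' : Graph α β, G'.IsProperMinorOf G → G'.spectatorFloor ≠ k

/-! ### The particular graphs -/

/-- The graph with all elements of `α` as its vertices, all elements of `β` as its edges, and given
ends of each edge. -/
def ofEnds {α β : Type*} (ends : β → Sym2 α) : Graph α β where
  vertexSet := Set.univ
  IsLink e x y := ends e = s(x, y)
  isLink_symm _ _ := ⟨fun _ _ h => h.trans Sym2.eq_swap⟩
  eq_or_eq_of_isLink_of_isLink := by
    intro e x y v w h h'
    rcases Sym2.eq_iff.1 (h.symm.trans h') with h | h
    · exact Or.inl h.1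
    · exact Or.inr h.1
  left_mem_of_isLink _ _ _ _ := Set.mem_univ _

/-- The disjoint union of two graphs. -/
def disjointUnion {α β α' β' : Type*} (G : Graph α β) (H : Graph α' β') :
    Graph (α ⊕ α') (β ⊕ β') where
  vertexSet := Sum.inl '' G.vertexSet ∪ Sum.inr '' H.vertexSet
  IsLink e x y :=
    (∃ f a b, G.IsLink f a b ∧ e = Sum.inl f ∧ x = Sum.inl a ∧ y = Sum.inl b) ∨
    (∃ f a b, H.IsLink f a b ∧ e = Sum.inr f ∧ x = Sum.inr a ∧ y = Sum.inr b)
  isLink_symm := by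
    intro e _
    constructor
    rintro x y (⟨f, a, b, h, rfl, rfl, rfl⟩ | ⟨f, a, b, h, rfl, rfl, rfl⟩)
    · exact Or.inl ⟨f, b, a, h.symm, rfl, rfl, rfl⟩
    · exact Or.inr ⟨f, b, a, h.symm, rfl, rfl, rfl⟩
  eq_or_eq_of_isLink_of_isLink := by
    rintro e x y v w (⟨f, a, b, h, rfl, rfl, rfl⟩ | ⟨f, a, b, h, rfl, rfl, rfl⟩)
      (⟨f', a', b', h', hf, rfl, rfl⟩ | ⟨f', a', b', h', hf, rfl, rfl⟩)
    · cases hf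
      rcases h.left_eq_or_eq h' with rfl | rfl
      · exact Or.inl rfl
      · exact Or.inr rfl
    · cases hf
    · cases hf
    · cases hf
      rcases h.left_eq_or_eq h' with rfl | rfl
      · exact Or.inl rfl
      · exact Or.inr rfl
  left_mem_of_isLink := by
    rintro e x y (⟨f, a, b, h, rfl, rfl, rfl⟩ | ⟨f, a, b, h, rfl, rfl, rfl⟩)
    · exact Or.inl ⟨a, h.left_mem, rfl⟩
    · exact Or.inr ⟨a, h.left_mem, rfl⟩

/-- `C₂`: two vertices joined by two parallel edges. -/
def graphC2 : Graph (Fin 2) (Fin 2) := ofEnds ![s(0, 1), s(0, 1)]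

/-- `C₄`: the cycle on four vertices. -/
def graphC4 : Graph (Fin 4) (Fin 4) := ofEnds ![s(0, 1), s(1, 2), s(2, 3), s(3, 0)]

/-- The star `K_{1,n}` with centre `0`. -/
def star (n : ℕ) : Graph (Fin (n + 1)) (Fin n) := ofEnds fun i => s(0, i.succ)

/-- `H₁`: the triangle with every edge doubled. -/
def graphH1 : Graph (Fin 3) (Fin 6) :=
  ofEnds ![s(0, 1), s(0, 1), s(1, 2), s(1, 2), s(2, 0), s(2, 0)]

/-- `H₂`: the star `K_{1,3}` (with centre `0`) with two of its edges doubled. -/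
def graphH2 : Graph (Fin 4) (Fin 5) :=
  ofEnds ![s(0, 1), s(0, 1), s(0, 2), s(0, 2), s(0, 3)]

/-- `H₃`: the `1`-sum of a triangle and `C₂`, which share exactly the vertex `0`. -/
def graphH3 : Graph (Fin 4) (Fin 5) :=
  ofEnds ![s(0, 1), s(1, 2), s(2, 0), s(0, 3), s(0, 3)]

/-- The `3`-sun: a triangle `0, 1, 2` with one pendant edge at each of its vertices. -/
def threeSun : Graph (Fin 6) (Fin 6) :=
  ofEnds ![s(0, 1), s(1, 2), s(2, 0), s(0, 3), s(1, 4), s(2, 5)]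

/-- `H₄`: the `3`-sun with one edge of its triangle contracted. -/
noncomputable def graphH4 : Graph (Fin 6) (Fin 6) := threeSun.contractLink 0 0 1

/-- `H₅`: the path `2, 3, 4` with its last edge doubled and two further pendant edges at `2`. -/
def graphH5 : Graph (Fin 5) (Fin 5) :=
  ofEnds ![s(0, 2), s(1, 2), s(2, 3), s(3, 4), s(3, 4)]

/-- The long `Y`: the star `K_{1,3}` with every edge subdivided once. -/
def longY : Graph (Fin 7) (Fin 6) :=
  ofEnds ![s(0, 1), s(1, 2), s(0, 3), s(3, 4), s(0, 5), s(5, 6)]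

end Graph

/-!
The proof rests on a description of the graphs with spectator floor at most `1`. Let a *near-path*
be a subgraph of one of two infinite hosts. Both consist of a two-way infinite path, with the
integers as its vertices, and of one more vertex, the apex. In the first host, the apex is joined
to `0` and `1` by any number of parallel edges. In the second host, the apex is isolated, and the
edge between `0` and `1` may have parallel edges.

A graph has spectator floor at most `1` if and only if it is a near-path. If a unique shortest
path misses at most one vertex of a graph, then the neighbours of the missed vertex on the path
are consecutive and the path has no chords or parallel edges, so the graph fits the first host
(`IsMultigraph.fitsHost_of_spectatorNumber_le_one`); and near-paths are closed under taking minors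
(`IsNearPath.of_isElementaryMinor`). Conversely, a finite subgraph of a host lies in a finite
graph with spectator number at most `1`, or in a contraction of one
(`IsNearPath.spectatorFloor_le_one`). Unique shortest paths are certified by height functions
(`IsPathFromTo.isUniqueShortestPath`).

Each of the eleven listed graphs is an obstruction (`IsObstruction`): it is not a near-path, its
elementary minors are near-paths, and it is a subgraph of a graph with spectator number at most
`2`. This makes it minor-minimal with spectator floor `2` (`IsObstruction.isMinorMinimal`), and it
makes it the only such graph that has it as a minor (`IsObstruction.isomorphic`).

It remains to see that every graph without these minors is a near-path
(`ExcludesObstructions.isNearPath`). As `C₄` is excluded, all cycles of length above `2` are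
triangles (`exists_triangle`).
* If there is a triangle, then one of its vertices has no neighbours outside of it, since there is
  no `3`-sun minor; and such a vertex can be chosen as the apex (`isNearPath_of_triangle`).
* If there is no triangle but a vertex with three neighbours, it is the only one, and one of its
  neighbours is adjacent to no other vertex and can be chosen as the apex, since there is no
  long `Y` (`isNearPath_of_three_neighbors`).
* Otherwise, the underlying simple graph is a linear forest. It has at most one thick edge, or two
  that share a vertex, since there is no `C₂ ⊔ C₂` (`isNearPath_of_degree_le_two`).

In each case, the graph without the apex is a linear forest, whose vertices are placed on the
integers by `exists_linear_layout`.
-/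

namespace Graph

variable {α β α' β' α'' β'' : Type*}

/-! ### Embeddings and minors -/

/-- `G` is isomorphic to a subgraph of `H`. -/
def Embeds (G : Graph α β) (H : Graph α' β') : Prop :=
  ∃ (φ : α → α') (ψ : β → β'), Set.MapsTo φ G.vertexSet H.vertexSet ∧
    Set.InjOn φ G.vertexSet ∧ Set.InjOn ψ G.edgeSet ∧
    ∀ e x y, G.IsLink e x y → H.IsLink (ψ e) (φ x) (φ y)

theorem Isomorphic.symm {G : Graph α β} {H : Graph α' β'} (h : G.Isomorphic H) :
    H.Isomorphic G := by
  obtain ⟨φ, ψ, h⟩ := h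
  exact ⟨φ.symm, ψ.symm, fun e x y => by simp [h]⟩

theorem Isomorphic.trans {G : Graph α β} {H : Graph α' β'} {K : Graph α'' β''}
    (h : G.Isomorphic H) (h' : H.Isomorphic K) : G.Isomorphic K := by
  obtain ⟨φ, ψ, h⟩ := h
  obtain ⟨φ', ψ', h'⟩ := h'
  exact ⟨φ.trans φ', ψ.trans ψ', fun e x y => by simp [h, h']⟩

/-- Isomorphic graphs embed into each other. The nonemptiness assumptions only provide values for
the vertex and edge maps outside `G`. -/
theorem Isomorphic.embeds [Nonempty α'] [Nonempty β'] {G : Graph α β} {H : Graph α' β'}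
    (h : G.Isomorphic H) : G.Embeds H := by
  classical
  obtain ⟨φ, ψ, h⟩ := h
  refine ⟨fun x => if hx : x ∈ G.vertexSet then φ ⟨x, hx⟩ else Classical.arbitrary _,
    fun e => if he : e ∈ G.edgeSet then ψ ⟨e, he⟩ else Classical.arbitrary _, ?_, ?_, ?_, ?_⟩
  · intro x hx
    simp [hx]
  · intro x hx y hy hxy
    simpa [hx, hy, Subtype.ext_iff.symm] using hxy
  · intro x hx y hy hxy
    simpa [hx, hy, Subtype.ext_iff.symm] using hxy
  · intro e x y hl
    simpa [hl.edge_mem, hl.left_mem, hl.right_mem] using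
      (h ⟨e, hl.edge_mem⟩ ⟨x, hl.left_mem⟩ ⟨y, hl.right_mem⟩).1 hl

theorem reflTransGen_deleteEdges (H : Graph α β) {F : Set β} (hF : F.Finite)
    (hFE : F ⊆ H.edgeSet) : Relation.ReflTransGen IsElementaryMinor (H.deleteEdges F) H := by
  induction F, hF using Set.Finite.induction_on with
  | empty => rw [deleteEdges_empty]
  | @insert e F he _ ih =>
    refine .head (.deleteEdge e ?_ ?_) (ih ((Set.subset_insert _ _).trans hFE))
    · exact ⟨hFE (Set.mem_insert _ _), he⟩
    · rw [deleteEdges_deleteEdges, Set.union_singleton]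

theorem reflTransGen_deleteVerts (H : Graph α β) {W : Set α} (hW : W.Finite)
    (hWV : W ⊆ H.vertexSet) (hiso : ∀ v ∈ W, ∀ e, ¬ H.Inc e v) :
    Relation.ReflTransGen IsElementaryMinor (H.deleteVerts W) H := by
  induction W, hW using Set.Finite.induction_on with
  | empty => rw [deleteVerts_empty]
  | @insert v W hv _ ih =>
    have hsub := Set.subset_insert v W
    refine .head (.deleteIsolated v ?_ ?_ ?_) (ih (hsub.trans hWV) fun w hw => hiso w (hsub hw))
    · rw [vertexSet_deleteVerts]
      exact ⟨hWV (Set.mem_insert _ _), hv⟩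
    · rintro e ⟨x, hx⟩
      rw [deleteVerts_isLink] at hx
      exact hiso v (Set.mem_insert _ _) e hx.1.inc_left
    · refine Graph.ext ?_ fun e x y => ?_
      · simp only [vertexSet_deleteVerts]
        ext x
        simp only [Set.mem_sdiff, Set.mem_insert_iff, Set.mem_singleton_iff]
        tauto
      · simp only [deleteVerts_isLink, Set.mem_insert_iff, Set.mem_singleton_iff]
        tauto

/-- A subgraph of a finite graph is a minor of it. -/
theorem Embeds.isMinorOf {G : Graph α β} {H : Graph α' β'} (h : G.Embeds H)
    (hV : H.vertexSet.Finite) (hE : H.edgeSet.Finite) : G.IsMinorOf H := by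
  obtain ⟨φ, ψ, h1, h2, h3, h4⟩ := h
  have hlink : ∀ e x' y', (H.deleteEdges (H.edgeSet \ ψ '' G.edgeSet)).IsLink e x' y' →
      ∃ f x y, G.IsLink f x y ∧ ψ f = e ∧ φ x = x' ∧ φ y = y' := by
    intro e x' y' hl
    rw [deleteEdges_isLink] at hl
    have he : e ∈ ψ '' G.edgeSet := by
      by_contra hne
      exact hl.2 ⟨hl.1.edge_mem, hne⟩
    obtain ⟨f, hf, rfl⟩ := he
    obtain ⟨x, y, hxy⟩ := exists_isLink_of_mem_edgeSet hf
    rcases (h4 _ _ _ hxy).eq_and_eq_or_eq_and_eq hl.1 with h | h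
    · exact ⟨f, x, y, hxy, rfl, h.1, h.2⟩
    · exact ⟨f, y, x, hxy.symm, rfl, h.2, h.1⟩
  refine ⟨(H.deleteEdges (H.edgeSet \ ψ '' G.edgeSet)).deleteVerts (H.vertexSet \ φ '' G.vertexSet),
    (reflTransGen_deleteVerts (H.deleteEdges (H.edgeSet \ ψ '' G.edgeSet))
      (hV.subset Set.sdiff_subset) Set.sdiff_subset ?_).trans
      (reflTransGen_deleteEdges _ (hE.subset Set.sdiff_subset) Set.sdiff_subset), ?_⟩
  · rintro v hv e ⟨y, hl⟩
    obtain ⟨f, a, b, hab, -, rfl, -⟩ := hlink _ _ _ hl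
    exact hv.2 ⟨a, hab.left_mem, rfl⟩
  · have hVeq : ((H.deleteEdges (H.edgeSet \ ψ '' G.edgeSet)).deleteVerts
        (H.vertexSet \ φ '' G.vertexSet)).vertexSet = φ '' G.vertexSet := by
      rw [vertexSet_deleteVerts]
      change H.vertexSet \ (H.vertexSet \ φ '' G.vertexSet) = _
      rw [Set.sdiff_sdiff_cancel_left (Set.image_subset_iff.2 h1)]
    have key : ∀ e x y, G.IsLink e x y → ((H.deleteEdges (H.edgeSet \ ψ '' G.edgeSet)).deleteVerts
        (H.vertexSet \ φ '' G.vertexSet)).IsLink (ψ e) (φ x) (φ y) := by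
      intro e x y h
      rw [deleteVerts_isLink, deleteEdges_isLink]
      exact ⟨⟨h4 _ _ _ h, fun hh => hh.2 ⟨e, h.edge_mem, rfl⟩⟩, fun hh => hh.2 ⟨x, h.left_mem, rfl⟩,
        fun hh => hh.2 ⟨y, h.right_mem, rfl⟩⟩
    have hEeq : ((H.deleteEdges (H.edgeSet \ ψ '' G.edgeSet)).deleteVerts
        (H.vertexSet \ φ '' G.vertexSet)).edgeSet = ψ '' G.edgeSet := by
      ext e
      constructor
      · intro he
        obtain ⟨x, y, h⟩ := exists_isLink_of_mem_edgeSet he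
        rw [deleteVerts_isLink] at h
        obtain ⟨f, a, b, hab, rfl, -⟩ := hlink _ _ _ h.1
        exact ⟨f, hab.edge_mem, rfl⟩
      · rintro ⟨f, hf, rfl⟩
        obtain ⟨x, y, h⟩ := exists_isLink_of_mem_edgeSet hf
        exact (key _ _ _ h).edge_mem
    refine ⟨(Equiv.Set.imageOfInjOn φ _ h2).trans (Equiv.setCongr hVeq.symm),
      (Equiv.Set.imageOfInjOn ψ _ h3).trans (Equiv.setCongr hEeq.symm), ?_⟩
    rintro ⟨e, he⟩ ⟨x, hx⟩ ⟨y, hy⟩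
    constructor
    · exact fun h => key e x y h
    · intro h
      change IsLink _ (ψ e) (φ x) (φ y) at h
      rw [deleteVerts_isLink] at h
      obtain ⟨f, a, b, hab, hf, ha, hb⟩ := hlink _ _ _ h.1
      obtain rfl := h3 hab.edge_mem he hf
      obtain rfl := h2 hab.left_mem hx ha
      obtain rfl := h2 hab.right_mem hy hb
      exact hab

theorem IsMinorOf.of_isomorphic {G : Graph α β} {G' : Graph α' β'} {H : Graph α'' β''}
    (h : G'.IsMinorOf H) (hG : G.Isomorphic G') : G.IsMinorOf H := by
  obtain ⟨K, hK, hi⟩ := h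
  exact ⟨K, hK, hG.trans hi⟩

theorem IsMinorOf.trans_reflTransGen {G : Graph α β} {H K : Graph α' β'}
    (h : G.IsMinorOf H) (hH : Relation.ReflTransGen IsElementaryMinor H K) : G.IsMinorOf K := by
  obtain ⟨G', hG', hi⟩ := h
  exact ⟨G', hG'.trans hH, hi⟩

/-! ### Contractions -/

open Classical in
theorem contractLink_isLink {H : Graph α β} {e f : β} {u v x y : α} :
    (H.contractLink e u v).IsLink f x y ↔ ∃ a b, (H.IsLink f a b ∧ f ≠ e) ∧
      (if a = v then u else a) = x ∧ (if b = v then u else b) = y := by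
  unfold contractLink
  rw [map_isLink]
  simp [Relation.Map]

open Classical in
theorem mem_vertexSet_contractLink {H : Graph α β} {e : β} {u v x : α} :
    x ∈ (H.contractLink e u v).vertexSet ↔ ∃ a ∈ H.vertexSet, (if a = v then u else a) = x := by
  unfold contractLink
  simp

theorem IsElementaryMinor.finite {G H : Graph α β} (h : IsElementaryMinor G H)
    (hV : H.vertexSet.Finite) (hE : H.edgeSet.Finite) :
    G.vertexSet.Finite ∧ G.edgeSet.Finite := by
  cases h with
  | deleteIsolated v hv _ eq =>
    subst eq
    exact ⟨hV.subset deleteVerts_le.vertexSet_mono, hE.subset deleteVerts_le.edgeSet_mono⟩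
  | deleteEdge e he eq =>
    subst eq
    exact ⟨hV.subset deleteEdges_le.vertexSet_mono, hE.subset deleteEdges_le.edgeSet_mono⟩
  | contractEdge e u v he _ eq =>
    subst eq
    classical
    refine ⟨(hV.image fun a => if a = v then u else a).subset ?_, hE.subset ?_⟩
    · intro x hx
      obtain ⟨a, ha, rfl⟩ := mem_vertexSet_contractLink.1 hx
      exact ⟨a, ha, rfl⟩
    · intro f hf
      obtain ⟨x, y, h⟩ := exists_isLink_of_mem_edgeSet hf
      obtain ⟨a, b, h, -⟩ := contractLink_isLink.1 h
      exact h.1.edge_mem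

theorem IsMultigraph.not_isLink_self {G : Graph α β} (hG : G.IsMultigraph) {e : β} {x : α} :
    ¬ G.IsLink e x x := fun h => hG.loopless.not_isLoopAt e x h

theorem IsMultigraph.ne {G : Graph α β} (hG : G.IsMultigraph) {x y : α} (h : G.Adj x y) :
    x ≠ y := by
  rintro rfl
  obtain ⟨e, he⟩ := h
  exact hG.not_isLink_self he

open Classical in
/-- Two adjacent vertices `x` and `y` can be identified within the minors of a graph: all edges
between them but one are deleted, and the last one is contracted. -/
theorem IsMultigraph.exists_identify {G : Graph α β} (hG : G.IsMultigraph) {x y : α}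
    (h : G.Adj x y) : ∃ G' : Graph α β, Relation.ReflTransGen IsElementaryMinor G' G ∧
      G'.IsMultigraph ∧ (∀ a, a ∈ G'.vertexSet ↔ a ∈ G.vertexSet ∧ a ≠ y) ∧
      ∀ f a b, G'.IsLink f a b ↔ ∃ a₀ b₀, G.IsLink f a₀ b₀ ∧ ¬ G.IsLink f x y ∧
        (if a₀ = y then x else a₀) = a ∧ (if b₀ = y then x else b₀) = b := by
  have hxy := hG.ne h
  obtain ⟨e, he⟩ := h
  set F : Set β := {f | G.IsLink f x y ∧ f ≠ e} with hF
  have hFE : F ⊆ G.edgeSet := fun f hf => hf.1.edge_mem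
  have hlink : ∀ f a b, ((G.deleteEdges F).contractLink e x y).IsLink f a b ↔
      ∃ a₀ b₀, G.IsLink f a₀ b₀ ∧ ¬ G.IsLink f x y ∧
        (if a₀ = y then x else a₀) = a ∧ (if b₀ = y then x else b₀) = b := by
    intro f a b
    rw [contractLink_isLink]
    simp only [deleteEdges_isLink, hF, Set.mem_ofPred_eq]
    refine exists_congr fun a₀ => exists_congr fun b₀ => ?_
    by_cases hfe : f = e
    · subst hfe
      simp [he]
    · simp only [hfe, ne_eq, not_false_eq_true, and_true]
      tauto
  have hvert : ∀ a, a ∈ ((G.deleteEdges F).contractLink e x y).vertexSet ↔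
      a ∈ G.vertexSet ∧ a ≠ y := by
    intro a
    rw [mem_vertexSet_contractLink]
    constructor
    · rintro ⟨b, hb, rfl⟩
      split_ifs with hby
      · exact ⟨he.left_mem, hxy⟩
      · exact ⟨hb, hby⟩
    · rintro ⟨ha, hay⟩
      exact ⟨a, ha, by simp [hay]⟩
  refine ⟨(G.deleteEdges F).contractLink e x y, ?_, ⟨⟨?_⟩, ?_, ?_, ?_⟩, hvert, hlink⟩
  · refine .head (.contractEdge e x y ?_ ?_ rfl)
      (reflTransGen_deleteEdges G (hG.finite_edgeSet.subset hFE) hFE)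
    · simp [hF, he]
    · intro f hf
      simp only [deleteEdges_isLink, hF, Set.mem_ofPred_eq] at hf
      tauto
  · intro f a hfa
    obtain ⟨a₀, b₀, h1, h2, h3, h4⟩ := (hlink _ _ _).1 hfa
    have h5 := h3.trans h4.symm
    split_ifs at h5 with h6 h7 h7
    · exact hG.not_isLink_self (h6 ▸ h7 ▸ h1)
    · subst h6 h5
      exact h2 h1.symm
    · subst h5 h7
      exact h2 h1
    · subst h5
      exact hG.not_isLink_self h1
  · exact hG.finite_vertexSet.subset fun a ha => ((hvert a).1 ha).1
  · refine hG.finite_edgeSet.subset fun f hf => ?_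
    obtain ⟨a, b, h⟩ := exists_isLink_of_mem_edgeSet hf
    obtain ⟨a₀, b₀, h1, -⟩ := (hlink _ _ _).1 h
    exact h1.edge_mem
  · exact ⟨x, (hvert x).2 ⟨he.left_mem, hxy⟩⟩

/-! ### Near-paths -/

/-- Adjacency in the two infinite host graphs with vertex set `Option ℤ`. In both, the integers form
a two-way infinite path. If `apex` is true, `none` is joined to `0` and `1`; otherwise `none` is
isolated. -/
def HostAdj (apex : Bool) : Option ℤ → Option ℤ → Prop
  | some i, some j => i = j + 1 ∨ j = i + 1
  | some i, none => apex = true ∧ (i = 0 ∨ i = 1)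
  | none, some i => apex = true ∧ (i = 0 ∨ i = 1)
  | none, none => False

/-- The adjacent pairs of the host graph between which parallel edges are allowed: those at `none`
if `apex` is true, and the pair `0`, `1` otherwise. -/
def HostThick (apex : Bool) (x y : Option ℤ) : Prop :=
  (apex = true ∧ (x = none ∨ y = none)) ∨
    (apex = false ∧ (x = some 0 ∧ y = some 1 ∨ x = some 1 ∧ y = some 0))

instance (apex : Bool) : DecidableRel (HostAdj apex)
  | some _, some _ => inferInstanceAs (Decidable (_ ∨ _))
  | some _, none => inferInstanceAs (Decidable (_ ∧ _))
  | none, some _ => inferInstanceAs (Decidable (_ ∧ _))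
  | none, none => inferInstanceAs (Decidable False)

instance (apex : Bool) : DecidableRel (HostThick apex) :=
  fun _ _ => inferInstanceAs (Decidable (_ ∨ _))

/-- `G` is a subgraph of the host graph, the allowed parallel edges having any multiplicity. -/
def FitsHost (apex : Bool) (G : Graph α β) : Prop :=
  ∃ g : α → Option ℤ, Set.InjOn g G.vertexSet ∧
    (∀ e x y, G.IsLink e x y → HostAdj apex (g x) (g y)) ∧
    ∀ e f x y, G.IsLink e x y → G.IsLink f x y → e ≠ f → HostThick apex (g x) (g y)

/-- `G` is a near-path: a subgraph of one of the two hosts. For finite nonempty graphs, this turns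
out to be the same as having spectator floor at most `1`. -/
def IsNearPath (G : Graph α β) : Prop := ∃ apex, FitsHost apex G

theorem HostAdj.symm {apex : Bool} {x y : Option ℤ} (h : HostAdj apex x y) :
    HostAdj apex y x := by
  cases x <;> cases y <;> simp only [HostAdj] at h ⊢ <;> tauto

theorem HostThick.symm {apex : Bool} {x y : Option ℤ} (h : HostThick apex x y) :
    HostThick apex y x := by
  unfold HostThick at h ⊢
  tauto

theorem FitsHost.of_embeds {apex : Bool} {G : Graph α β} {H : Graph α' β'}
    (hH : FitsHost apex H) (h : G.Embeds H) : FitsHost apex G := by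
  obtain ⟨g, h1, h2, h3⟩ := hH
  obtain ⟨φ, ψ, i1, i2, i3, i4⟩ := h
  exact ⟨g ∘ φ, h1.comp i2 i1, fun e x y h => h2 _ _ _ (i4 _ _ _ h), fun e f x y he hf hne =>
    h3 _ _ _ _ (i4 _ _ _ he) (i4 _ _ _ hf) fun hh => hne (i3 he.edge_mem hf.edge_mem hh)⟩

theorem IsNearPath.of_embeds {G : Graph α β} {H : Graph α' β'}
    (hH : H.IsNearPath) (h : G.Embeds H) : G.IsNearPath := hH.imp fun _ hk => hk.of_embeds h

/-- A placement of the vertices of `G` in the host that puts only the ends of `e` on the same spot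
places the graph obtained by contracting `e`. -/
theorem FitsHost.contractLink {apex : Bool} {G : Graph α β} {e : β} {u v : α}
    (g : α → Option ℤ) (huv : g u = g v)
    (hinj : ∀ x ∈ G.vertexSet, ∀ y ∈ G.vertexSet, g x = g y → x = y ∨ (x = u ∧ y = v) ∨
      (x = v ∧ y = u))
    (hadj : ∀ f x y, G.IsLink f x y → f ≠ e → HostAdj apex (g x) (g y))
    (hthick : ∀ f₁ f₂ x₁ x₂ y₁ y₂, G.IsLink f₁ x₁ y₁ → G.IsLink f₂ x₂ y₂ → f₁ ≠ e → f₂ ≠ e →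
      f₁ ≠ f₂ → g x₁ = g x₂ → g y₁ = g y₂ → HostThick apex (g x₁) (g y₁)) :
    FitsHost apex (G.contractLink e u v) := by
  classical
  have hr : ∀ a, g (if a = v then u else a) = g a := by
    intro a
    split_ifs with h
    · rw [h, huv]
    · rfl
  refine ⟨g, ?_, ?_, ?_⟩
  · intro x hx y hy hxy
    obtain ⟨a, ha, rfl⟩ := mem_vertexSet_contractLink.1 hx
    obtain ⟨b, hb, rfl⟩ := mem_vertexSet_contractLink.1 hy
    rw [hr, hr] at hxy
    rcases hinj a ha b hb hxy with h | ⟨h, h'⟩ | ⟨h, h'⟩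
    · rw [h]
    · simp [h, h']
    · simp [h, h']
  · intro f x y h
    obtain ⟨a, b, ⟨hab, hne⟩, rfl, rfl⟩ := contractLink_isLink.1 h
    rw [hr, hr]
    exact hadj _ _ _ hab hne
  · intro f₁ f₂ x y h₁ h₂ hne
    obtain ⟨a₁, b₁, ⟨h₁', hne₁⟩, rfl, rfl⟩ := contractLink_isLink.1 h₁
    obtain ⟨a₂, b₂, ⟨h₂', hne₂⟩, hx, hy⟩ := contractLink_isLink.1 h₂
    have hx' := congrArg g hx
    have hy' := congrArg g hy
    rw [hr, hr] at hx' hy'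
    rw [hr, hr]
    exact hthick f₁ f₂ _ _ _ _ h₁' h₂' hne₁ hne₂ hne hx'.symm hy'.symm

/-- Contracting the edge `{i, i + 1}` of the path: the part of the path that does not contain both
`0` and `1` is shifted towards the other one. -/
theorem FitsHost.contractLink_of_path {apex : Bool} {G : Graph α β} {e : β} {u v : α}
    (he : G.IsLink e u v) (noParallel : ∀ f, G.IsLink f u v → f = e) {g : α → Option ℤ}
    (h1 : Set.InjOn g G.vertexSet) (h2 : ∀ e x y, G.IsLink e x y → HostAdj apex (g x) (g y))
    (h3 : ∀ e f x y, G.IsLink e x y → G.IsLink f x y → e ≠ f → HostThick apex (g x) (g y))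
    {i : ℤ} (hi : (g u = some i ∧ g v = some (i + 1)) ∨ (g v = some i ∧ g u = some (i + 1))) :
    FitsHost apex (G.contractLink e u v) := by
  set s : ℤ → ℤ := fun j => if 0 ≤ i then (if i < j then j - 1 else j) else
    (if j ≤ i then j + 1 else j) with hs
  have hs' : ∀ j, (0 ≤ i ∧ i < j ∧ s j = j - 1) ∨ (0 ≤ i ∧ j ≤ i ∧ s j = j) ∨
      (i < 0 ∧ j ≤ i ∧ s j = j + 1) ∨ (i < 0 ∧ i < j ∧ s j = j) := by
    intro j
    simp only [hs]
    split_ifs <;> omega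
  clear_value s
  have hpair : ∀ x ∈ G.vertexSet, ∀ y ∈ G.vertexSet, ∀ a b, g x = some a → g y = some b →
      (a = i ∧ b = i + 1) ∨ (a = i + 1 ∧ b = i) → (x = u ∧ y = v) ∨ (x = v ∧ y = u) := by
    rintro x hx y hy a b ha hb (⟨rfl, rfl⟩ | ⟨rfl, rfl⟩) <;> rcases hi with ⟨hu, hv⟩ | ⟨hu, hv⟩
    · exact Or.inl ⟨h1 hx he.left_mem (ha.trans hu.symm), h1 hy he.right_mem (hb.trans hv.symm)⟩
    · exact Or.inr ⟨h1 hx he.right_mem (ha.trans hu.symm), h1 hy he.left_mem (hb.trans hv.symm)⟩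
    · exact Or.inr ⟨h1 hx he.right_mem (ha.trans hv.symm), h1 hy he.left_mem (hb.trans hu.symm)⟩
    · exact Or.inl ⟨h1 hx he.left_mem (ha.trans hv.symm), h1 hy he.right_mem (hb.trans hu.symm)⟩
  have hne : ∀ f x y, G.IsLink f x y → f ≠ e → ∀ a b, g x = some a → g y = some b →
      ¬ ((a = i ∧ b = i + 1) ∨ (a = i + 1 ∧ b = i)) := by
    intro f x y hf hfe a b ha hb hab
    rcases hpair x hf.left_mem y hf.right_mem a b ha hb hab with ⟨rfl, rfl⟩ | ⟨rfl, rfl⟩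
    · exact hfe (noParallel f hf)
    · exact hfe (noParallel f hf.symm)
  refine FitsHost.contractLink (fun x => (g x).map s) ?_ ?_ ?_ ?_
  · rcases hi with ⟨hu, hv⟩ | ⟨hu, hv⟩
    · simp only [hu, hv, Option.map_some, Option.some.injEq]
      have := hs' i
      have := hs' (i + 1)
      omega
    · simp only [hu, hv, Option.map_some, Option.some.injEq]
      have := hs' i
      have := hs' (i + 1)
      omega
  · intro x hx y hy hxy
    rcases hgx : g x with _ | a <;> rcases hgy : g y with _ | b <;> simp only [hgx, hgy,
      Option.map_some, Option.map_none, Option.some.injEq, reduceCtorEq] at hxy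
    · exact Or.inl (h1 hx hy (hgx.trans hgy.symm))
    · by_cases hab : a = b
      · subst hab
        exact Or.inl (h1 hx hy (hgx.trans hgy.symm))
      · refine Or.inr (hpair x hx y hy a b hgx hgy ?_)
        have := hs' a
        have := hs' b
        omega
  · intro f x y hf hfe
    have hadj := h2 _ _ _ hf
    have hn := hne f x y hf hfe
    rcases hgx : g x with _ | a <;> rcases hgy : g y with _ | b <;>
      simp only [hgx, hgy, Option.map_some, Option.map_none, HostAdj] at hadj ⊢
    · refine ⟨hadj.1, ?_⟩
      have := hs' b
      omega
    · refine ⟨hadj.1, ?_⟩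
      have := hs' a
      omega
    · have := hn a b hgx hgy
      have := hs' a
      have := hs' b
      omega
  · intro f₁ f₂ x₁ x₂ y₁ y₂ hf₁ hf₂ hfe₁ hfe₂ hf hx hy
    have ha₁ := h2 _ _ _ hf₁
    have ha₂ := h2 _ _ _ hf₂
    have hn₁ := hne _ _ _ hf₁ hfe₁
    have hn₂ := hne _ _ _ hf₂ hfe₂
    rcases hgx₁ : g x₁ with _ | a₁ <;> rcases hgx₂ : g x₂ with _ | a₂ <;>
      simp only [hgx₁, hgx₂, Option.map_some, Option.map_none, Option.some.injEq,
        reduceCtorEq] at hx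
    · refine Or.inl ⟨?_, Or.inl rfl⟩
      rw [hgx₁] at ha₁
      cases hgy₁ : g y₁ <;> rw [hgy₁] at ha₁
      · exact ha₁.elim
      · exact ha₁.1
    · rcases hgy₁ : g y₁ with _ | b₁ <;> rcases hgy₂ : g y₂ with _ | b₂ <;>
        simp only [hgy₁, hgy₂, Option.map_some, Option.map_none, Option.some.injEq,
          reduceCtorEq] at hy
      · rw [hgx₁, hgy₁] at ha₁
        exact Or.inl ⟨ha₁.1, Or.inr rfl⟩
      · have hn₁ := hn₁ a₁ b₁ hgx₁ hgy₁
        have hn₂ := hn₂ a₂ b₂ hgx₂ hgy₂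
        rw [hgx₁, hgy₁] at ha₁
        rw [hgx₂, hgy₂] at ha₂
        simp only [HostAdj] at ha₁ ha₂
        have e1 := hs' a₁
        have e2 := hs' b₁
        have e3 := hs' a₂
        have e4 := hs' b₂
        obtain rfl : a₁ = a₂ := by omega
        obtain rfl : b₁ = b₂ := by omega
        obtain rfl := h1 hf₁.left_mem hf₂.left_mem (hgx₁.trans hgx₂.symm)
        obtain rfl := h1 hf₁.right_mem hf₂.right_mem (hgy₁.trans hgy₂.symm)
        have ht := h3 _ _ _ _ hf₁ hf₂ hf
        simp only [HostThick, hgx₁, hgy₁, Option.map_some, Option.some.injEq, reduceCtorEq,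
          or_false, and_false, false_or] at ht ⊢
        exact ⟨ht.1, by omega⟩

/-- Contracting an edge between `none` and the path leaves a path with one thick edge. -/
theorem FitsHost.contractLink_of_apex {G : Graph α β} {e : β} {u v : α}
    (he : G.IsLink e u v) (noParallel : ∀ f, G.IsLink f u v → f = e) {g : α → Option ℤ}
    (h1 : Set.InjOn g G.vertexSet) (h2 : ∀ e x y, G.IsLink e x y → HostAdj true (g x) (g y))
    (h3 : ∀ e f x y, G.IsLink e x y → G.IsLink f x y → e ≠ f → HostThick true (g x) (g y))
    {i : ℤ} (hi : (g u = none ∧ g v = some i) ∨ (g v = none ∧ g u = some i)) :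
    FitsHost false (G.contractLink e u v) := by
  have hi01 : i = 0 ∨ i = 1 := by
    have := h2 _ _ _ he
    rcases hi with ⟨hu, hv⟩ | ⟨hv, hu⟩ <;> rw [hu, hv] at this <;> exact this.2
  have hpair : ∀ x ∈ G.vertexSet, ∀ y ∈ G.vertexSet, g x = none → g y = some i →
      (x = u ∧ y = v) ∨ (x = v ∧ y = u) := by
    intro x hx y hy ha hb
    rcases hi with ⟨hu, hv⟩ | ⟨hv, hu⟩
    · exact Or.inl ⟨h1 hx he.left_mem (ha.trans hu.symm), h1 hy he.right_mem (hb.trans hv.symm)⟩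
    · exact Or.inr ⟨h1 hx he.right_mem (ha.trans hv.symm), h1 hy he.left_mem (hb.trans hu.symm)⟩
  have hne : ∀ f x y, G.IsLink f x y → f ≠ e → g x = none → g y ≠ some i := by
    intro f x y hf hfe ha hb
    rcases hpair x hf.left_mem y hf.right_mem ha hb with ⟨rfl, rfl⟩ | ⟨rfl, rfl⟩
    · exact hfe (noParallel f hf)
    · exact hfe (noParallel f hf.symm)
  have hcases : ∀ f x y, G.IsLink f x y → f ≠ e →
      (∃ a b, g x = some a ∧ g y = some b ∧ (a = b + 1 ∨ b = a + 1)) ∨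
      (∃ b, g x = none ∧ g y = some b ∧ (b = 0 ∨ b = 1) ∧ b ≠ i) ∨
      (∃ a, g x = some a ∧ g y = none ∧ (a = 0 ∨ a = 1) ∧ a ≠ i) := by
    intro f x y hf hfe
    have hadj := h2 _ _ _ hf
    have hn := hne f x y hf hfe
    have hn' := hne f y x hf.symm hfe
    rcases hgx : g x with _ | a <;> rcases hgy : g y with _ | b <;> rw [hgx, hgy] at hadj hn hn'
    · exact hadj.elim
    · exact Or.inr (Or.inl ⟨b, rfl, rfl, hadj.2, by simpa using hn⟩)
    · exact Or.inr (Or.inr ⟨a, rfl, rfl, hadj.2, by simpa using hn'⟩)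
    · exact Or.inl ⟨a, b, rfl, rfl, hadj⟩
  refine FitsHost.contractLink (fun x => some ((g x).getD i)) ?_ ?_ ?_ ?_
  · rcases hi with ⟨hu, hv⟩ | ⟨hu, hv⟩ <;> simp [hu, hv]
  · intro x hx y hy hxy
    rcases hgx : g x with _ | a <;> rcases hgy : g y with _ | b <;> simp only [hgx, hgy,
      Option.getD_some, Option.getD_none, Option.some.injEq] at hxy
    · exact Or.inl (h1 hx hy (hgx.trans hgy.symm))
    · subst hxy
      exact Or.inr (hpair x hx y hy hgx hgy)
    · subst hxy
      have := hpair y hy x hx hgy hgx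
      tauto
    · subst hxy
      exact Or.inl (h1 hx hy (hgx.trans hgy.symm))
  · intro f x y hf hfe
    rcases hcases f x y hf hfe with ⟨a, b, hx, hy, h⟩ | ⟨b, hx, hy, h⟩ | ⟨a, hx, hy, h⟩ <;>
      simp only [hx, hy, Option.getD_some, Option.getD_none, HostAdj] <;> omega
  · intro f₁ f₂ x₁ x₂ y₁ y₂ hf₁ hf₂ hfe₁ hfe₂ hf hx hy
    rcases hcases f₁ x₁ y₁ hf₁ hfe₁ with ⟨a, b, hx₁, hy₁, h⟩ | ⟨b, hx₁, hy₁, h⟩ | ⟨a, hx₁, hy₁, h⟩ <;>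
    rcases hcases f₂ x₂ y₂ hf₂ hfe₂ with ⟨a', b', hx₂, hy₂, h'⟩ | ⟨b', hx₂, hy₂, h'⟩ |
      ⟨a', hx₂, hy₂, h'⟩ <;>
    simp only [hx₁, hy₁, hx₂, hy₂, Option.getD_some, Option.getD_none, Option.some.injEq] at hx hy <;>
    simp only [HostThick, hx₁, hy₁, Option.getD_some, Option.getD_none, Option.some.injEq,
      Bool.false_eq_true, false_and, true_and, false_or]
    · subst hx hy
      obtain rfl := h1 hf₁.left_mem hf₂.left_mem (hx₁.trans hx₂.symm)
      obtain rfl := h1 hf₁.right_mem hf₂.right_mem (hy₁.trans hy₂.symm)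
      have := h3 _ _ _ _ hf₁ hf₂ hf
      simp [HostThick, hx₁, hy₁] at this
    all_goals omega

/-- Near-paths are closed under taking minors. -/
theorem IsNearPath.of_isElementaryMinor {G H : Graph α β} (hH : H.IsNearPath)
    (h : IsElementaryMinor G H) : G.IsNearPath := by
  obtain ⟨k, hk⟩ := hH
  have of_le : G ≤ H → G.IsNearPath := fun hle => IsNearPath.of_embeds ⟨k, hk⟩
    ⟨id, id, hle.vertexSet_mono, Function.injective_id.injOn, Function.injective_id.injOn,
      fun _ _ _ h => hle.isLink_mono h⟩
  cases h with
  | deleteIsolated v hv _ eq => exact of_le (eq ▸ deleteVerts_le)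
  | deleteEdge e he eq => exact of_le (eq ▸ deleteEdges_le)
  | contractEdge e u v he noParallel eq =>
    subst eq
    obtain ⟨g, h1, h2, h3⟩ := hk
    have hadj := h2 _ _ _ he
    rcases hgu : g u with _ | i <;> rcases hgv : g v with _ | j <;> rw [hgu, hgv] at hadj
    · exact hadj.elim
    · obtain rfl : k = true := hadj.1
      exact ⟨false, FitsHost.contractLink_of_apex he noParallel h1 h2 h3 (Or.inl ⟨hgu, hgv⟩)⟩
    · obtain rfl : k = true := hadj.1
      exact ⟨false, FitsHost.contractLink_of_apex he noParallel h1 h2 h3 (Or.inr ⟨hgv, hgu⟩)⟩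
    · rcases hadj with rfl | rfl
      · exact ⟨k, FitsHost.contractLink_of_path he noParallel h1 h2 h3 (Or.inr ⟨hgv, hgu⟩)⟩
      · exact ⟨k, FitsHost.contractLink_of_path he noParallel h1 h2 h3 (Or.inl ⟨hgu, hgv⟩)⟩

theorem IsNearPath.of_reflTransGen {G H : Graph α β} (hH : H.IsNearPath)
    (h : Relation.ReflTransGen IsElementaryMinor G H) : G.IsNearPath := by
  induction h using Relation.ReflTransGen.head_induction_on with
  | refl => exact hH
  | head h _ ih => exact ih.of_isElementaryMinor h

/-! ### Parades -/

theorem IsPathFromTo.le_ncard {G : Graph α β} (hV : G.vertexSet.Finite) {u v : α} {k : ℕ}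
    {p : Fin (k + 1) → α} {q : Fin k → β} (h : G.IsPathFromTo u v k p q) :
    k + 1 ≤ G.vertexSet.ncard := by
  have h1 : (Set.range p).ncard = k + 1 := by
    rw [← Set.image_univ, Set.ncard_image_of_injective _ h.injective]
    simp [Set.ncard_univ]
  rw [← h1]
  exact Set.ncard_le_ncard (by rintro _ ⟨i, rfl⟩; exact h.mem_vertexSet i) hV

theorem bddAbove_parade {G : Graph α β} (hV : G.vertexSet.Finite) :
    BddAbove {m | ∃ (u v : α) (k : ℕ) (p : Fin (k + 1) → α) (q : Fin k → β),
      G.IsUniqueShortestPath u v k p q ∧ m = k + 1} := by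
  refine ⟨G.vertexSet.ncard, ?_⟩
  rintro m ⟨u, v, k, p, q, h, rfl⟩
  exact h.1.1.le_ncard hV

theorem IsUniqueShortestPath.spectatorNumber_le {G : Graph α β} (hV : G.vertexSet.Finite)
    {u v : α} {k : ℕ} {p : Fin (k + 1) → α} {q : Fin k → β}
    (h : G.IsUniqueShortestPath u v k p q) :
    G.spectatorNumber ≤ G.vertexSet.ncard - (k + 1) :=
  Nat.sub_le_sub_left (le_csSup (bddAbove_parade hV) ⟨u, v, k, p, q, h, rfl⟩) _

/-- The parade number is attained, single vertices being unique shortest paths. -/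
theorem IsMultigraph.exists_parade {G : Graph α β} (hG : G.IsMultigraph) :
    ∃ (u v : α) (k : ℕ) (p : Fin (k + 1) → α) (q : Fin k → β),
      G.IsUniqueShortestPath u v k p q ∧ G.paradeNumber = k + 1 := by
  refine Nat.sSup_mem ?_ (bddAbove_parade hG.finite_vertexSet)
  obtain ⟨x, hx⟩ := hG.nonempty
  refine ⟨1, x, x, 0, fun _ => x, Fin.elim0, ⟨⟨⟨fun _ => hx, fun i => i.elim0, rfl, rfl,
    fun i j _ => Fin.ext (by omega)⟩, fun _ _ _ _ => Nat.zero_le _⟩, ?_⟩, rfl⟩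
  intro p' q' h
  refine ⟨funext fun i => ?_, Subsingleton.elim _ _⟩
  obtain rfl : i = 0 := by omega
  exact h.first

/-- A height function `h` that changes by at most `1` along each edge certifies a unique shortest
path: a path that climbs one step at a time is shortest, and it is unique if at each of its vertices
there is only one edge that goes up. -/
theorem IsPathFromTo.isUniqueShortestPath {G : Graph α β} {u v : α} {k : ℕ}
    {p : Fin (k + 1) → α} {q : Fin k → β} (hp : G.IsPathFromTo u v k p q) (h : α → ℤ)
    (hh : ∀ i, h (p i) = (i : ℕ)) (lip : ∀ e x y, G.IsLink e x y → h y ≤ h x + 1)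
    (up : ∀ (i : Fin k) e y, G.IsLink e (p i.castSucc) y → h y = (i : ℕ) + 1 →
      y = p i.succ ∧ e = q i) : G.IsUniqueShortestPath u v k p q := by
  have upper : ∀ (l : ℕ) (p' : Fin (l + 1) → α) (q' : Fin l → β), G.IsPathFromTo u v l p' q' →
      ∀ n (hn : n < l + 1), h (p' ⟨n, hn⟩) ≤ n := by
    intro l p' q' h' n
    induction n with
    | zero =>
      intro _
      have : p' ⟨0, by omega⟩ = p 0 := h'.first.trans hp.first.symm
      rw [this, hh]
      simp
    | succ n ih =>
      intro hn
      have h1 := lip _ _ _ (h'.isLink ⟨n, by omega⟩)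
      have h2 := ih (by omega)
      simp only [Fin.castSucc_mk, Fin.succ_mk] at h1
      push_cast
      omega
  have last : ∀ (l : ℕ) (p' : Fin (l + 1) → α) (q' : Fin l → β), G.IsPathFromTo u v l p' q' →
      h (p' ⟨l, by omega⟩) = k := by
    intro l p' q' h'
    have : p' ⟨l, by omega⟩ = p (Fin.last k) := h'.last.trans hp.last.symm
    rw [this, hh]
    simp
  refine ⟨⟨hp, fun l p' q' h' => ?_⟩, fun p' q' h' => ?_⟩
  · have h1 := upper l p' q' h' l (by omega)
    rw [last l p' q' h'] at h1
    exact_mod_cast h1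
  · have lower : ∀ d (hd : d ≤ k), (k - d : ℤ) ≤ h (p' ⟨k - d, by omega⟩) := by
      intro d
      induction d with
      | zero =>
        intro _
        have := last k p' q' h'
        simp only [Nat.sub_zero, this]
        simp
      | succ d ih =>
        intro hd
        have h1 := lip _ _ _ (h'.isLink ⟨k - (d + 1), by omega⟩)
        have h2 := ih (by omega)
        have h3 : k - (d + 1) + 1 = k - d := by omega
        simp only [Fin.castSucc_mk, Fin.succ_mk, h3] at h1
        push_cast
        omega
    have height : ∀ n (hn : n < k + 1), h (p' ⟨n, hn⟩) = n := by
      intro n hn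
      have h1 := upper k p' q' h' n hn
      have h2 := lower (k - n) (by omega)
      have h3 : k - (k - n) = n := by omega
      simp only [h3] at h2
      push_cast [show n ≤ k by omega] at h2
      omega
    have hpe : ∀ n (hn : n < k + 1), p' ⟨n, hn⟩ = p ⟨n, hn⟩ := by
      intro n
      induction n with
      | zero => exact fun _ => h'.first.trans hp.first.symm
      | succ n ih =>
        intro hn
        have h1 := h'.isLink ⟨n, by omega⟩
        simp only [Fin.castSucc_mk, Fin.succ_mk, ih (by omega)] at h1
        exact (up ⟨n, by omega⟩ _ _ h1 (by rw [height]; push_cast; rfl)).1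
    refine ⟨funext fun i => hpe i i.2, funext fun i => ?_⟩
    have h1 := h'.isLink i
    have h2 : p' i.castSucc = p i.castSucc := hpe _ _
    rw [h2] at h1
    exact (up i _ _ h1 ((height (i + 1) (by omega)).trans (by push_cast; rfl))).2

/-- The defining properties of a unique shortest path, for sequences indexed by natural numbers. The
edge `e₀` only provides the terms of the edge sequence beyond its end. -/
theorem IsUniqueShortestPath.exists_seq {G : Graph α β} {u v : α} {k : ℕ}
    {p : Fin (k + 1) → α} {q : Fin k → β} (h : G.IsUniqueShortestPath u v k p q) (e₀ : β) :
    ∃ (P : ℕ → α) (Q : ℕ → β), (∀ i, p i = P i) ∧ (∀ n, P n ∈ G.vertexSet) ∧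
      (∀ n < k, G.IsLink (Q n) (P n) (P (n + 1))) ∧
      (∀ m ≤ k, ∀ n ≤ k, P m = P n → m = n) ∧
      (∀ (l : ℕ) (P' : ℕ → α) (Q' : ℕ → β), (∀ n, P' n ∈ G.vertexSet) →
        (∀ n < l, G.IsLink (Q' n) (P' n) (P' (n + 1))) →
        (∀ m ≤ l, ∀ n ≤ l, P' m = P' n → m = n) → P' 0 = P 0 → P' l = P k →
        k ≤ l ∧ (l = k → (∀ n ≤ k, P' n = P n) ∧ ∀ n < k, Q' n = Q n)) := by
  obtain ⟨⟨hp, hmin⟩, huniq⟩ := h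
  refine ⟨fun n => p ⟨min n k, by omega⟩, fun n => if hn : n < k then q ⟨n, hn⟩ else e₀,
    ?_, fun n => hp.mem_vertexSet _, ?_, ?_, ?_⟩
  · intro i
    congr 1
    ext
    simp only
    omega
  · intro n hn
    have := hp.isLink ⟨n, hn⟩
    simp only [Fin.castSucc_mk, Fin.succ_mk] at this
    simpa [hn, hn.le, Nat.min_eq_left (Nat.succ_le_of_lt hn)] using this
  · intro m hm n hn hmn
    have := hp.injective hmn
    simp only [Fin.mk.injEq] at this
    omega
  · intro l P' Q' hV hl hi h0 h1
    have hp' : G.IsPathFromTo u v l (fun i => P' i) (fun i => Q' i) := by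
      refine ⟨fun i => hV _, fun i => by simpa using hl i i.2, ?_, ?_, ?_⟩
      · simp only [Fin.val_zero, h0, ← hp.first]
        congr 1
      · simp only [Fin.val_last, h1, ← hp.last]
        congr 1
        ext
        simp
      · intro i j hij
        exact Fin.ext (hi _ (by omega) _ (by omega) hij)
    refine ⟨hmin _ _ _ hp', ?_⟩
    rintro rfl
    obtain ⟨e1, e2⟩ := huniq _ _ hp'
    constructor
    · intro n hn
      have := congrFun e1 ⟨n, by omega⟩
      simp only at this
      rw [this]
      congr 1
      ext
      simp only
      omega
    · intro n hn
      have := congrFun e2 ⟨n, hn⟩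
      simpa [hn] using this

/-- The only edges between vertices of a unique shortest path are its own: any other edge would
provide a shortcut or a second path of the same length. -/
theorem eq_of_isLink_of_shortest {G : Graph α β} {k : ℕ} {P : ℕ → α} {Q : ℕ → β}
    (hV : ∀ n, P n ∈ G.vertexSet) (hl : ∀ n < k, G.IsLink (Q n) (P n) (P (n + 1)))
    (hi : ∀ m ≤ k, ∀ n ≤ k, P m = P n → m = n)
    (hmin : ∀ (l : ℕ) (P' : ℕ → α) (Q' : ℕ → β), (∀ n, P' n ∈ G.vertexSet) →
      (∀ n < l, G.IsLink (Q' n) (P' n) (P' (n + 1))) →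
      (∀ m ≤ l, ∀ n ≤ l, P' m = P' n → m = n) → P' 0 = P 0 → P' l = P k →
      k ≤ l ∧ (l = k → (∀ n ≤ k, P' n = P n) ∧ ∀ n < k, Q' n = Q n))
    {i j : ℕ} (hij : i < j) (hj : j ≤ k) {e : β} (he : G.IsLink e (P i) (P j)) :
    j = i + 1 ∧ e = Q i := by
  obtain ⟨d, rfl⟩ : ∃ d, j = i + 1 + d := ⟨j - (i + 1), by omega⟩
  have key := hmin (k - d) (fun n => if n ≤ i then P n else P (n + d))
    (fun n => if n < i then Q n else if n = i then e else Q (n + d)) ?_ ?_ ?_ ?_ ?_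
  · obtain ⟨h1, h2⟩ := key
    obtain rfl : d = 0 := by omega
    have := (h2 (by omega)).2 i (by omega)
    simpa using this
  · intro n
    split_ifs <;> exact hV _
  · intro n hn
    rcases lt_trichotomy n i with h | h | h
    · simpa [h, h.le, Nat.succ_le_of_lt h] using hl n (by omega)
    · subst h
      simpa using he
    · have := hl (n + d) (by omega)
      simpa [h.not_ge, h.not_gt, h.ne', (h.trans (Nat.lt_succ_self n)).not_ge, add_right_comm]
        using this
  · intro m hm n hn hmn
    split_ifs at hmn with h1 h2 h2 <;> have := hi _ (by omega) _ (by omega) hmn <;> omega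
  · simp
  · simp only [show ¬ k - d ≤ i by omega, if_false]
    congr 1
    omega

/-- The neighbours of a vertex outside of a unique shortest path on this path are consecutive. -/
theorem eq_of_isLink_isLink_of_shortest {G : Graph α β} {k : ℕ} {P : ℕ → α} {Q : ℕ → β}
    (hV : ∀ n, P n ∈ G.vertexSet) (hl : ∀ n < k, G.IsLink (Q n) (P n) (P (n + 1)))
    (hi : ∀ m ≤ k, ∀ n ≤ k, P m = P n → m = n)
    (hmin : ∀ (l : ℕ) (P' : ℕ → α) (Q' : ℕ → β), (∀ n, P' n ∈ G.vertexSet) →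
      (∀ n < l, G.IsLink (Q' n) (P' n) (P' (n + 1))) →
      (∀ m ≤ l, ∀ n ≤ l, P' m = P' n → m = n) → P' 0 = P 0 → P' l = P k →
      k ≤ l ∧ (l = k → (∀ n ≤ k, P' n = P n) ∧ ∀ n < k, Q' n = Q n))
    {i j : ℕ} (hij : i < j) (hj : j ≤ k) {e f : β} {w : α} (hw : ∀ n ≤ k, P n ≠ w)
    (he : G.IsLink e (P i) w) (hf : G.IsLink f w (P j)) : j = i + 1 := by
  by_contra hne
  obtain ⟨d, rfl⟩ : ∃ d, j = i + 2 + d := ⟨j - (i + 2), by omega⟩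
  have key := hmin (k - d) (fun n => if n ≤ i then P n else if n = i + 1 then w else P (n + d))
    (fun n => if n < i then Q n else if n = i then e else if n = i + 1 then f else Q (n + d))
    ?_ ?_ ?_ ?_ ?_
  · obtain ⟨h1, h2⟩ := key
    obtain rfl : d = 0 := by omega
    have := (h2 (by omega)).1 (i + 1) (by omega)
    simp only [show ¬ i + 1 ≤ i by omega, if_false, if_true] at this
    exact hw _ (by omega) this.symm
  · intro n
    split_ifs
    · exact hV _
    · exact he.right_mem
    · exact hV _
  · intro n hn
    rcases lt_trichotomy n i with h | h | h
    · simpa [h, h.le, Nat.succ_le_of_lt h] using hl n (by omega)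
    · subst h
      simpa using he
    · rcases eq_or_ne n (i + 1) with rfl | h'
      · simpa [add_right_comm] using hf
      · have := hl (n + d) (by omega)
        simp only [show ¬ n < i by omega, show ¬ n = i by omega, h', show ¬ n ≤ i by omega,
          show ¬ n + 1 ≤ i by omega, show ¬ n + 1 = i + 1 by omega, if_false]
        rwa [add_right_comm]
  · intro m hm n hn hmn
    split_ifs at hmn with h1 h2 h3 h3 h4 h5 h6 h6
    all_goals first
      | omega
      | exact absurd hmn (hw _ (by omega))
      | exact absurd hmn.symm (hw _ (by omega))
      | (have := hi _ (by omega) _ (by omega) hmn; omega)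
  · simp
  · simp only [show ¬ k - d ≤ i by omega, show ¬ k - d = i + 1 by omega, if_false]
    congr 1
    omega

/-- A graph with a unique shortest path that misses at most one vertex is a subgraph of the host
with the apex `none`, where the missed vertex is placed. -/
theorem IsMultigraph.fitsHost_of_spectatorNumber_le_one {G : Graph α β} (hG : G.IsMultigraph)
    (hs : G.spectatorNumber ≤ 1) : FitsHost true G := by
  classical
  obtain ⟨u, v, k, p, q, h, hk⟩ := hG.exists_parade
  by_cases hE : G.edgeSet = ∅
  · -- Without edges, any injection into the integers will do.
    have : Countable G.vertexSet := hG.finite_vertexSet.countable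
    obtain ⟨g, hg⟩ := exists_injective_nat G.vertexSet
    refine ⟨fun x => if hx : x ∈ G.vertexSet then some (g ⟨x, hx⟩) else none, ?_, ?_, ?_⟩
    · intro x hx y hy hxy
      simp only [hx, hy, dite_true, Option.some.injEq, Nat.cast_inj] at hxy
      exact congrArg Subtype.val (hg hxy)
    · intro e x y he
      exact absurd he.edge_mem (by simp [hE])
    · intro e f x y he
      exact absurd he.edge_mem (by simp [hE])
  obtain ⟨e₀, -⟩ := Set.nonempty_iff_ne_empty.2 hE
  obtain ⟨P, Q, hpP, hV, hl, hi, hmin⟩ := h.exists_seq e₀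
  -- At most one vertex is missed.
  have hoff : ∀ x ∈ G.vertexSet, ∀ y ∈ G.vertexSet, (∀ n ≤ k, P n ≠ x) → (∀ n ≤ k, P n ≠ y) →
      x = y := by
    intro x hx y hy hPx hPy
    by_contra hxy
    have hinj : Function.Injective p := h.1.1.injective
    have h1 : (Set.range p).ncard = k + 1 := by
      rw [← Set.image_univ, Set.ncard_image_of_injective _ hinj]
      simp [Set.ncard_univ]
    have hx' : x ∉ Set.range p := by
      rintro ⟨i, hi⟩
      exact hPx i (by omega) ((hpP i).symm.trans hi)
    have hy' : y ∉ insert x (Set.range p) := by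
      rintro (hyx | ⟨i, hi⟩)
      · exact hxy hyx.symm
      · exact hPy i (by omega) ((hpP i).symm.trans hi)
    have h2 : (insert y (insert x (Set.range p))).ncard = k + 3 := by
      rw [Set.ncard_insert_of_notMem hy', Set.ncard_insert_of_notMem hx', h1]
    have h3 : insert y (insert x (Set.range p)) ⊆ G.vertexSet := by
      rintro z (rfl | rfl | ⟨i, rfl⟩)
      · exact hy
      · exact hx
      · exact h.1.1.mem_vertexSet i
    have h4 := Set.ncard_le_ncard h3 hG.finite_vertexSet
    unfold spectatorNumber at hs
    omega
  have hshort : ∀ i ≤ k, ∀ j ≤ k, ∀ e, G.IsLink e (P i) (P j) →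
      (j = i + 1 ∧ e = Q i) ∨ (i = j + 1 ∧ e = Q j) := by
    intro i hik j hjk e he
    rcases lt_trichotomy i j with hij | hij | hij
    · exact Or.inl (eq_of_isLink_of_shortest hV hl hi hmin hij hjk he)
    · subst hij
      exact absurd he hG.not_isLink_self
    · exact Or.inr (eq_of_isLink_of_shortest hV hl hi hmin hij hik he.symm)
  -- The first neighbour `P a` of the missed vertex, if there is one, is placed at `0`.
  obtain ⟨a, ha⟩ : ∃ a : ℕ, ∀ w, (∀ n ≤ k, P n ≠ w) → ∀ j ≤ k, ∀ e, G.IsLink e w (P j) →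
      j = a ∨ j = a + 1 := by
    by_cases hw : ∃ j, j ≤ k ∧ ∃ w e, (∀ n ≤ k, P n ≠ w) ∧ G.IsLink e w (P j)
    · refine ⟨Nat.find hw, fun w hPw j hjk e he => ?_⟩
      obtain ⟨h1, w', e', hPw', he'⟩ := Nat.find_spec hw
      obtain rfl := hoff w he.left_mem w' he'.left_mem hPw hPw'
      have h2 : Nat.find hw ≤ j := Nat.find_min' hw ⟨hjk, w, e, hPw, he⟩
      rcases h2.eq_or_lt with h3 | h3
      · exact Or.inl h3.symm
      · exact Or.inr (eq_of_isLink_isLink_of_shortest hV hl hi hmin h3 hjk hPw he'.symm he)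
    · exact ⟨0, fun w hPw j hjk e he => absurd ⟨j, hjk, w, e, hPw, he⟩ hw⟩
  set g : α → Option ℤ := fun x =>
    if hx : ∃ n, n ≤ k ∧ P n = x then some ((Nat.find hx : ℤ) - a) else none with hg
  have hgP : ∀ n ≤ k, g (P n) = some ((n : ℤ) - a) := by
    intro n hn
    have hx : ∃ m, m ≤ k ∧ P m = P n := ⟨n, hn, rfl⟩
    simp only [hg, dif_pos hx]
    rw [hi _ (Nat.find_spec hx).1 _ hn (Nat.find_spec hx).2]
  have hgn : ∀ x, (∀ n ≤ k, P n ≠ x) → g x = none := by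
    intro x hx
    simp only [hg]
    rw [dif_neg]
    rintro ⟨n, hn, h⟩
    exact hx n hn h
  clear_value g
  have hcases : ∀ x, (∃ n ≤ k, x = P n) ∨ ∀ n ≤ k, P n ≠ x := by
    intro x
    by_cases hx : ∃ n ≤ k, x = P n
    · exact Or.inl hx
    · exact Or.inr fun n hn h => hx ⟨n, hn, h.symm⟩
  refine ⟨g, ?_, ?_, ?_⟩
  · intro x hx y hy hxy
    rcases hcases x with ⟨m, hm, rfl⟩ | hx' <;> rcases hcases y with ⟨n, hn, rfl⟩ | hy'
    · rw [hgP m hm, hgP n hn, Option.some.injEq] at hxy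
      rw [show m = n by omega]
    · rw [hgP m hm, hgn y hy'] at hxy
      simp at hxy
    · rw [hgP n hn, hgn x hx'] at hxy
      simp at hxy
    · exact hoff x hx y hy hx' hy'
  · intro e x y he
    rcases hcases x with ⟨m, hm, rfl⟩ | hx' <;> rcases hcases y with ⟨n, hn, rfl⟩ | hy'
    · rw [hgP m hm, hgP n hn]
      simp only [HostAdj]
      rcases hshort m hm n hn e he with ⟨h, -⟩ | ⟨h, -⟩ <;> omega
    · rw [hgP m hm, hgn y hy']
      have := ha y hy' m hm e he.symm
      exact ⟨rfl, by omega⟩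
    · rw [hgP n hn, hgn x hx']
      have := ha x hx' n hn e he
      exact ⟨rfl, by omega⟩
    · obtain rfl := hoff x he.left_mem y he.right_mem hx' hy'
      exact absurd he hG.not_isLink_self
  · intro e f x y he hf hef
    refine Or.inl ⟨rfl, ?_⟩
    rcases hcases x with ⟨m, hm, rfl⟩ | hx'
    · rcases hcases y with ⟨n, hn, rfl⟩ | hy'
      · rcases hshort m hm n hn e he with ⟨h1, h2⟩ | ⟨h1, h2⟩ <;>
        rcases hshort m hm n hn f hf with ⟨h3, h4⟩ | ⟨h3, h4⟩
        · exact absurd (h2.trans h4.symm) hef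
        · omega
        · omega
        · exact absurd (h2.trans h4.symm) hef
      · exact Or.inr (hgn y hy')
    · exact Or.inl (hgn x hx')

/-! ### Upper bounds for the spectator floor -/

/-- The graph with vertices `0, …, n - 1` and edges `0, …, m - 1`, the edge `e` joining `a e` and
`b e`. Edges with an end that is not a vertex are left out. -/
def natGraph (n m : ℕ) (a b : ℕ → ℕ) : Graph ℕ ℕ where
  vertexSet := {x | x < n}
  IsLink e x y := e < m ∧ x < n ∧ y < n ∧ (x = a e ∧ y = b e ∨ x = b e ∧ y = a e)
  isLink_symm _ _ := ⟨fun _ _ h => ⟨h.1, h.2.2.1, h.2.1, by tauto⟩⟩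
  eq_or_eq_of_isLink_of_isLink := by
    rintro e x y v w ⟨-, -, -, h⟩ ⟨-, -, -, h'⟩
    omega
  left_mem_of_isLink _ _ _ h := h.2.1

theorem natGraph_isLink {n m : ℕ} {a b : ℕ → ℕ} {e x y : ℕ} : (natGraph n m a b).IsLink e x y ↔
    e < m ∧ x < n ∧ y < n ∧ (x = a e ∧ y = b e ∨ x = b e ∧ y = a e) := Iff.rfl

theorem natGraph_isMultigraph {n m : ℕ} {a b : ℕ → ℕ} (hn : 0 < n) (h : ∀ e < m, a e ≠ b e) :
    (natGraph n m a b).IsMultigraph where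
  loopless := ⟨fun e x hx => by
    obtain ⟨he, -, -, h'⟩ := natGraph_isLink.1 (isLink_self_iff.2 hx)
    have := h e he
    omega⟩
  finite_vertexSet := Set.finite_lt_nat n
  finite_edgeSet := (Set.finite_lt_nat m).subset fun e he => by
    obtain ⟨x, y, hl⟩ := exists_isLink_of_mem_edgeSet he
    exact hl.1
  nonempty := ⟨0, hn⟩

/-- The path `0, …, k` with the edges `0, …, k - 1` is a unique shortest path if there is a height
function as in `IsPathFromTo.isUniqueShortestPath`. -/
theorem natGraph_spectatorNumber_le {n m : ℕ} {a b : ℕ → ℕ} (k : ℕ) (hk : k < n) (hkm : k ≤ m)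
    (h : ℕ → ℕ) (hpath : ∀ i < k, a i = i ∧ b i = i + 1) (hh : ∀ i < k + 1, h i = i)
    (lip : ∀ e < m, h (a e) ≤ h (b e) + 1 ∧ h (b e) ≤ h (a e) + 1)
    (up : ∀ e < m, (a e < k → h (b e) = a e + 1 → b e = a e + 1 ∧ e = a e) ∧
      (b e < k → h (a e) = b e + 1 → a e = b e + 1 ∧ e = b e)) :
    (natGraph n m a b).spectatorNumber ≤ n - (k + 1) := by
  have hp : (natGraph n m a b).IsPathFromTo 0 k k (fun i => i) (fun i => i) := by
    refine ⟨fun i => ?_, fun i => ?_, rfl, by simp, fun i j hij => Fin.ext hij⟩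
    · exact (Nat.lt_succ_iff.1 i.2).trans_lt hk
    · have := hpath i i.2
      rw [natGraph_isLink]
      simp only [Fin.val_castSucc, Fin.val_succ]
      omega
  have hcard : (natGraph n m a b).vertexSet.ncard = n := by
    change {x | x < n}.ncard = n
    rw [show {x | x < n} = ((Finset.range n : Finset ℕ) : Set ℕ) by ext; simp, Set.ncard_coe_finset,
      Finset.card_range]
  have := (hp.isUniqueShortestPath (fun x => (h x : ℤ)) (fun i => by simpa using hh i i.2)
    ?_ ?_).spectatorNumber_le (Set.finite_lt_nat n)
  · rwa [hcard] at this
  · intro e x y hl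
    obtain ⟨he, -, -, ⟨rfl, rfl⟩ | ⟨rfl, rfl⟩⟩ := natGraph_isLink.1 hl <;> have := lip e he <;> omega
  · intro i e y hl hy
    have hi := i.2
    obtain ⟨he, -, -, ⟨h1, rfl⟩ | ⟨h1, rfl⟩⟩ := natGraph_isLink.1 hl <;> have := up e he <;>
      simp only [Fin.val_castSucc, Fin.val_succ] at h1 hy ⊢ <;> omega

theorem spectatorFloor_le {G : Graph α β} {H : Graph ℕ ℕ} (hH : H.IsMultigraph)
    (h : G.IsMinorOf H) : G.spectatorFloor ≤ H.spectatorNumber :=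
  Nat.sInf_le ⟨H, hH, h, rfl⟩

theorem spectatorFloor_congr {G : Graph α β} {G' : Graph α' β'} (h : G.Isomorphic G') :
    G.spectatorFloor = G'.spectatorFloor := by
  unfold spectatorFloor
  congr 1
  ext s
  exact ⟨fun ⟨H, h1, h2, h3⟩ => ⟨H, h1, h2.of_isomorphic h.symm, h3⟩,
    fun ⟨H, h1, h2, h3⟩ => ⟨H, h1, h2.of_isomorphic h, h3⟩⟩

/-- A path `0, …, N` and a vertex `N + 1` all of whose edges go to `K` or `K + 1` have spectator
number at most `1`. -/
theorem spectatorNumber_pathWithApex_le {N M K : ℕ} (hK : K < N) (b : ℕ → ℕ)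
    (hb : ∀ e, N ≤ e → b e = K ∨ b e = K + 1) (hb' : ∀ e < N, b e = e + 1) :
    (natGraph (N + 2) (N + M) (fun e => if e < N then e else N + 1) b).IsMultigraph ∧
    (natGraph (N + 2) (N + M) (fun e => if e < N then e else N + 1) b).spectatorNumber ≤ 1 := by
  have hcases : ∀ e, (e < N ∧ b e = e + 1) ∨ (N ≤ e ∧ (b e = K ∨ b e = K + 1)) := by
    intro e
    rcases lt_or_ge e N with h | h
    · exact Or.inl ⟨h, hb' e h⟩
    · exact Or.inr ⟨h, hb e h⟩
  constructor
  · refine natGraph_isMultigraph (by omega) fun e _ => ?_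
    have := hcases e
    split_ifs <;> omega
  · refine (natGraph_spectatorNumber_le N (by omega) (by omega)
      (fun x => if x = N + 1 then K else x) ?_ ?_ ?_ ?_).trans (by omega)
    · intro i hi
      simp [hi, hb' i hi]
    · intro i hi
      simp [show i ≠ N + 1 by omega]
    · intro e _
      have := hcases e
      split_ifs <;> omega
    · intro e _
      have := hcases e
      split_ifs <;> omega

theorem exists_injOn_lt_of_finite {E : Set β} (hE : E.Finite) :
    ∃ (ι : β → ℕ) (M : ℕ), Set.InjOn ι E ∧ ∀ e ∈ E, ι e < M := by
  obtain ⟨ι, hι⟩ := Set.countable_iff_exists_injOn.1 hE.countable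
  obtain ⟨M, hM⟩ := (hE.image ι).bddAbove
  exact ⟨ι, M + 1, hι, fun e he => Nat.lt_succ_of_le (hM ⟨e, he, rfl⟩)⟩

theorem exists_bound_of_finite {V : Set α} (hV : V.Finite) (g : α → Option ℤ) :
    ∃ K : ℕ, ∀ x ∈ V, ∀ i, g x = some i → -(K : ℤ) ≤ i ∧ i ≤ K := by
  obtain ⟨K, hK⟩ := (hV.image fun x => ((g x).getD 0).natAbs).bddAbove
  refine ⟨K, fun x hx i hi => ?_⟩
  have : ((g x).getD 0).natAbs ≤ K := hK ⟨x, hx, rfl⟩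
  rw [hi, Option.getD_some] at this
  omega

/-- An embedding can be given by a vertex map and a choice, for each edge, of one among possibly
several admissible images, as long as different edges never admit the same image. -/
theorem Embeds.of_forall_exists {G : Graph α β} {H : Graph α' ℕ} (φ : α → α')
    (h1 : Set.MapsTo φ G.vertexSet H.vertexSet) (h2 : Set.InjOn φ G.vertexSet)
    (P : β → ℕ → Prop)
    (h3 : ∀ e x y, G.IsLink e x y → ∃ c, P e c ∧ H.IsLink c (φ x) (φ y))
    (h4 : ∀ c e f, e ∈ G.edgeSet → f ∈ G.edgeSet → P e c → P f c →
      (∀ x y, G.IsLink e x y → G.IsLink f x y) → e = f) : G.Embeds H := by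
  have h5 : ∀ e, ∃ c, ∀ x y, G.IsLink e x y → P e c ∧ H.IsLink c (φ x) (φ y) := by
    intro e
    by_cases he : e ∈ G.edgeSet
    · obtain ⟨x, y, h⟩ := exists_isLink_of_mem_edgeSet he
      obtain ⟨c, hc, hl⟩ := h3 e x y h
      refine ⟨c, fun x' y' h' => ⟨hc, ?_⟩⟩
      rcases h.eq_and_eq_or_eq_and_eq h' with ⟨rfl, rfl⟩ | ⟨rfl, rfl⟩
      · exact hl
      · exact hl.symm
    · exact ⟨0, fun x y h => absurd h.edge_mem he⟩
  choose ψ hψ using h5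
  refine ⟨φ, ψ, h1, h2, ?_, fun e x y h => (hψ e x y h).2⟩
  intro e he f hf hef
  obtain ⟨x, y, hexy⟩ := exists_isLink_of_mem_edgeSet he
  obtain ⟨z, w, hfzw⟩ := exists_isLink_of_mem_edgeSet hf
  obtain ⟨p1, l1⟩ := hψ e x y hexy
  obtain ⟨p2, l2⟩ := hψ f z w hfzw
  rw [← hef] at p2 l2
  refine h4 _ e f he hf p1 p2 ?_
  have hfxy : G.IsLink f x y := by
    rcases l1.eq_and_eq_or_eq_and_eq l2 with ⟨h, h'⟩ | ⟨h, h'⟩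
    · rwa [h2 hexy.left_mem hfzw.left_mem h, h2 hexy.right_mem hfzw.right_mem h']
    · rw [h2 hexy.left_mem hfzw.right_mem h, h2 hexy.right_mem hfzw.left_mem h']
      exact hfzw.symm
  intro x' y' h'
  rcases hexy.eq_and_eq_or_eq_and_eq h' with ⟨rfl, rfl⟩ | ⟨rfl, rfl⟩
  · exact hfxy
  · exact hfxy.symm

theorem FitsHost.spectatorFloor_le_one_of_apex {G : Graph α β} (hV : G.vertexSet.Finite)
    (hE : G.edgeSet.Finite) (h : FitsHost true G) : G.spectatorFloor ≤ 1 := by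
  obtain ⟨g, h1, h2, h3⟩ := h
  obtain ⟨ι, M, hι, hM⟩ := exists_injOn_lt_of_finite hE
  obtain ⟨K, hK⟩ := exists_bound_of_finite hV g
  set N := 2 * K + 1 with hN
  -- Two edges are reserved for the edge of `G` with number `i`: the edge `N + 2 * i` joins the apex
  -- `N + 1` to `K`, and the edge `N + 2 * i + 1` joins it to `K + 1`.
  obtain ⟨hH, hs⟩ := spectatorNumber_pathWithApex_le (N := N) (M := 2 * M) (K := K) (by omega)
    (fun e => if e < N then e + 1 else K + (e - N) % 2)
    (fun e he => by simp only [he.not_gt, if_false]; omega) (fun e he => by simp [he])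
  refine (spectatorFloor_le hH (Embeds.isMinorOf ?_ hH.finite_vertexSet hH.finite_edgeSet)).trans hs
  set φ : α → ℕ := fun x => match g x with
    | some i => (i + K).toNat
    | none => N + 1 with hφ
  have hφs : ∀ x ∈ G.vertexSet, ∀ i, g x = some i → (φ x : ℤ) = i + K ∧ φ x < N := by
    intro x hx i hi
    have := hK x hx i hi
    simp only [hφ, hi]
    omega
  have hφn : ∀ x, g x = none → φ x = N + 1 := by
    intro x hx
    simp only [hφ, hx]
  clear_value φ
  refine Embeds.of_forall_exists φ ?_ ?_
    (fun e c => (c < N ∧ ∀ x y, G.IsLink e x y → g x ≠ none ∧ g y ≠ none) ∨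
      (N ≤ c ∧ (c - N) / 2 = ι e)) ?_ ?_
  · intro x hx
    change φ x < N + 2
    rcases hgx : g x with _ | i
    · rw [hφn x hgx]
      omega
    · have := hφs x hx i hgx
      omega
  · intro x hx y hy hxy
    refine h1 hx hy ?_
    rcases hgx : g x with _ | i <;> rcases hgy : g y with _ | j
    · rfl
    · have := hφn x hgx
      have := hφs y hy j hgy
      omega
    · have := hφn y hgy
      have := hφs x hx i hgx
      omega
    · have := hφs x hx i hgx
      have := hφs y hy j hgy
      rw [Option.some.injEq]
      omega
  · intro e x y he
    have hadj := h2 e x y he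
    have hMe := hM e he.edge_mem
    have hif : ∀ c : ℕ, N ≤ c → (if c < N then c else N + 1) = N + 1 ∧
        (if c < N then c + 1 else K + (c - N) % 2) = K + (c - N) % 2 := by
      intro c hc
      simp [hc.not_gt]
    rcases hgx : g x with _ | i <;> rcases hgy : g y with _ | j <;> rw [hgx, hgy] at hadj
    · exact hadj.elim
    · have e1 := hφn x hgx
      have e2 := hφs y he.right_mem j hgy
      have e3 := hadj.2
      obtain ⟨t, ht, htj⟩ : ∃ t : ℕ, t < 2 ∧ (t : ℤ) = j := ⟨j.toNat, by omega, by omega⟩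
      refine ⟨N + (2 * ι e + t), Or.inr ⟨by omega, by omega⟩, ?_⟩
      rw [natGraph_isLink, (hif _ (Nat.le_add_right _ _)).1, (hif _ (Nat.le_add_right _ _)).2]
      omega
    · have e1 := hφn y hgy
      have e2 := hφs x he.left_mem i hgx
      have e3 := hadj.2
      obtain ⟨t, ht, htj⟩ : ∃ t : ℕ, t < 2 ∧ (t : ℤ) = i := ⟨i.toNat, by omega, by omega⟩
      refine ⟨N + (2 * ι e + t), Or.inr ⟨by omega, by omega⟩, ?_⟩
      rw [natGraph_isLink, (hif _ (Nat.le_add_right _ _)).1, (hif _ (Nat.le_add_right _ _)).2]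
      omega
    · have e1 := hφs x he.left_mem i hgx
      have e2 := hφs y he.right_mem j hgy
      simp only [HostAdj] at hadj
      refine ⟨min (φ x) (φ y), Or.inl ⟨by omega, ?_⟩, ?_⟩
      · intro x' y' he'
        rcases he.eq_and_eq_or_eq_and_eq he' with ⟨rfl, rfl⟩ | ⟨rfl, rfl⟩ <;> simp [hgx, hgy]
      · rw [natGraph_isLink]
        simp only [show min (φ x) (φ y) < N by omega, if_true]
        omega
  · rintro c e f he hf (⟨hc, hne⟩ | ⟨hc, hce⟩) (⟨hc', hnf⟩ | ⟨hc', hcf⟩) hpar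
    · by_contra hef
      obtain ⟨x, y, hl⟩ := exists_isLink_of_mem_edgeSet he
      have := h3 e f x y hl (hpar _ _ hl) hef
      simp [HostThick, hne x y hl] at this
    · omega
    · omega
    · exact hι he hf (hce.symm.trans hcf)

theorem FitsHost.spectatorFloor_le_one_of_not_apex {G : Graph α β} (hV : G.vertexSet.Finite)
    (hE : G.edgeSet.Finite) (h : FitsHost false G) : G.spectatorFloor ≤ 1 := by
  obtain ⟨g, h1, h2, h3⟩ := h
  obtain ⟨ι, M, hι, hM⟩ := exists_injOn_lt_of_finite hE
  obtain ⟨K, hK⟩ := exists_bound_of_finite hV g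
  set N := 2 * K + 1 with hN
  -- The edge `N` joins `K` to the apex `N + 1`, and the following ones join `K + 1` to the apex.
  -- Contracting the edge `N` makes the latter parallel to the edge `K` of the path.
  obtain ⟨hH, hs⟩ := spectatorNumber_pathWithApex_le (N := N) (M := 1 + M) (K := K) (by omega)
    (fun e => if e < N then e + 1 else if e = N then K else K + 1)
    (fun e he => by simp only [he.not_gt, if_false]; split_ifs <;> omega)
    (fun e he => by simp [he])
  set H := natGraph (N + 2) (N + (1 + M)) (fun e => if e < N then e else N + 1)
    (fun e => if e < N then e + 1 else if e = N then K else K + 1) with hHdef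
  have hlink : ∀ e x y, H.IsLink e x y ↔ e < N + (1 + M) ∧ x < N + 2 ∧ y < N + 2 ∧
      ((e < N ∧ (x = e ∧ y = e + 1 ∨ x = e + 1 ∧ y = e)) ∨
      (e = N ∧ (x = N + 1 ∧ y = K ∨ x = K ∧ y = N + 1)) ∨
      (N < e ∧ (x = N + 1 ∧ y = K + 1 ∨ x = K + 1 ∧ y = N + 1))) := by
    intro e x y
    rw [hHdef, natGraph_isLink]
    rcases lt_trichotomy e N with h | h | h
    · simp only [if_pos h]
      omega
    · simp only [if_neg (show ¬ e < N by omega), if_pos h]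
      omega
    · simp only [if_neg h.not_gt, if_neg h.ne']
      omega
  have hc : IsElementaryMinor (H.contractLink N K (N + 1)) H := by
    refine .contractEdge N K (N + 1) ?_ ?_ rfl
    · rw [hlink]
      omega
    · intro f hf
      rw [hlink] at hf
      omega
  obtain ⟨hcV, hcE⟩ := hc.finite hH.finite_vertexSet hH.finite_edgeSet
  refine (spectatorFloor_le hH (IsMinorOf.trans_reflTransGen (H := H.contractLink N K (N + 1))
    (Embeds.isMinorOf ?_ hcV hcE) (.single hc))).trans hs
  have hclink : ∀ e x y, H.IsLink e x y → e ≠ N →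
      (H.contractLink N K (N + 1)).IsLink e (if x = N + 1 then K else x)
        (if y = N + 1 then K else y) := by
    intro e x y h hne
    rw [contractLink_isLink]
    exact ⟨x, y, ⟨h, hne⟩, by congr, by congr⟩
  have hsome : ∀ x y e, G.IsLink e x y → ∃ i j, g x = some i ∧ g y = some j ∧
      (i = j + 1 ∨ j = i + 1) := by
    intro x y e he
    have hadj := h2 e x y he
    rcases hgx : g x with _ | i <;> rcases hgy : g y with _ | j <;> rw [hgx, hgy] at hadj <;>
      simp [HostAdj] at hadj
    exact ⟨i, j, rfl, rfl, hadj⟩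
  set φ : α → ℕ := fun x => match g x with
    | some i => (i + K).toNat
    | none => N with hφ
  have hφs : ∀ x ∈ G.vertexSet, ∀ i, g x = some i → (φ x : ℤ) = i + K ∧ φ x < N := by
    intro x hx i hi
    have := hK x hx i hi
    simp only [hφ, hi]
    omega
  have hφn : ∀ x, g x = none → φ x = N := by
    intro x hx
    simp only [hφ, hx]
  clear_value φ
  refine Embeds.of_forall_exists φ ?_ ?_
    (fun e c => (c < N ∧ ∀ x y, G.IsLink e x y → ¬ HostThick false (g x) (g y)) ∨
      (N < c ∧ c - (N + 1) = ι e)) ?_ ?_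
  · intro x hx
    rw [mem_vertexSet_contractLink]
    have hlt : φ x < N + 1 := by
      rcases hgx : g x with _ | i
      · rw [hφn x hgx]
        omega
      · have := hφs x hx i hgx
        omega
    exact ⟨φ x, hlt.trans (by omega), by rw [if_neg hlt.ne]⟩
  · intro x hx y hy hxy
    refine h1 hx hy ?_
    rcases hgx : g x with _ | i <;> rcases hgy : g y with _ | j
    · rfl
    · have := hφn x hgx
      have := hφs y hy j hgy
      omega
    · have := hφn y hgy
      have := hφs x hx i hgx
      omega
    · have := hφs x hx i hgx
      have := hφs y hy j hgy
      rw [Option.some.injEq]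
      omega
  · intro e x y he
    have hMe := hM e he.edge_mem
    obtain ⟨i, j, hgx, hgy, hij⟩ := hsome x y e he
    have e1 := hφs x he.left_mem i hgx
    have e2 := hφs y he.right_mem j hgy
    by_cases hth : HostThick false (g x) (g y)
    · refine ⟨N + 1 + ι e, Or.inr ⟨by omega, by omega⟩, ?_⟩
      simp only [HostThick, hgx, hgy, Option.some.injEq, Bool.false_eq_true, false_and, true_and,
        false_or] at hth
      rcases hth with ⟨rfl, rfl⟩ | ⟨rfl, rfl⟩
      · have := hclink (N + 1 + ι e) (N + 1) (K + 1) (by rw [hlink]; omega) (by omega)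
        rw [if_pos rfl, if_neg (by omega)] at this
        rwa [show φ x = K by omega, show φ y = K + 1 by omega]
      · have := hclink (N + 1 + ι e) (N + 1) (K + 1) (by rw [hlink]; omega) (by omega)
        rw [if_pos rfl, if_neg (by omega)] at this
        rw [show φ x = K + 1 by omega, show φ y = K by omega]
        exact this.symm
    · refine ⟨min (φ x) (φ y), Or.inl ⟨by omega, ?_⟩, ?_⟩
      · intro x' y' he'
        rcases he.eq_and_eq_or_eq_and_eq he' with ⟨rfl, rfl⟩ | ⟨rfl, rfl⟩
        · exact hth
        · exact fun h => hth h.symm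
      · have := hclink (min (φ x) (φ y)) (φ x) (φ y) (by rw [hlink]; omega) (by omega)
        rwa [if_neg (by omega), if_neg (by omega)] at this
  · rintro c e f he hf (⟨hc, hne⟩ | ⟨hc, hce⟩) (⟨hc', hnf⟩ | ⟨hc', hcf⟩) hpar
    · by_contra hef
      obtain ⟨x, y, hl⟩ := exists_isLink_of_mem_edgeSet he
      exact hne x y hl (h3 e f x y hl (hpar _ _ hl) hef)
    · omega
    · omega
    · exact hι he hf (hce.symm.trans hcf)

theorem IsNearPath.spectatorFloor_le_one {G : Graph α β} (h : G.IsNearPath)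
    (hV : G.vertexSet.Finite) (hE : G.edgeSet.Finite) : G.spectatorFloor ≤ 1 := by
  obtain ⟨_ | _, h⟩ := h
  · exact h.spectatorFloor_le_one_of_not_apex hV hE
  · exact h.spectatorFloor_le_one_of_apex hV hE

theorem isNearPath_of_isMinorOf [Nonempty α'] [Nonempty β'] {G : Graph α β} {H : Graph α' β'}
    (hH : H.IsMultigraph) (hs : H.spectatorNumber ≤ 1) (h : G.IsMinorOf H) : G.IsNearPath := by
  obtain ⟨G', hG', hi⟩ := h
  exact (IsNearPath.of_reflTransGen ⟨true, hH.fitsHost_of_spectatorNumber_le_one hs⟩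
    hG').of_embeds hi.embeds

/-- A graph that is not a near-path has spectator floor at least `2`. The graph `H` shows that the
minimum that defines the spectator floor is taken over a nonempty set. -/
theorem spectatorFloor_eq_two {G : Graph α β} {H : Graph ℕ ℕ} (hG : ¬ G.IsNearPath)
    (hH : H.IsMultigraph) (hs : H.spectatorNumber ≤ 2) (h : G.IsMinorOf H) :
    G.spectatorFloor = 2 := by
  refine le_antisymm ((spectatorFloor_le hH h).trans hs) ?_
  obtain ⟨K, h1, h2, h3⟩ := Nat.sInf_mem (s := {s | ∃ H : Graph ℕ ℕ, H.IsMultigraph ∧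
    G.IsMinorOf H ∧ s = H.spectatorNumber}) ⟨_, H, hH, h, rfl⟩
  by_contra hlt
  change ¬ 2 ≤ sInf _ at hlt
  exact hG (isNearPath_of_isMinorOf h1 (by omega) h2)

/-! ### Graphs given by a list of edges -/

/-- The graph with vertices `0, …, n - 1` and the listed edges. -/
def edgeGraph {n m : ℕ} (l : Fin m → Fin n × Fin n) : Graph (Fin n) (Fin m) :=
  ofEnds fun e => s((l e).1, (l e).2)

theorem edgeGraph_isLink {n m : ℕ} {l : Fin m → Fin n × Fin n} {e : Fin m} {x y : Fin n} :
    (edgeGraph l).IsLink e x y ↔ (x = (l e).1 ∧ y = (l e).2) ∨ (x = (l e).2 ∧ y = (l e).1) := by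
  change s((l e).1, (l e).2) = s(x, y) ↔ _
  rw [Sym2.eq_iff]
  grind

theorem edgeGraph_isLink_self {n m : ℕ} (l : Fin m → Fin n × Fin n) (e : Fin m) :
    (edgeGraph l).IsLink e (l e).1 (l e).2 := edgeGraph_isLink.2 (Or.inl ⟨rfl, rfl⟩)

theorem isomorphic_edgeGraph {n m : ℕ} {G : Graph α β} {l : Fin m → Fin n × Fin n}
    (φ : Fin n → α) (ψ : Fin m → β) (hφ : Function.Injective φ) (hψ : Function.Injective ψ)
    (hV : Set.range φ = G.vertexSet) (hE : ∀ e ∈ G.edgeSet, e ∈ Set.range ψ)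
    (h : ∀ e, G.IsLink (ψ e) (φ (l e).1) (φ (l e).2)) : G.Isomorphic (edgeGraph l) := by
  have hE' : Set.range ψ = G.edgeSet := by
    refine Set.Subset.antisymm ?_ hE
    rintro _ ⟨e, rfl⟩
    exact (h e).edge_mem
  refine Isomorphic.symm ⟨(Equiv.Set.univ _).trans ((Equiv.ofInjective φ hφ).trans
    (Equiv.setCongr hV)), ((Equiv.setCongr ?_).trans (Equiv.Set.univ _)).trans
    ((Equiv.ofInjective ψ hψ).trans (Equiv.setCongr hE')), ?_⟩
  · ext e
    exact ⟨fun _ => Set.mem_univ _, fun _ => (edgeGraph_isLink_self l e).edge_mem⟩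
  · rintro ⟨e, he⟩ ⟨x, hx⟩ ⟨y, hy⟩
    rw [edgeGraph_isLink]
    change _ ↔ G.IsLink (ψ e) (φ x) (φ y)
    rw [(h e).isLink_iff, hφ.eq_iff, hφ.eq_iff, hφ.eq_iff, hφ.eq_iff]
    grind

theorem edgeGraph_embeds {n m : ℕ} {G : Graph α β} {l : Fin m → Fin n × Fin n}
    (φ : Fin n → α) (ψ : Fin m → β) (hφ : Function.Injective φ)
    (hV : ∀ i, φ i ∈ G.vertexSet) (h : ∀ e, G.IsLink (ψ e) (φ (l e).1) (φ (l e).2))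
    (hψ : ∀ e f, e < f → l e = l f ∨ l e = (l f).swap → ψ e ≠ ψ f) : (edgeGraph l).Embeds G := by
  refine ⟨φ, ψ, fun i _ => hV i, hφ.injOn, ?_, ?_⟩
  · intro e _ f _ hef
    have key : l e = l f ∨ l e = (l f).swap := by
      have h1 := h e
      rw [hef] at h1
      rcases h1.eq_and_eq_or_eq_and_eq (h f) with ⟨h2, h3⟩ | ⟨h2, h3⟩
      · exact Or.inl (Prod.ext (hφ h2) (hφ h3))
      · exact Or.inr (Prod.ext (hφ h2) (hφ h3))
    rcases lt_trichotomy e f with h1 | h1 | h1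
    · exact absurd hef (hψ e f h1 key)
    · exact h1
    · refine absurd hef.symm (hψ f e h1 ?_)
      rcases key with h2 | h2
      · exact Or.inl h2.symm
      · exact Or.inr (by rw [h2, Prod.swap_swap])
  · intro e x y hl
    rcases edgeGraph_isLink.1 hl with ⟨rfl, rfl⟩ | ⟨rfl, rfl⟩
    · exact h e
    · exact (h e).symm

/-- The elementary minors of a graph without isolated vertices are near-paths as soon as the graph
can be placed in the host with the exception of any one edge `e`, in two ways if `e` may be
contracted: with the ends of `e` apart, and with the ends of `e` on the same spot. -/
theorem isNearPath_of_isElementaryMinor_edgeGraph {n m : ℕ} {l : Fin m → Fin n × Fin n}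
    (del con : Fin m → Fin n → Option ℤ) (hinc : ∀ v, ∃ e, (l e).1 = v ∨ (l e).2 = v)
    (hdel : ∀ e, Function.Injective (del e) ∧
      (∀ f, f ≠ e → HostAdj true (del e (l f).1) (del e (l f).2)) ∧
      ∀ f f', f ≠ e → f' ≠ e → f ≠ f' → (del e (l f).1 = del e (l f').1 ∧
        del e (l f).2 = del e (l f').2 ∨ del e (l f).1 = del e (l f').2 ∧
        del e (l f).2 = del e (l f').1) → HostThick true (del e (l f).1) (del e (l f).2))
    (hcon : ∀ e, (∀ f, l f = l e → f = e) → con e (l e).1 = con e (l e).2 ∧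
      (∀ x y, con e x = con e y → x = y ∨ (x = (l e).1 ∧ y = (l e).2) ∨
        (x = (l e).2 ∧ y = (l e).1)) ∧
      (∀ f, f ≠ e → HostAdj true (con e (l f).1) (con e (l f).2)) ∧
      ∀ f f', f ≠ e → f' ≠ e → f ≠ f' → (con e (l f).1 = con e (l f').1 ∧
        con e (l f).2 = con e (l f').2 ∨ con e (l f).1 = con e (l f').2 ∧
        con e (l f).2 = con e (l f').1) → HostThick true (con e (l f).1) (con e (l f).2))
    {G : Graph (Fin n) (Fin m)} (hG : IsElementaryMinor G (edgeGraph l)) : G.IsNearPath := by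
  cases hG with
  | deleteIsolated v hv hiso eq =>
    obtain ⟨e, rfl | rfl⟩ := hinc v
    · exact absurd (edgeGraph_isLink_self l e).inc_left (hiso e)
    · exact absurd (edgeGraph_isLink_self l e).inc_right (hiso e)
  | deleteEdge e he eq =>
    subst eq
    obtain ⟨h1, h2, h3⟩ := hdel e
    refine ⟨true, del e, h1.injOn, ?_, ?_⟩
    · intro f x y hf
      rw [deleteEdges_isLink, edgeGraph_isLink] at hf
      rcases hf with ⟨⟨rfl, rfl⟩ | ⟨rfl, rfl⟩, hf⟩
      · exact h2 f hf
      · exact (h2 f hf).symm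
    · intro f f' x y hf hf' hne
      rw [deleteEdges_isLink, edgeGraph_isLink] at hf hf'
      have := h3 f f' hf.2 hf'.2 hne
      rcases hf with ⟨⟨rfl, rfl⟩ | ⟨rfl, rfl⟩, -⟩ <;> rcases hf' with ⟨⟨h4, h5⟩ | ⟨h4, h5⟩, -⟩ <;>
        rw [← h4, ← h5] at this
      · exact this (Or.inl ⟨rfl, rfl⟩)
      · exact this (Or.inr ⟨rfl, rfl⟩)
      · exact (this (Or.inr ⟨rfl, rfl⟩)).symm
      · exact (this (Or.inl ⟨rfl, rfl⟩)).symm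
  | contractEdge e u v he hpar eq =>
    subst eq
    have hpar' : ∀ f, l f = l e → f = e := by
      intro f hf
      refine hpar f ?_
      rw [edgeGraph_isLink] at he ⊢
      rwa [hf]
    obtain ⟨h1, h2, h3, h4⟩ := hcon e hpar'
    refine ⟨true, FitsHost.contractLink (con e) ?_ ?_ ?_ ?_⟩
    · rcases edgeGraph_isLink.1 he with ⟨rfl, rfl⟩ | ⟨rfl, rfl⟩
      · exact h1
      · exact h1.symm
    · intro x _ y _ hxy
      have := h2 x y hxy
      rcases edgeGraph_isLink.1 he with ⟨rfl, rfl⟩ | ⟨rfl, rfl⟩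
      · exact this
      · tauto
    · intro f x y hf hfe
      rcases edgeGraph_isLink.1 hf with ⟨rfl, rfl⟩ | ⟨rfl, rfl⟩
      · exact h3 f hfe
      · exact (h3 f hfe).symm
    · intro f f' x x' y y' hf hf' hfe hfe' hne hx hy
      have := h4 f f' hfe hfe' hne
      rcases edgeGraph_isLink.1 hf with ⟨rfl, rfl⟩ | ⟨rfl, rfl⟩ <;>
        rcases edgeGraph_isLink.1 hf' with ⟨rfl, rfl⟩ | ⟨rfl, rfl⟩
      · exact this (Or.inl ⟨hx, hy⟩)
      · exact this (Or.inr ⟨hx, hy⟩)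
      · exact (this (Or.inr ⟨hy, hx⟩)).symm
      · exact (this (Or.inl ⟨hy, hx⟩)).symm

/-- The placement of a near-path without isolated vertices in the host, in terms of integers: all
vertices but at most one, `w`, are placed on the path. -/
theorem exists_of_isNearPath_edgeGraph {n m : ℕ} {l : Fin m → Fin n × Fin n}
    (hinc : ∀ v, ∃ e, (l e).1 = v ∨ (l e).2 = v) (h : (edgeGraph l).IsNearPath) :
    ∃ f : Fin n → ℤ, ((∀ i j, i < j → f i ≠ f j) ∧
      (∀ e, f (l e).1 = f (l e).2 + 1 ∨ f (l e).2 = f (l e).1 + 1) ∧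
      ∀ e e', e < e' → l e = l e' →
        f (l e).1 = 0 ∧ f (l e).2 = 1 ∨ f (l e).1 = 1 ∧ f (l e).2 = 0) ∨
    ∃ w, (∀ i j, i < j → i ≠ w → j ≠ w → f i ≠ f j) ∧
      (∀ e, (l e).1 ≠ w → (l e).2 ≠ w → f (l e).1 = f (l e).2 + 1 ∨ f (l e).2 = f (l e).1 + 1) ∧
      (∀ e, (l e).1 = w → f (l e).2 = 0 ∨ f (l e).2 = 1) ∧
      (∀ e, (l e).2 = w → f (l e).1 = 0 ∨ f (l e).1 = 1) ∧
      ∀ e e', e < e' → l e = l e' → (l e).1 = w ∨ (l e).2 = w := by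
  obtain ⟨k, g, h1, h2, h3⟩ := h
  have inj : ∀ i j, i < j → g i ≠ g j := fun i j hij hg =>
    hij.ne (h1 (Set.mem_univ _) (Set.mem_univ _) hg)
  have adj : ∀ e, HostAdj k (g (l e).1) (g (l e).2) :=
    fun e => h2 _ _ _ (edgeGraph_isLink_self l e)
  have thick : ∀ e e', e < e' → l e = l e' → HostThick k (g (l e).1) (g (l e).2) := by
    intro e e' hee' hl
    refine h3 _ _ _ _ (edgeGraph_isLink_self l e) ?_ hee'.ne
    rw [hl]
    exact edgeGraph_isLink_self l e'
  by_cases hw : ∃ w, g w = none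
  · obtain ⟨w, hw⟩ := hw
    have hk : k = true := by
      obtain ⟨e, he | he⟩ := hinc w
      · have := adj e
        rw [he, hw] at this
        revert this
        cases g (l e).2
        · exact fun h => h.elim
        · exact fun h => h.1
      · have := adj e
        rw [he, hw] at this
        revert this
        cases g (l e).1
        · exact fun h => h.elim
        · exact fun h => h.1
    subst hk
    obtain ⟨f, hf⟩ : ∃ f : Fin n → ℤ, ∀ i, i ≠ w → g i = some (f i) := by
      refine ⟨fun i => (g i).getD 0, fun i hi => ?_⟩
      rcases hgi : g i with _ | z
      · exact absurd (h1 (Set.mem_univ _) (Set.mem_univ _) (hgi.trans hw.symm)) hi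
      · simp [hgi]
    refine ⟨f, Or.inr ⟨w, ?_, ?_, ?_, ?_, ?_⟩⟩
    · intro i j hij hi hj hfij
      exact inj i j hij (by rw [hf i hi, hf j hj, hfij])
    · intro e he he'
      have := adj e
      rwa [hf _ he, hf _ he'] at this
    · intro e he
      have := adj e
      by_cases he' : (l e).2 = w
      · rw [he, he', hw] at this
        exact this.elim
      · rw [he, hw, hf _ he'] at this
        exact this.2
    · intro e he
      have := adj e
      by_cases he' : (l e).1 = w
      · rw [he, he', hw] at this
        exact this.elim
      · rw [he, hw, hf _ he'] at this
        exact this.2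
    · intro e e' hee' hl
      have := thick e e' hee' hl
      by_contra! hne
      rw [hf _ hne.1, hf _ hne.2] at this
      simp [HostThick] at this
  · have hf : ∀ i, g i = some ((g i).getD 0) := by
      intro i
      rcases hgi : g i with _ | z
      · exact absurd ⟨i, hgi⟩ hw
      · rfl
    generalize (fun i => (g i).getD 0) = f at hf
    obtain ⟨f, hf⟩ : ∃ f : Fin n → ℤ, ∀ i, g i = some (f i) := ⟨_, hf⟩
    refine ⟨f, Or.inl ⟨?_, ?_, ?_⟩⟩
    · intro i j hij hfij
      exact inj i j hij (by rw [hf i, hf j, hfij])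
    · intro e
      have := adj e
      rwa [hf, hf] at this
    · intro e e' hee' hl
      have := thick e e' hee' hl
      rw [hf, hf] at this
      simp only [HostThick, Option.some.injEq, reduceCtorEq, or_false, and_false, false_or] at this
      exact this.2

/-! ### The eleven obstructions -/

/-- The properties of the graph with the edges `l` that make it minor-minimal with spectator
floor `2`: it is not a near-path, its elementary minors are, and it is a subgraph of a graph with
spectator number at most `2`. -/
structure IsObstruction {n m : ℕ} (l : Fin m → Fin n × Fin n) : Prop where
  not_isNearPath : ¬ (edgeGraph l).IsNearPath
  isNearPath : ∀ G, IsElementaryMinor G (edgeGraph l) → G.IsNearPath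
  exists_host : ∃ H : Graph ℕ ℕ, H.IsMultigraph ∧ H.spectatorNumber ≤ 2 ∧ (edgeGraph l).Embeds H

/-- A host for a graph with listed edges, with its own edges `L`, the length `k` of the unique
shortest path `0, …, k`, a list `h` of heights, and the vertex and edge maps `φ` and `ψ`. -/
theorem exists_host {n m : ℕ} {l : Fin m → Fin n × Fin n} (k : ℕ) (L : List (ℕ × ℕ)) (h : List ℕ)
    (φ : Fin n → ℕ) (ψ : Fin m → ℕ)
    (H : (∀ e < L.length, (L.getD e (0, 0)).1 ≠ (L.getD e (0, 0)).2) ∧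
      (h.length = k + 3 ∧ k ≤ L.length) ∧
      (∀ i < k, (L.getD i (0, 0)).1 = i ∧ (L.getD i (0, 0)).2 = i + 1) ∧
      (∀ i < k + 1, h.getD i 0 = i) ∧
      (∀ e < L.length, h.getD (L.getD e (0, 0)).1 0 ≤ h.getD (L.getD e (0, 0)).2 0 + 1 ∧
        h.getD (L.getD e (0, 0)).2 0 ≤ h.getD (L.getD e (0, 0)).1 0 + 1) ∧
      (∀ e < L.length, ((L.getD e (0, 0)).1 < k →
          h.getD (L.getD e (0, 0)).2 0 = (L.getD e (0, 0)).1 + 1 →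
            (L.getD e (0, 0)).2 = (L.getD e (0, 0)).1 + 1 ∧ e = (L.getD e (0, 0)).1) ∧
        ((L.getD e (0, 0)).2 < k →
          h.getD (L.getD e (0, 0)).1 0 = (L.getD e (0, 0)).2 + 1 →
            (L.getD e (0, 0)).1 = (L.getD e (0, 0)).2 + 1 ∧ e = (L.getD e (0, 0)).2)) ∧
      Function.Injective φ ∧ Function.Injective ψ ∧ (∀ i, φ i < h.length) ∧
      ∀ e, ψ e < L.length ∧ (L.getD (ψ e) (0, 0) = (φ (l e).1, φ (l e).2) ∨
        L.getD (ψ e) (0, 0) = (φ (l e).2, φ (l e).1))) :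
    ∃ H : Graph ℕ ℕ, H.IsMultigraph ∧ H.spectatorNumber ≤ 2 ∧ (edgeGraph l).Embeds H := by
  obtain ⟨h1, ⟨h2, h3⟩, h4, h5, h6, h7, h8, h9, h10, h11⟩ := H
  refine ⟨natGraph h.length L.length (fun e => (L.getD e (0, 0)).1) (fun e => (L.getD e (0, 0)).2),
    natGraph_isMultigraph (by omega) h1, ?_, edgeGraph_embeds φ ψ h8 h10 ?_ ?_⟩
  · refine (natGraph_spectatorNumber_le k (by omega) h3 (fun x => h.getD x 0) h4 h5 h6 h7).trans ?_
    omega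
  · intro e
    refine ⟨(h11 e).1, h10 _, h10 _, ?_⟩
    rcases (h11 e).2 with h | h
    · exact Or.inl ⟨(congrArg Prod.fst h).symm, (congrArg Prod.snd h).symm⟩
    · exact Or.inr ⟨(congrArg Prod.snd h).symm, (congrArg Prod.fst h).symm⟩
  · exact fun e f hef _ => h9.ne hef.ne

/-- The edges of `C₂ ⊔ C₂`. -/
def endsC2C2 : Fin 4 → Fin 4 × Fin 4 :=
  ![(0, 1), (0, 1), (2, 3), (2, 3)]

/-- The edges of `C₂ ⊔ K_{1,3}`. -/
def endsC2Star : Fin 5 → Fin 6 × Fin 6 :=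
  ![(0, 1), (0, 1), (2, 3), (2, 4), (2, 5)]

/-- The edges of `K_{1,3} ⊔ K_{1,3}`. -/
def endsStarStar : Fin 6 → Fin 8 × Fin 8 :=
  ![(0, 1), (0, 2), (0, 3), (4, 5), (4, 6), (4, 7)]

/-- The edges of `C₄`. -/
def endsC4 : Fin 4 → Fin 4 × Fin 4 :=
  ![(0, 1), (1, 2), (2, 3), (3, 0)]

/-- The edges of `H₁`. -/
def endsH1 : Fin 6 → Fin 3 × Fin 3 :=
  ![(0, 1), (0, 1), (1, 2), (1, 2), (2, 0), (2, 0)]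

/-- The edges of `H₂`. -/
def endsH2 : Fin 5 → Fin 4 × Fin 4 :=
  ![(0, 1), (0, 1), (0, 2), (0, 2), (0, 3)]

/-- The edges of `H₃`. -/
def endsH3 : Fin 5 → Fin 4 × Fin 4 :=
  ![(0, 1), (1, 2), (2, 0), (0, 3), (0, 3)]

/-- The edges of `H₄`. -/
def endsH4 : Fin 5 → Fin 5 × Fin 5 :=
  ![(0, 1), (0, 1), (0, 2), (0, 3), (1, 4)]

/-- The edges of `H₅`. -/
def endsH5 : Fin 5 → Fin 5 × Fin 5 :=
  ![(0, 2), (1, 2), (2, 3), (3, 4), (3, 4)]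

/-- The edges of `K_{1,4}`. -/
def endsStar4 : Fin 4 → Fin 5 × Fin 5 :=
  ![(0, 1), (0, 2), (0, 3), (0, 4)]

/-- The edges of the long `Y`. -/
def endsLongY : Fin 6 → Fin 7 × Fin 7 :=
  ![(0, 1), (1, 2), (0, 3), (3, 4), (0, 5), (5, 6)]

theorem not_isNearPath_C2C2 : ¬ (edgeGraph endsC2C2).IsNearPath := by
  intro h
  obtain ⟨f, ⟨h1, h2, h3⟩ | ⟨w, h1, h2, h3, h4, h5⟩⟩ :=
    exists_of_isNearPath_edgeGraph (by decide) h
  · simp [Fin.forall_fin_succ, endsC2C2] at h1 h2 h3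
    omega
  · fin_cases w <;> simp [Fin.forall_fin_succ, endsC2C2] at h1 h2 h3 h4 h5

theorem not_isNearPath_C2Star : ¬ (edgeGraph endsC2Star).IsNearPath := by
  intro h
  obtain ⟨f, ⟨h1, h2, h3⟩ | ⟨w, h1, h2, h3, h4, h5⟩⟩ :=
    exists_of_isNearPath_edgeGraph (by decide) h
  · simp [Fin.forall_fin_succ, endsC2Star] at h1 h2 h3
    omega
  · fin_cases w <;> simp [Fin.forall_fin_succ, endsC2Star] at h1 h2 h3 h4 h5 <;> omega

theorem not_isNearPath_StarStar : ¬ (edgeGraph endsStarStar).IsNearPath := by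
  intro h
  obtain ⟨f, ⟨h1, h2, -⟩ | ⟨w, h1, h2, -⟩⟩ := exists_of_isNearPath_edgeGraph (by decide) h
  · have a1 : f 0 = f 1 + 1 ∨ f 1 = f 0 + 1 := h2 0
    have a2 : f 0 = f 2 + 1 ∨ f 2 = f 0 + 1 := h2 1
    have a3 : f 0 = f 3 + 1 ∨ f 3 = f 0 + 1 := h2 2
    have := h1 1 2 (by decide)
    have := h1 1 3 (by decide)
    have := h1 2 3 (by decide)
    omega
  · -- The star that does not contain `w` has three leaves on two spots.
    by_cases hw : w < 4
    · have hne : ∀ i, 4 ≤ i → i ≠ w := by rintro i hi rfl; omega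
      have a1 : f 4 = f 5 + 1 ∨ f 5 = f 4 + 1 := h2 3 (hne _ (by decide)) (hne _ (by decide))
      have a2 : f 4 = f 6 + 1 ∨ f 6 = f 4 + 1 := h2 4 (hne _ (by decide)) (hne _ (by decide))
      have a3 : f 4 = f 7 + 1 ∨ f 7 = f 4 + 1 := h2 5 (hne _ (by decide)) (hne _ (by decide))
      have := h1 5 6 (by decide) (hne _ (by decide)) (hne _ (by decide))
      have := h1 5 7 (by decide) (hne _ (by decide)) (hne _ (by decide))
      have := h1 6 7 (by decide) (hne _ (by decide)) (hne _ (by decide))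
      omega
    · have hne : ∀ i, i < 4 → i ≠ w := by rintro i hi rfl; exact hw hi
      have a1 : f 0 = f 1 + 1 ∨ f 1 = f 0 + 1 := h2 0 (hne _ (by decide)) (hne _ (by decide))
      have a2 : f 0 = f 2 + 1 ∨ f 2 = f 0 + 1 := h2 1 (hne _ (by decide)) (hne _ (by decide))
      have a3 : f 0 = f 3 + 1 ∨ f 3 = f 0 + 1 := h2 2 (hne _ (by decide)) (hne _ (by decide))
      have := h1 1 2 (by decide) (hne _ (by decide)) (hne _ (by decide))
      have := h1 1 3 (by decide) (hne _ (by decide)) (hne _ (by decide))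
      have := h1 2 3 (by decide) (hne _ (by decide)) (hne _ (by decide))
      omega

theorem not_isNearPath_C4 : ¬ (edgeGraph endsC4).IsNearPath := by
  intro h
  obtain ⟨f, ⟨h1, h2, h3⟩ | ⟨w, h1, h2, h3, h4, h5⟩⟩ :=
    exists_of_isNearPath_edgeGraph (by decide) h
  · simp [Fin.forall_fin_succ, endsC4] at h1 h2 h3
    omega
  · fin_cases w <;> simp [Fin.forall_fin_succ, endsC4] at h1 h2 h3 h4 h5 <;> omega

theorem not_isNearPath_H1 : ¬ (edgeGraph endsH1).IsNearPath := by
  intro h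
  obtain ⟨f, ⟨h1, h2, h3⟩ | ⟨w, h1, h2, h3, h4, h5⟩⟩ :=
    exists_of_isNearPath_edgeGraph (by decide) h
  · simp [Fin.forall_fin_succ, endsH1] at h1 h2 h3
    omega
  · fin_cases w <;> simp [Fin.forall_fin_succ, endsH1] at h1 h2 h3 h4 h5

theorem not_isNearPath_H2 : ¬ (edgeGraph endsH2).IsNearPath := by
  intro h
  obtain ⟨f, ⟨h1, h2, h3⟩ | ⟨w, h1, h2, h3, h4, h5⟩⟩ :=
    exists_of_isNearPath_edgeGraph (by decide) h
  · simp [Fin.forall_fin_succ, endsH2] at h1 h2 h3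
    omega
  · fin_cases w <;> simp [Fin.forall_fin_succ, endsH2] at h1 h2 h3 h4 h5
    omega

theorem not_isNearPath_H3 : ¬ (edgeGraph endsH3).IsNearPath := by
  intro h
  obtain ⟨f, ⟨h1, h2, h3⟩ | ⟨w, h1, h2, h3, h4, h5⟩⟩ :=
    exists_of_isNearPath_edgeGraph (by decide) h
  · simp [Fin.forall_fin_succ, endsH3] at h1 h2 h3
    omega
  · fin_cases w <;> simp [Fin.forall_fin_succ, endsH3] at h1 h2 h3 h4 h5 <;> omega

theorem not_isNearPath_H4 : ¬ (edgeGraph endsH4).IsNearPath := by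
  intro h
  obtain ⟨f, ⟨h1, h2, h3⟩ | ⟨w, h1, h2, h3, h4, h5⟩⟩ :=
    exists_of_isNearPath_edgeGraph (by decide) h
  · simp [Fin.forall_fin_succ, endsH4] at h1 h2 h3
    omega
  · fin_cases w <;> simp [Fin.forall_fin_succ, endsH4] at h1 h2 h3 h4 h5 <;> omega

theorem not_isNearPath_H5 : ¬ (edgeGraph endsH5).IsNearPath := by
  intro h
  obtain ⟨f, ⟨h1, h2, h3⟩ | ⟨w, h1, h2, h3, h4, h5⟩⟩ :=
    exists_of_isNearPath_edgeGraph (by decide) h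
  · simp [Fin.forall_fin_succ, endsH5] at h1 h2 h3
    omega
  · fin_cases w <;> simp [Fin.forall_fin_succ, endsH5] at h1 h2 h3 h4 h5 <;> omega

theorem not_isNearPath_Star4 : ¬ (edgeGraph endsStar4).IsNearPath := by
  intro h
  obtain ⟨f, ⟨h1, h2, h3⟩ | ⟨w, h1, h2, h3, h4, h5⟩⟩ :=
    exists_of_isNearPath_edgeGraph (by decide) h
  · simp [Fin.forall_fin_succ, endsStar4] at h1 h2 h3
    omega
  · fin_cases w <;> simp [Fin.forall_fin_succ, endsStar4] at h1 h2 h3 h4 h5 <;> omega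

theorem not_isNearPath_LongY : ¬ (edgeGraph endsLongY).IsNearPath := by
  intro h
  obtain ⟨f, ⟨h1, h2, -⟩ | ⟨w, h1, h2, h3, h4, -⟩⟩ := exists_of_isNearPath_edgeGraph (by decide) h
  · have a1 : f 0 = f 1 + 1 ∨ f 1 = f 0 + 1 := h2 0
    have a2 : f 0 = f 3 + 1 ∨ f 3 = f 0 + 1 := h2 2
    have a3 : f 0 = f 5 + 1 ∨ f 5 = f 0 + 1 := h2 4
    have := h1 1 3 (by decide)
    have := h1 1 5 (by decide)
    have := h1 3 5 (by decide)
    omega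
  · have b1 := h1 1 3 (by decide)
    have b2 := h1 1 5 (by decide)
    have b3 := h1 3 5 (by decide)
    have b4 := h1 2 3 (by decide)
    have b5 := h1 2 5 (by decide)
    have b6 := h1 1 4 (by decide)
    have b7 := h1 4 5 (by decide)
    have b8 := h1 1 6 (by decide)
    have b9 := h1 3 6 (by decide)
    have b10 := h1 0 2 (by decide)
    have b11 := h1 0 4 (by decide)
    have b12 := h1 0 6 (by decide)
    clear h1
    fin_cases w <;> simp [Fin.forall_fin_succ, endsLongY] at * <;> omega

theorem isObstruction_endsC2C2 : IsObstruction endsC2C2 where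
  not_isNearPath := not_isNearPath_C2C2
  isNearPath _ := isNearPath_of_isElementaryMinor_edgeGraph
    ![![some 0, some (-1), none, some 1], ![some 0, some (-1), none, some 1],
      ![none, some 0, some 1, some 2], ![none, some 0, some 1, some 2]]
    (fun _ _ => none) (by decide) (by decide)
    (fun e he => absurd he (by clear he; revert e; decide))
  exists_host := exists_host 1 [(0, 1), (0, 2), (0, 2), (1, 3), (1, 3)] [0, 1, 0, 0]
    ![0, 2, 1, 3] ![1, 2, 3, 4] (by decide)

theorem isObstruction_endsC2Star : IsObstruction endsC2Star where
  not_isNearPath := not_isNearPath_C2Star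
  isNearPath _ := isNearPath_of_isElementaryMinor_edgeGraph
    ![![some (-1), some (-2), some 1, none, some 0, some 2],
      ![some (-1), some (-2), some 1, none, some 0, some 2],
      ![none, some 0, some 2, some (-1), some 1, some 3],
      ![none, some 0, some 2, some 1, some (-1), some 3],
      ![none, some 0, some 2, some 1, some 3, some (-1)]]
    ![![some (-1), some (-2), some 1, none, some 0, some 2],
      ![some (-1), some (-2), some 1, none, some 0, some 2],
      ![none, some 0, some 2, some 2, some 1, some 3],
      ![none, some 0, some 2, some 1, some 2, some 3],
      ![none, some 0, some 2, some 1, some 3, some 2]]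
    (by decide) (by decide) (by decide)
  exists_host := exists_host 3 [(0, 1), (1, 2), (2, 3), (3, 4), (3, 4), (1, 5)] [0, 1, 2, 3, 2, 0]
    ![3, 4, 1, 0, 2, 5] ![3, 4, 0, 1, 5] (by decide)

theorem isObstruction_endsStarStar : IsObstruction endsStarStar where
  not_isNearPath := not_isNearPath_StarStar
  isNearPath _ := isNearPath_of_isElementaryMinor_edgeGraph
    ![![some (-2), some 3, some (-1), some (-3), some 1, none, some 0, some 2],
      ![some (-2), some (-1), some 3, some (-3), some 1, none, some 0, some 2],
      ![some (-2), some (-1), some (-3), some 3, some 1, none, some 0, some 2],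
      ![some 0, none, some 1, some (-1), some 3, some (-2), some 2, some 4],
      ![some 0, none, some 1, some (-1), some 3, some 2, some (-2), some 4],
      ![some 0, none, some 1, some (-1), some 3, some 2, some 4, some (-2)]]
    ![![some (-2), some (-2), some (-1), some (-3), some 1, none, some 0, some 2],
      ![some (-2), some (-1), some (-2), some (-3), some 1, none, some 0, some 2],
      ![some (-2), some (-1), some (-3), some (-2), some 1, none, some 0, some 2],
      ![some 0, none, some 1, some (-1), some 3, some 3, some 2, some 4],
      ![some 0, none, some 1, some (-1), some 3, some 2, some 3, some 4],
      ![some 0, none, some 1, some (-1), some 3, some 2, some 4, some 3]]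
    (by decide) (by decide) (by decide)
  exists_host := exists_host 5 [(0, 1), (1, 2), (2, 3), (3, 4), (4, 5), (1, 6), (4, 7)]
    [0, 1, 2, 3, 4, 5, 0, 3]
    ![1, 0, 2, 6, 4, 3, 5, 7] ![0, 1, 5, 3, 4, 6] (by decide)

theorem isObstruction_endsC4 : IsObstruction endsC4 where
  not_isNearPath := not_isNearPath_C4
  isNearPath _ := isNearPath_of_isElementaryMinor_edgeGraph
    ![![none, some (-1), some 0, some 1], ![none, some 0, some 2, some 1],
      ![none, some 0, some (-1), some 1], ![none, some 0, some 1, some 2]]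
    ![![none, none, some 0, some 1], ![none, some 0, some 0, some 1],
      ![none, some 0, some 1, some 1], ![none, some 0, some 1, none]]
    (by decide) (by decide) (by decide)
  exists_host := exists_host 1 [(0, 1), (1, 2), (2, 3), (3, 0)] [0, 1, 0, 0]
    ![0, 1, 2, 3] ![0, 1, 2, 3] (by decide)

theorem isObstruction_endsH1 : IsObstruction endsH1 where
  not_isNearPath := not_isNearPath_H1
  isNearPath _ := isNearPath_of_isElementaryMinor_edgeGraph
    ![![some 0, some 1, none], ![some 0, some 1, none], ![none, some 0, some 1],
      ![none, some 0, some 1], ![some 0, none, some 1], ![some 0, none, some 1]]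
    (fun _ _ => none) (by decide) (by decide)
    (fun e he => absurd he (by clear he; revert e; decide))
  exists_host := exists_host 0 [(0, 1), (0, 1), (1, 2), (1, 2), (2, 0), (2, 0)] [0, 0, 0]
    ![0, 1, 2] ![0, 1, 2, 3, 4, 5] (by decide)

theorem isObstruction_endsH2 : IsObstruction endsH2 where
  not_isNearPath := not_isNearPath_H2
  isNearPath _ := isNearPath_of_isElementaryMinor_edgeGraph
    ![![some 0, some 1, none, some (-1)], ![some 0, some 1, none, some (-1)],
      ![some 0, none, some 1, some (-1)], ![some 0, none, some 1, some (-1)],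
      ![none, some 0, some 1, some (-1)]]
    ![![some 0, some 1, none, some (-1)], ![some 0, some 1, none, some (-1)],
      ![some 0, none, some 1, some (-1)], ![some 0, none, some 1, some (-1)],
      ![none, some 0, some 1, none]]
    (by decide) (by decide) (by decide)
  exists_host := exists_host 1 [(0, 1), (0, 2), (0, 2), (0, 3), (0, 3)] [0, 1, 0, 0]
    ![0, 2, 3, 1] ![1, 2, 3, 4, 0] (by decide)

theorem isObstruction_endsH3 : IsObstruction endsH3 where
  not_isNearPath := not_isNearPath_H3
  isNearPath _ := isNearPath_of_isElementaryMinor_edgeGraph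
    ![![none, some (-1), some 0, some 1], ![some 0, some 1, some (-1), none],
      ![none, some 0, some (-1), some 1], ![some 0, none, some 1, some (-1)],
      ![some 0, none, some 1, some (-1)]]
    ![![none, none, some 0, some 1], ![none, some 0, some 0, some 1], ![none, some 0, none, some 1],
      ![some 0, none, some 1, some (-1)], ![some 0, none, some 1, some (-1)]]
    (by decide) (by decide) (by decide)
  exists_host := exists_host 1 [(0, 1), (1, 2), (2, 0), (0, 3), (0, 3)] [0, 1, 0, 0]
    ![0, 1, 2, 3] ![0, 1, 2, 3, 4] (by decide)

theorem isObstruction_endsH4 : IsObstruction endsH4 where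
  not_isNearPath := not_isNearPath_H4
  isNearPath _ := isNearPath_of_isElementaryMinor_edgeGraph
    ![![some 0, some 1, none, some (-1), some 2], ![some 0, some 1, none, some (-1), some 2],
      ![none, some 0, some 2, some 1, some (-1)], ![none, some 0, some 1, some 2, some (-1)],
      ![some 0, none, some 1, some (-1), some 2]]
    ![![some 0, some 1, none, some (-1), some 2], ![some 0, some 1, none, some (-1), some 2],
      ![none, some 0, none, some 1, some (-1)], ![none, some 0, some 1, none, some (-1)],
      ![some 0, none, some 1, some (-1), none]]
    (by decide) (by decide) (by decide)
  exists_host := exists_host 2 [(0, 1), (1, 2), (1, 3), (1, 3), (3, 4)] [0, 1, 2, 0, 0]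
    ![1, 3, 0, 2, 4] ![2, 3, 0, 1, 4] (by decide)

theorem isObstruction_endsH5 : IsObstruction endsH5 where
  not_isNearPath := not_isNearPath_H5
  isNearPath _ := isNearPath_of_isElementaryMinor_edgeGraph
    ![![some 0, some 3, some 2, some 1, none], ![some (-1), some 2, some 0, none, some 1],
      ![some 0, some (-2), some (-1), none, some 1], ![none, some 0, some 1, some 2, some 3],
      ![none, some 0, some 1, some 2, some 3]]
    ![![some 0, some (-1), some 0, none, some 1], ![some (-1), some 0, some 0, none, some 1],
      ![some 0, some 2, some 1, some 1, none], ![none, some 0, some 1, some 2, some 3],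
      ![none, some 0, some 1, some 2, some 3]]
    (by decide) (by decide) (by decide)
  exists_host := exists_host 2 [(0, 1), (1, 2), (1, 3), (3, 4), (3, 4)] [0, 1, 2, 0, 0]
    ![0, 2, 1, 3, 4] ![0, 1, 2, 3, 4] (by decide)

theorem isObstruction_endsStar4 : IsObstruction endsStar4 where
  not_isNearPath := not_isNearPath_Star4
  isNearPath _ := isNearPath_of_isElementaryMinor_edgeGraph
    ![![some 0, some 2, none, some 1, some (-1)], ![some 0, none, some 2, some 1, some (-1)],
      ![some 0, none, some 1, some 2, some (-1)], ![some 0, none, some 1, some (-1), some 2]]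
    ![![some 0, some 0, none, some 1, some (-1)], ![some 0, none, some 0, some 1, some (-1)],
      ![some 0, none, some 1, some 0, some (-1)], ![some 0, none, some 1, some (-1), some 0]]
    (by decide) (by decide) (by decide)
  exists_host := exists_host 2 [(0, 1), (1, 2), (1, 3), (1, 4)] [0, 1, 2, 0, 0]
    ![1, 0, 2, 3, 4] ![0, 1, 2, 3] (by decide)

theorem isObstruction_endsLongY : IsObstruction endsLongY where
  not_isNearPath := not_isNearPath_LongY
  isNearPath _ := isNearPath_of_isElementaryMinor_edgeGraph
    ![![none, some (-2), some (-3), some 0, some (-1), some 1, some 2],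
      ![some 0, none, some 3, some 1, some 2, some (-1), some (-2)],
      ![none, some 0, some (-1), some (-2), some (-3), some 1, some 2],
      ![some 0, some 1, some 2, none, some 3, some (-1), some (-2)],
      ![none, some 0, some (-1), some 1, some 2, some (-2), some (-3)],
      ![some 0, some 1, some 2, some (-1), some (-2), none, some 3]]
    ![![some 0, some 0, none, some 1, some 2, some (-1), some (-2)],
      ![some 0, none, none, some 1, some 2, some (-1), some (-2)],
      ![some 0, some 1, some 2, some 0, none, some (-1), some (-2)],
      ![some 0, some 1, some 2, none, none, some (-1), some (-2)],
      ![some 0, some 1, some 2, some (-1), some (-2), some 0, none],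
      ![some 0, some 1, some 2, some (-1), some (-2), none, none]]
    (by decide) (by decide) (by decide)
  exists_host := exists_host 4 [(0, 1), (1, 2), (2, 3), (3, 4), (2, 5), (5, 6)] [0, 1, 2, 3, 4, 1, 0]
    ![2, 1, 0, 3, 4, 5, 6] ![1, 0, 2, 3, 4, 5] (by decide)

/-! ### Obstructions and minor-minimality -/

theorem graphC2_isLink (e : Fin 2) : graphC2.IsLink e 0 1 := by
  change ![s(0, 1), s(0, 1)] e = s(0, 1)
  fin_cases e <;> rfl

theorem star_isLink {n : ℕ} (e : Fin n) : (star n).IsLink e 0 e.succ := rfl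

theorem isomorphic_C2C2 : (graphC2.disjointUnion graphC2).Isomorphic (edgeGraph endsC2C2) := by
  refine isomorphic_edgeGraph ![.inl 0, .inl 1, .inr 0, .inr 1] ![.inl 0, .inl 1, .inr 0, .inr 1]
    (by decide) (by decide) ?_ ?_ ?_
  · ext x
    refine ⟨fun _ => ?_, fun _ => ?_⟩
    · rcases x with x | x
      · exact Or.inl ⟨x, Set.mem_univ _, rfl⟩
      · exact Or.inr ⟨x, Set.mem_univ _, rfl⟩
    · clear * -
      simp only [Set.mem_range]
      revert x
      decide
  · intro e _
    clear * -
    simp only [Set.mem_range]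
    revert e
    decide
  · intro e
    fin_cases e
    · exact Or.inl ⟨0, 0, 1, graphC2_isLink 0, rfl, rfl, rfl⟩
    · exact Or.inl ⟨1, 0, 1, graphC2_isLink 1, rfl, rfl, rfl⟩
    · exact Or.inr ⟨0, 0, 1, graphC2_isLink 0, rfl, rfl, rfl⟩
    · exact Or.inr ⟨1, 0, 1, graphC2_isLink 1, rfl, rfl, rfl⟩

theorem isomorphic_C2Star : (graphC2.disjointUnion (star 3)).Isomorphic (edgeGraph endsC2Star) := by
  refine isomorphic_edgeGraph ![.inl 0, .inl 1, .inr 0, .inr 1, .inr 2, .inr 3]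
    ![.inl 0, .inl 1, .inr 0, .inr 1, .inr 2] (by decide) (by decide) ?_ ?_ ?_
  · ext x
    refine ⟨fun _ => ?_, fun _ => ?_⟩
    · rcases x with x | x
      · exact Or.inl ⟨x, Set.mem_univ _, rfl⟩
      · exact Or.inr ⟨x, Set.mem_univ _, rfl⟩
    · clear * -
      simp only [Set.mem_range]
      revert x
      decide
  · intro e _
    clear * -
    simp only [Set.mem_range]
    revert e
    decide
  · intro e
    fin_cases e
    · exact Or.inl ⟨0, 0, 1, graphC2_isLink 0, rfl, rfl, rfl⟩
    · exact Or.inl ⟨1, 0, 1, graphC2_isLink 1, rfl, rfl, rfl⟩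
    · exact Or.inr ⟨0, 0, 1, star_isLink 0, rfl, rfl, rfl⟩
    · exact Or.inr ⟨1, 0, 2, star_isLink 1, rfl, rfl, rfl⟩
    · exact Or.inr ⟨2, 0, 3, star_isLink 2, rfl, rfl, rfl⟩

theorem isomorphic_StarStar :
    ((star 3).disjointUnion (star 3)).Isomorphic (edgeGraph endsStarStar) := by
  refine isomorphic_edgeGraph
    ![.inl 0, .inl 1, .inl 2, .inl 3, .inr 0, .inr 1, .inr 2, .inr 3]
    ![.inl 0, .inl 1, .inl 2, .inr 0, .inr 1, .inr 2] (by decide) (by decide) ?_ ?_ ?_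
  · ext x
    refine ⟨fun _ => ?_, fun _ => ?_⟩
    · rcases x with x | x
      · exact Or.inl ⟨x, Set.mem_univ _, rfl⟩
      · exact Or.inr ⟨x, Set.mem_univ _, rfl⟩
    · clear * -
      simp only [Set.mem_range]
      revert x
      decide
  · intro e _
    clear * -
    simp only [Set.mem_range]
    revert e
    decide
  · intro e
    fin_cases e
    · exact Or.inl ⟨0, 0, 1, star_isLink 0, rfl, rfl, rfl⟩
    · exact Or.inl ⟨1, 0, 2, star_isLink 1, rfl, rfl, rfl⟩
    · exact Or.inl ⟨2, 0, 3, star_isLink 2, rfl, rfl, rfl⟩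
    · exact Or.inr ⟨0, 0, 1, star_isLink 0, rfl, rfl, rfl⟩
    · exact Or.inr ⟨1, 0, 2, star_isLink 1, rfl, rfl, rfl⟩
    · exact Or.inr ⟨2, 0, 3, star_isLink 2, rfl, rfl, rfl⟩

theorem isomorphic_ofEnds {n m : ℕ} {ends : Fin m → Sym2 (Fin n)} {l : Fin m → Fin n × Fin n}
    (h : ∀ e, ends e = s((l e).1, (l e).2)) : (ofEnds ends).Isomorphic (edgeGraph l) :=
  isomorphic_edgeGraph id id Function.injective_id Function.injective_id Set.range_id
    (fun e _ => ⟨e, rfl⟩) h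

theorem isomorphic_C4 : graphC4.Isomorphic (edgeGraph endsC4) := isomorphic_ofEnds (by decide)

theorem isomorphic_H1 : graphH1.Isomorphic (edgeGraph endsH1) := isomorphic_ofEnds (by decide)

theorem isomorphic_H2 : graphH2.Isomorphic (edgeGraph endsH2) := isomorphic_ofEnds (by decide)

theorem isomorphic_H3 : graphH3.Isomorphic (edgeGraph endsH3) := isomorphic_ofEnds (by decide)

theorem isomorphic_H4 : graphH4.Isomorphic (edgeGraph endsH4) := by
  have hlink : ∀ e x y, graphH4.IsLink e x y ↔ ∃ a b, (threeSun.IsLink e a b ∧ e ≠ 0) ∧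
      (if a = 1 then 0 else a) = x ∧ (if b = 1 then 0 else b) = y := by
    intro e x y
    rw [graphH4, contractLink_isLink]
    congr!
  refine isomorphic_edgeGraph ![0, 2, 3, 4, 5] ![1, 2, 3, 4, 5] (by decide) (by decide) ?_ ?_ ?_
  · ext x
    have hx : x ∈ graphH4.vertexSet ↔ ∃ a : Fin 6, (if a = 1 then 0 else a) = x := by
      rw [graphH4, mem_vertexSet_contractLink]
      refine ⟨fun ⟨a, _, h⟩ => ⟨a, by convert h⟩, fun ⟨a, h⟩ => ⟨a, Set.mem_univ _, by convert h⟩⟩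
    rw [hx, Set.mem_range]
    clear hx
    revert x
    decide
  · intro e he
    obtain ⟨x, y, h⟩ := exists_isLink_of_mem_edgeSet he
    obtain ⟨a, b, h, -⟩ := (hlink _ _ _).1 h
    have hne := h.2
    clear * - hne
    rw [Set.mem_range]
    revert e
    decide
  · intro e
    fin_cases e
    · exact (hlink _ _ _).2 ⟨1, 2, ⟨rfl, by decide⟩, rfl, rfl⟩
    · exact (hlink _ _ _).2 ⟨0, 2, ⟨Sym2.eq_swap, by decide⟩, rfl, rfl⟩
    · exact (hlink _ _ _).2 ⟨0, 3, ⟨rfl, by decide⟩, rfl, rfl⟩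
    · exact (hlink _ _ _).2 ⟨1, 4, ⟨rfl, by decide⟩, rfl, rfl⟩
    · exact (hlink _ _ _).2 ⟨2, 5, ⟨rfl, by decide⟩, rfl, rfl⟩

theorem isomorphic_H5 : graphH5.Isomorphic (edgeGraph endsH5) := isomorphic_ofEnds (by decide)

theorem isomorphic_Star4 : (star 4).Isomorphic (edgeGraph endsStar4) :=
  isomorphic_ofEnds (by decide)

theorem isomorphic_LongY : longY.Isomorphic (edgeGraph endsLongY) := isomorphic_ofEnds (by decide)

/-- Elementary operations carry over along isomorphisms, up to embedding. -/
theorem IsElementaryMinor.exists_embeds [Nonempty α'] [Nonempty β'] {G G' : Graph α β}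
    {X : Graph α' β'} (hX : G.Isomorphic X) (h : IsElementaryMinor G' G) :
    ∃ X', IsElementaryMinor X' X ∧ G'.Embeds X' := by
  classical
  obtain ⟨φ₀, ψ₀, h₀⟩ := hX
  obtain ⟨φ, hφ⟩ : ∃ φ : α → α', ∀ x : G.vertexSet, φ x = φ₀ x :=
    ⟨fun x => if hx : x ∈ G.vertexSet then φ₀ ⟨x, hx⟩ else Classical.arbitrary _,
      fun x => by simp⟩
  obtain ⟨ψ, hψ⟩ : ∃ ψ : β → β', ∀ e : G.edgeSet, ψ e = ψ₀ e :=
    ⟨fun e => if he : e ∈ G.edgeSet then ψ₀ ⟨e, he⟩ else Classical.arbitrary _,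
      fun e => by simp⟩
  have hφV : ∀ x ∈ G.vertexSet, φ x ∈ X.vertexSet := fun x hx => by
    rw [hφ ⟨x, hx⟩]; exact Subtype.coe_prop _
  have hφi : Set.InjOn φ G.vertexSet := by
    intro x hx y hy hxy
    rw [hφ ⟨x, hx⟩, hφ ⟨y, hy⟩, Subtype.coe_inj, φ₀.injective.eq_iff, Subtype.mk.injEq] at hxy
    exact hxy
  have hψE : ∀ e ∈ G.edgeSet, ψ e ∈ X.edgeSet := fun e he => by
    rw [hψ ⟨e, he⟩]; exact Subtype.coe_prop _
  have hψi : Set.InjOn ψ G.edgeSet := by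
    intro x hx y hy hxy
    rw [hψ ⟨x, hx⟩, hψ ⟨y, hy⟩, Subtype.coe_inj, ψ₀.injective.eq_iff, Subtype.mk.injEq] at hxy
    exact hxy
  have hψs : ∀ f ∈ X.edgeSet, ∃ e ∈ G.edgeSet, ψ e = f := fun f hf =>
    ⟨ψ₀.symm ⟨f, hf⟩, Subtype.coe_prop _, by rw [hψ]; simp⟩
  have hl : ∀ e ∈ G.edgeSet, ∀ x ∈ G.vertexSet, ∀ y ∈ G.vertexSet,
      G.IsLink e x y ↔ X.IsLink (ψ e) (φ x) (φ y) := by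
    intro e he x hx y hy
    rw [hψ ⟨e, he⟩, hφ ⟨x, hx⟩, hφ ⟨y, hy⟩]
    exact h₀ ⟨e, he⟩ ⟨x, hx⟩ ⟨y, hy⟩
  have hl' : ∀ e x y, G.IsLink e x y → X.IsLink (ψ e) (φ x) (φ y) := fun e x y h =>
    (hl e h.edge_mem x h.left_mem y h.right_mem).1 h
  cases h with
  | deleteIsolated v hv hiso eq =>
    subst eq
    have hsub : (G.deleteVerts {v}) ≤ G := deleteVerts_le
    have hφv : ∀ x ∈ G.vertexSet, x ≠ v → φ x ≠ φ v := fun x hx hne h => hne (hφi hx hv h)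
    refine ⟨X.deleteVerts {φ v}, .deleteIsolated (φ v) (hφV v hv) ?_ rfl, φ, ψ, ?_,
      hφi.mono hsub.vertexSet_mono, hψi.mono hsub.edgeSet_mono, ?_⟩
    · rintro f ⟨y, hf⟩
      obtain ⟨e, he, rfl⟩ := hψs f hf.edge_mem
      obtain ⟨a, b, hab⟩ := exists_isLink_of_mem_edgeSet he
      rcases (hl' _ _ _ hab).eq_and_eq_or_eq_and_eq hf with ⟨h1, -⟩ | ⟨-, h1⟩
      · exact hiso e (hφi hab.left_mem hv h1 ▸ hab.inc_left)
      · exact hiso e (hφi hab.right_mem hv h1 ▸ hab.inc_right)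
    · intro x hx
      rw [vertexSet_deleteVerts] at hx ⊢
      exact ⟨hφV x hx.1, hφv x hx.1 hx.2⟩
    · intro e x y h
      rw [deleteVerts_isLink] at h ⊢
      exact ⟨hl' _ _ _ h.1, hφv x h.1.left_mem h.2.1, hφv y h.1.right_mem h.2.2⟩
  | deleteEdge e he eq =>
    subst eq
    have hsub : (G.deleteEdges {e}) ≤ G := deleteEdges_le
    refine ⟨X.deleteEdges {ψ e}, .deleteEdge (ψ e) (hψE e he) rfl, φ, ψ, hφV, hφi,
      hψi.mono hsub.edgeSet_mono, ?_⟩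
    intro f x y h
    rw [deleteEdges_isLink] at h ⊢
    exact ⟨hl' _ _ _ h.1, fun hf => h.2 (hψi h.1.edge_mem he hf)⟩
  | contractEdge e u v he hpar eq =>
    subst eq
    have hr : ∀ a ∈ G.vertexSet, (if φ a = φ v then φ u else φ a) = φ (if a = v then u else a) := by
      intro a ha
      by_cases hav : a = v
      · simp [hav]
      · rw [if_neg hav, if_neg fun h => hav (hφi ha he.right_mem h)]
    have hE : (G.contractLink e u v).edgeSet ⊆ G.edgeSet := by
      intro f hf
      obtain ⟨x, y, h⟩ := exists_isLink_of_mem_edgeSet hf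
      obtain ⟨a, b, hab, -⟩ := contractLink_isLink.1 h
      exact hab.1.edge_mem
    have hV : (G.contractLink e u v).vertexSet ⊆ G.vertexSet := by
      intro x hx
      obtain ⟨a, ha, rfl⟩ := mem_vertexSet_contractLink.1 hx
      split_ifs
      · exact he.left_mem
      · exact ha
    refine ⟨X.contractLink (ψ e) (φ u) (φ v), .contractEdge (ψ e) (φ u) (φ v) (hl' _ _ _ he) ?_ rfl,
      φ, ψ, ?_, hφi.mono hV, hψi.mono hE, ?_⟩
    · intro f hf
      obtain ⟨f, hf', rfl⟩ := hψs f hf.edge_mem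
      rw [hpar f ((hl f hf' u he.left_mem v he.right_mem).2 hf)]
    · intro x hx
      obtain ⟨a, ha, rfl⟩ := mem_vertexSet_contractLink.1 hx
      exact mem_vertexSet_contractLink.2 ⟨φ a, hφV a ha, hr a ha⟩
    · intro f x y h
      obtain ⟨a, b, ⟨hab, hne⟩, rfl, rfl⟩ := contractLink_isLink.1 h
      exact contractLink_isLink.2 ⟨φ a, φ b, ⟨hl' _ _ _ hab, fun h => hne (hψi hab.edge_mem
        he.edge_mem h)⟩, hr a hab.left_mem, hr b hab.right_mem⟩

/-- Graphs isomorphic to an obstruction are minor-minimal with spectator floor `2`. -/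
theorem IsObstruction.isMinorMinimal {n m : ℕ} {l : Fin m → Fin n × Fin n} (hl : IsObstruction l)
    {G : Graph α β} (hG : G.IsMultigraph) (h : G.Isomorphic (edgeGraph l)) :
    G.IsMinorMinimalWithSpectatorFloor 2 := by
  have hm : m ≠ 0 := by
    rintro rfl
    refine hl.not_isNearPath ⟨true, fun i => some (i : ℕ), ?_, ?_, ?_⟩
    · intro i _ j _ hij
      simpa [Fin.ext_iff] using hij
    · intro e
      exact e.elim0
    · intro e
      exact e.elim0
  have : Nonempty (Fin m) := ⟨⟨0, Nat.pos_of_ne_zero hm⟩⟩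
  have : Nonempty (Fin n) := ⟨(l (Classical.arbitrary _)).1⟩
  obtain ⟨H, hH, hs, hE⟩ := hl.exists_host
  have hn : ¬ (edgeGraph l).IsNearPath := hl.not_isNearPath
  constructor
  · rw [spectatorFloor_congr h]
    exact spectatorFloor_eq_two hn hH hs (hE.isMinorOf hH.finite_vertexSet hH.finite_edgeSet)
  · rintro G' ⟨-, hG'⟩
    have hfin : ∀ K : Graph α β, Relation.ReflTransGen IsElementaryMinor K G →
        K.vertexSet.Finite ∧ K.edgeSet.Finite := by
      intro K hK
      induction hK using Relation.ReflTransGen.head_induction_on with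
      | refl => exact ⟨hG.finite_vertexSet, hG.finite_edgeSet⟩
      | head h _ ih => exact h.finite ih.1 ih.2
    obtain ⟨hV, hE⟩ := hfin G' hG'.to_reflTransGen
    obtain ⟨K, hK, hKG⟩ := Relation.TransGen.tail'_iff.1 hG'
    obtain ⟨X, hX, hi⟩ := hKG.exists_embeds h
    have := (((hl.isNearPath X hX).of_embeds hi).of_reflTransGen hK).spectatorFloor_le_one hV hE
    omega

/-- A minor-minimal graph with spectator floor `2` that has an obstruction as a minor is isomorphic
to it. -/
theorem IsObstruction.isomorphic {n m : ℕ} {l : Fin m → Fin n × Fin n} (hl : IsObstruction l)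
    {G : Graph α β} (hG : G.IsMinorMinimalWithSpectatorFloor 2) (h : (edgeGraph l).IsMinorOf G) :
    G.Isomorphic (edgeGraph l) := by
  obtain ⟨G', hG', hi⟩ := h
  rcases Relation.reflTransGen_iff_eq_or_transGen.1 hG' with rfl | hT
  · exact hi.symm
  · obtain ⟨H, hH, hs, hE⟩ := hl.exists_host
    refine absurd ?_ (hG.2 G' ⟨?_, hT⟩)
    · rw [← spectatorFloor_congr hi]
      exact spectatorFloor_eq_two hl.not_isNearPath hH hs
        (hE.isMinorOf hH.finite_vertexSet hH.finite_edgeSet)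
    · obtain ⟨φ, -⟩ := hi
      have hn : Nonempty (edgeGraph l).vertexSet := by
        by_contra hne
        rw [not_nonempty_iff] at hne
        refine hl.not_isNearPath ⟨true, fun _ => none, fun x hx => ?_, ?_, ?_⟩
        · exact (hne.false ⟨x, hx⟩).elim
        · intro e x y h
          exact (hne.false ⟨x, h.left_mem⟩).elim
        · intro e f x y h
          exact (hne.false ⟨x, h.left_mem⟩).elim
      exact ⟨_, (φ hn.some).2⟩

/-! ### Layouts of linear forests -/

/-- The vertices of a finite linear forest can be placed on distinct integers so that neighbours are
consecutive. That there are no cycles is expressed by the condition that every nonempty set of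
vertices has a member with at most one neighbour in the set. -/
theorem exists_linear_layout {R : α → α → Prop} (symm : ∀ x y, R x y → R y x)
    (irrefl : ∀ x, ¬ R x x) (S : Finset α)
    (deg : ∀ x ∈ S, ∀ a ∈ S, ∀ b ∈ S, ∀ c ∈ S, R x a → R x b → R x c → a = b ∨ a = c ∨ b = c)
    (acyclic : ∀ T ⊆ S, T.Nonempty → ∃ x ∈ T, ∀ y ∈ T, ∀ z ∈ T, R x y → R x z → y = z) :
    ∃ f : α → ℤ, Set.InjOn f S ∧
      ∀ x ∈ S, ∀ y ∈ S, R x y → f x = f y + 1 ∨ f y = f x + 1 := by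
  classical
  induction S using Finset.strongInduction with
  | H S ih =>
  rcases S.eq_empty_or_nonempty with rfl | hne
  · exact ⟨fun _ => 0, by simp, by simp⟩
  obtain ⟨x, hx, hx1⟩ := acyclic S subset_rfl hne
  have hsub : S.erase x ⊆ S := Finset.erase_subset _ _
  obtain ⟨f, hf, hadj⟩ := ih (S.erase x) (Finset.erase_ssubset hx)
    (fun y hy a ha b hb c hc => deg y (hsub hy) a (hsub ha) b (hsub hb) c (hsub hc))
    (fun T hT => acyclic T (hT.trans hsub))
  by_cases hnb : ∃ y ∈ S, R x y
  · obtain ⟨y, hy, hxy⟩ := hnb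
    have hyx : y ≠ x := by
      rintro rfl
      exact irrefl _ hxy
    have hy' : y ∈ S.erase x := Finset.mem_erase.2 ⟨hyx, hy⟩
    have hy1 : ∀ a ∈ S.erase x, ∀ b ∈ S.erase x, R y a → R y b → a = b := by
      intro a ha b hb hya hyb
      rcases deg y hy a (hsub ha) b (hsub hb) x hx hya hyb (symm _ _ hxy) with h | h | h
      · exact h
      · exact absurd h (Finset.ne_of_mem_erase ha)
      · exact absurd h (Finset.ne_of_mem_erase hb)
    -- After a reflection, the other neighbour of `y` comes before `y`; `x` is inserted after `y`.
    obtain ⟨g, hg, hadj', hup⟩ : ∃ g : α → ℤ, Set.InjOn g (S.erase x) ∧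
        (∀ a ∈ S.erase x, ∀ b ∈ S.erase x, R a b → g a = g b + 1 ∨ g b = g a + 1) ∧
        ∀ a ∈ S.erase x, R y a → g a ≠ g y + 1 := by
      by_cases hz : ∃ z ∈ S.erase x, R y z ∧ f z = f y + 1
      · obtain ⟨z, hz, hyz, hfz⟩ := hz
        refine ⟨fun a => - f a, fun a ha b hb hab => hf ha hb (neg_injective hab), ?_, ?_⟩
        · intro a ha b hb hab
          have := hadj a ha b hb hab
          dsimp only
          omega
        · intro a ha hya
          rw [hy1 a ha z hz hya hyz]
          dsimp only
          omega
      · exact ⟨f, hf, hadj, fun a ha hya h => hz ⟨a, ha, hya, h⟩⟩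
    refine ⟨fun a => if a = x then g y + 1 else if g y < g a then g a + 1 else g a, ?_, ?_⟩
    · intro a ha b hb hab
      by_cases hax : a = x <;> by_cases hbx : b = x <;> simp only [hax, hbx, if_true, if_false] at hab
      · rw [hax, hbx]
      · split_ifs at hab <;> omega
      · split_ifs at hab <;> omega
      · refine hg (Finset.mem_erase.2 ⟨hax, ha⟩) (Finset.mem_erase.2 ⟨hbx, hb⟩) ?_
        split_ifs at hab <;> omega
    · have hother : ∀ b ∈ S, b ≠ x → R x b → b = y := fun b hb _ h => hx1 b hb y hy h hxy
      intro a ha b hb hab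
      by_cases hax : a = x <;> by_cases hbx : b = x <;> simp only [hax, hbx, if_true, if_false]
      · rw [hax, hbx] at hab
        exact absurd hab (irrefl x)
      · rw [hax] at hab
        rw [hother b hb hbx hab]
        simp
      · rw [hbx] at hab
        rw [hother a ha hax (symm _ _ hab)]
        simp
      · have ha' := Finset.mem_erase.2 ⟨hax, ha⟩
        have hb' := Finset.mem_erase.2 ⟨hbx, hb⟩
        have h1 := hadj' a ha' b hb' hab
        have h2 : g a = g y → g b ≠ g y + 1 := by
          intro h
          rw [hg ha' hy' h] at hab
          exact hup b hb' hab
        have h3 : g b = g y → g a ≠ g y + 1 := by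
          intro h
          rw [hg hb' hy' h] at hab
          exact hup a ha' (symm _ _ hab)
        split_ifs <;> omega
  · obtain ⟨M, hM⟩ := (S.image f).exists_le
    have hM' : ∀ a ∈ S, f a ≠ M + 1 := by
      intro a ha
      have := hM (f a) (Finset.mem_image_of_mem f ha)
      omega
    refine ⟨fun a => if a = x then M + 1 else f a, ?_, ?_⟩
    · intro a ha b hb hab
      by_cases hax : a = x <;> by_cases hbx : b = x <;> simp only [hax, hbx, if_true, if_false] at hab
      · rw [hax, hbx]
      · exact absurd hab.symm (hM' b hb)
      · exact absurd hab (hM' a ha)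
      · exact hf (Finset.mem_erase.2 ⟨hax, ha⟩) (Finset.mem_erase.2 ⟨hbx, hb⟩) hab
    · intro a ha b hb hab
      have hax : a ≠ x := by
        rintro rfl
        exact hnb ⟨b, hb, hab⟩
      have hbx : b ≠ x := by
        rintro rfl
        exact hnb ⟨a, ha, symm _ _ hab⟩
      simp only [hax, hbx, if_false]
      exact hadj a (Finset.mem_erase.2 ⟨hax, ha⟩) b (Finset.mem_erase.2 ⟨hbx, hb⟩) hab

/-! ### Subgraphs and minors in terms of adjacency -/

/-- `x` and `y` are joined by at least two parallel edges. -/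
def Thick (G : Graph α β) (x y : α) : Prop :=
  ∃ e f, e ≠ f ∧ G.IsLink e x y ∧ G.IsLink f x y

theorem Thick.symm {G : Graph α β} {x y : α} (h : G.Thick x y) : G.Thick y x := by
  obtain ⟨e, f, hef, he, hf⟩ := h
  exact ⟨e, f, hef, he.symm, hf.symm⟩

theorem Thick.adj {G : Graph α β} {x y : α} (h : G.Thick x y) : G.Adj x y := by
  obtain ⟨e, -, -, he, -⟩ := h
  exact ⟨e, he⟩

/-- To find a listed graph without multiplicities above `2` as a subgraph, it suffices to find its
vertices, adjacent or joined by parallel edges as required. -/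
theorem IsMultigraph.edgeGraph_isMinorOf {n m : ℕ} {G : Graph α β} (hG : G.IsMultigraph)
    {l : Fin m → Fin n × Fin n} (φ : Fin n → α) (hφ : Function.Injective φ)
    (hinc : ∀ v, ∃ e, (l e).1 = v ∨ (l e).2 = v)
    (hl : ∀ e f, e < f → l e ≠ (l f).swap ∧ (l e = l f → ∀ g < e, l g ≠ l e))
    (hadj : ∀ e, G.Adj (φ (l e).1) (φ (l e).2))
    (hthick : ∀ e, (∃ f, f ≠ e ∧ l f = l e) → G.Thick (φ (l e).1) (φ (l e).2)) :
    (edgeGraph l).IsMinorOf G := by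
  classical
  have hE : ∀ p : Fin n × Fin n, ∃ e f : β, (G.Adj (φ p.1) (φ p.2) → G.IsLink e (φ p.1) (φ p.2)) ∧
      (G.Thick (φ p.1) (φ p.2) → G.IsLink f (φ p.1) (φ p.2) ∧ e ≠ f) ∨ ¬ G.Adj (φ p.1) (φ p.2) ∨
      m = 0 := by
    intro p
    by_cases ht : G.Thick (φ p.1) (φ p.2)
    · obtain ⟨e, f, hef, he, hf⟩ := ht
      exact ⟨e, f, Or.inl ⟨fun _ => he, fun _ => ⟨hf, hef⟩⟩⟩
    · by_cases ha : G.Adj (φ p.1) (φ p.2)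
      · obtain ⟨e, he⟩ := ha
        exact ⟨e, e, Or.inl ⟨fun _ => he, fun h => absurd h ht⟩⟩
      · by_cases hm : m = 0
        · subst hm
          obtain ⟨e, -⟩ := hinc p.1
          exact e.elim0
        · obtain ⟨e, -⟩ := hadj ⟨0, Nat.pos_of_ne_zero hm⟩
          exact ⟨e, e, Or.inr (Or.inl ha)⟩
  choose E₁ E₂ hE using hE
  have h1 : ∀ e, G.IsLink (E₁ (l e)) (φ (l e).1) (φ (l e).2) := by
    intro e
    rcases hE (l e) with h | h | h
    · exact h.1 (hadj e)
    · exact absurd (hadj e) h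
    · subst h
      exact e.elim0
  have h2 : ∀ e, (∃ f, f ≠ e ∧ l f = l e) → G.IsLink (E₂ (l e)) (φ (l e).1) (φ (l e).2) ∧
      E₁ (l e) ≠ E₂ (l e) := by
    intro e he
    rcases hE (l e) with h | h | h
    · exact h.2 (hthick e he)
    · exact absurd (hadj e) h
    · subst h
      exact e.elim0
  refine Embeds.isMinorOf (edgeGraph_embeds φ
    (fun e => if ∃ f < e, l f = l e then E₂ (l e) else E₁ (l e)) hφ ?_ ?_ ?_)
    hG.finite_vertexSet hG.finite_edgeSet
  · intro v
    obtain ⟨e, rfl | rfl⟩ := hinc v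
    · exact (hadj e).left_mem
    · exact (hadj e).right_mem
  · intro e
    split_ifs with h
    · obtain ⟨f, hf, hfe⟩ := h
      exact (h2 e ⟨f, hf.ne, hfe⟩).1
    · exact h1 e
  · rintro e f hef (h | h)
    · rw [if_neg, if_pos ⟨e, hef, h⟩, ← h]
      · exact (h2 e ⟨f, hef.ne', h.symm⟩).2
      · rintro ⟨g, hg, hge⟩
        exact (hl e f hef).2 h g hg hge
    · exact absurd h (hl e f hef).1

/-- `G` is a multigraph without any of the eleven obstructions as a minor. -/
structure ExcludesObstructions (G : Graph α β) : Prop where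
  isMultigraph : G.IsMultigraph
  C2C2 : ¬ (edgeGraph endsC2C2).IsMinorOf G
  C2Star : ¬ (edgeGraph endsC2Star).IsMinorOf G
  StarStar : ¬ (edgeGraph endsStarStar).IsMinorOf G
  C4 : ¬ (edgeGraph endsC4).IsMinorOf G
  H1 : ¬ (edgeGraph endsH1).IsMinorOf G
  H2 : ¬ (edgeGraph endsH2).IsMinorOf G
  H3 : ¬ (edgeGraph endsH3).IsMinorOf G
  H4 : ¬ (edgeGraph endsH4).IsMinorOf G
  H5 : ¬ (edgeGraph endsH5).IsMinorOf G
  Star4 : ¬ (edgeGraph endsStar4).IsMinorOf G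
  LongY : ¬ (edgeGraph endsLongY).IsMinorOf G

namespace ExcludesObstructions

variable {G : Graph α β}

theorem ne (hG : G.ExcludesObstructions) {x y : α} (h : G.Adj x y) : x ≠ y :=
  hG.isMultigraph.ne h

theorem no_C2C2 (hG : G.ExcludesObstructions) {a b c d : α} (h1 : G.Thick a b) (h2 : G.Thick c d)
    (hn : [a, b, c, d].Nodup) : False := by
  refine hG.C2C2 (hG.isMultigraph.edgeGraph_isMinorOf [a, b, c, d].get
    (List.nodup_iff_injective_get.1 hn) (by decide) (by decide) ?_ ?_) <;> intro e <;> fin_cases e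
  exacts [h1.adj, h1.adj, h2.adj, h2.adj, fun _ => h1, fun _ => h1, fun _ => h2, fun _ => h2]

theorem no_C2Star (hG : G.ExcludesObstructions) {a b c x y z : α} (h1 : G.Thick a b)
    (h2 : G.Adj c x) (h3 : G.Adj c y) (h4 : G.Adj c z) (hn : [a, b, c, x, y, z].Nodup) :
    False := by
  refine hG.C2Star (hG.isMultigraph.edgeGraph_isMinorOf [a, b, c, x, y, z].get
    (List.nodup_iff_injective_get.1 hn) (by decide) (by decide) ?_ ?_) <;> intro e <;> fin_cases e
  exacts [h1.adj, h1.adj, h2, h3, h4, fun _ => h1, fun _ => h1, fun h => absurd h (by decide),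
    fun h => absurd h (by decide), fun h => absurd h (by decide)]

theorem no_StarStar (hG : G.ExcludesObstructions) {c x y z d u v w : α} (h1 : G.Adj c x)
    (h2 : G.Adj c y) (h3 : G.Adj c z) (h4 : G.Adj d u) (h5 : G.Adj d v) (h6 : G.Adj d w)
    (hn : [c, x, y, z, d, u, v, w].Nodup) : False := by
  refine hG.StarStar (hG.isMultigraph.edgeGraph_isMinorOf [c, x, y, z, d, u, v, w].get
    (List.nodup_iff_injective_get.1 hn) (by decide) (by decide) ?_
    fun e h => absurd h (by revert e; decide))
  intro e
  fin_cases e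
  exacts [h1, h2, h3, h4, h5, h6]

theorem no_C4 (hG : G.ExcludesObstructions) {a b c d : α} (h1 : G.Adj a b) (h2 : G.Adj b c)
    (h3 : G.Adj c d) (h4 : G.Adj d a) (hac : a ≠ c) (hbd : b ≠ d) : False := by
  have := hG.ne h1
  have := hG.ne h2
  have := hG.ne h3
  have := hG.ne h4
  refine hG.C4 (hG.isMultigraph.edgeGraph_isMinorOf [a, b, c, d].get
    (List.nodup_iff_injective_get.1 (by grind)) (by decide) (by decide) ?_
    fun e h => absurd h (by revert e; decide))
  intro e
  fin_cases e
  exacts [h1, h2, h3, h4]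

theorem no_H1 (hG : G.ExcludesObstructions) {a b c : α} (h1 : G.Thick a b) (h2 : G.Thick b c)
    (h3 : G.Thick c a) : False := by
  have := hG.ne h1.adj
  have := hG.ne h2.adj
  have := hG.ne h3.adj
  refine hG.H1 (hG.isMultigraph.edgeGraph_isMinorOf [a, b, c].get
    (List.nodup_iff_injective_get.1 (by grind)) (by decide) (by decide) ?_ ?_) <;>
    intro e <;> fin_cases e
  exacts [h1.adj, h1.adj, h2.adj, h2.adj, h3.adj, h3.adj, fun _ => h1, fun _ => h1, fun _ => h2,
    fun _ => h2, fun _ => h3, fun _ => h3]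

theorem no_H2 (hG : G.ExcludesObstructions) {c a b d : α} (h1 : G.Thick c a) (h2 : G.Thick c b)
    (h3 : G.Adj c d) (hn : [a, b, d].Nodup) : False := by
  have := hG.ne h1.adj
  have := hG.ne h2.adj
  have := hG.ne h3
  refine hG.H2 (hG.isMultigraph.edgeGraph_isMinorOf [c, a, b, d].get
    (List.nodup_iff_injective_get.1 (by grind)) (by decide) (by decide) ?_ ?_) <;>
    intro e <;> fin_cases e
  exacts [h1.adj, h1.adj, h2.adj, h2.adj, h3, fun _ => h1, fun _ => h1, fun _ => h2, fun _ => h2,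
    fun h => absurd h (by decide)]

theorem no_H3 (hG : G.ExcludesObstructions) {a b c d : α} (h1 : G.Adj a b) (h2 : G.Adj b c)
    (h3 : G.Adj c a) (h4 : G.Thick a d) (hb : d ≠ b) (hc : d ≠ c) : False := by
  have := hG.ne h1
  have := hG.ne h2
  have := hG.ne h3
  have := hG.ne h4.adj
  refine hG.H3 (hG.isMultigraph.edgeGraph_isMinorOf [a, b, c, d].get
    (List.nodup_iff_injective_get.1 (by grind)) (by decide) (by decide) ?_ ?_) <;>
    intro e <;> fin_cases e
  exacts [h1, h2, h3, h4.adj, h4.adj, fun h => absurd h (by decide), fun h => absurd h (by decide),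
    fun h => absurd h (by decide), fun _ => h4, fun _ => h4]

theorem no_H4 (hG : G.ExcludesObstructions) {a b c d e : α} (h1 : G.Thick a b) (h2 : G.Adj a c)
    (h3 : G.Adj a d) (h4 : G.Adj b e) (hn : [a, b, c, d, e].Nodup) : False := by
  refine hG.H4 (hG.isMultigraph.edgeGraph_isMinorOf [a, b, c, d, e].get
    (List.nodup_iff_injective_get.1 hn) (by decide) (by decide) ?_ ?_) <;>
    intro e <;> fin_cases e
  exacts [h1.adj, h1.adj, h2, h3, h4, fun _ => h1, fun _ => h1, fun h => absurd h (by decide),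
    fun h => absurd h (by decide), fun h => absurd h (by decide)]

theorem no_H5 (hG : G.ExcludesObstructions) {c a b d e : α} (h1 : G.Adj c a) (h2 : G.Adj c b)
    (h3 : G.Adj c d) (h4 : G.Thick d e) (hn : [c, a, b, d, e].Nodup) : False := by
  refine hG.H5 (hG.isMultigraph.edgeGraph_isMinorOf [a, b, c, d, e].get
    (List.nodup_iff_injective_get.1 (by grind)) (by decide) (by decide) ?_ ?_) <;>
    intro e <;> fin_cases e
  exacts [h1.symm, h2.symm, h3, h4.adj, h4.adj, fun h => absurd h (by decide),
    fun h => absurd h (by decide), fun h => absurd h (by decide), fun _ => h4, fun _ => h4]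

theorem no_Star4 (hG : G.ExcludesObstructions) {c w x y z : α} (h1 : G.Adj c w) (h2 : G.Adj c x)
    (h3 : G.Adj c y) (h4 : G.Adj c z) (hn : [w, x, y, z].Nodup) : False := by
  have := hG.ne h1
  have := hG.ne h2
  have := hG.ne h3
  have := hG.ne h4
  refine hG.Star4 (hG.isMultigraph.edgeGraph_isMinorOf [c, w, x, y, z].get
    (List.nodup_iff_injective_get.1 (by grind)) (by decide) (by decide) ?_
    fun e h => absurd h (by revert e; decide))
  intro e
  fin_cases e
  exacts [h1, h2, h3, h4]

theorem no_LongY (hG : G.ExcludesObstructions) {c a a' b b' d d' : α} (h1 : G.Adj c a)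
    (h2 : G.Adj a a') (h3 : G.Adj c b) (h4 : G.Adj b b') (h5 : G.Adj c d) (h6 : G.Adj d d')
    (hn : [c, a, a', b, b', d, d'].Nodup) : False := by
  refine hG.LongY (hG.isMultigraph.edgeGraph_isMinorOf [c, a, a', b, b', d, d'].get
    (List.nodup_iff_injective_get.1 hn) (by decide) (by decide) ?_
    fun e h => absurd h (by revert e; decide))
  intro e
  fin_cases e
  exacts [h1, h2, h3, h4, h5, h6]

/-- The identification of two adjacent vertices `x` and `y`, in terms of adjacency. -/
theorem exists_identify (hG : G.ExcludesObstructions) {x y : α} (h : G.Adj x y) :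
    ∃ G' : Graph α β, G'.ExcludesObstructions ∧
      (∀ a, a ∈ G'.vertexSet ↔ a ∈ G.vertexSet ∧ a ≠ y) ∧
      (∀ a b, G.Adj a b → a ≠ y → b ≠ y → G'.Adj a b) ∧
      (∀ b, G.Adj y b → b ≠ x → G'.Adj x b) ∧
      (∀ a b, G'.Adj a b → G.Adj a b ∨ (a = x ∧ G.Adj y b) ∨ (b = x ∧ G.Adj a y)) ∧
      (∀ a b, G.Thick a b → a ≠ y → b ≠ y → G'.Thick a b) ∧
      (∀ b, G.Adj x b → G.Adj y b → G'.Thick x b) := by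
  classical
  have hxy := hG.ne h
  obtain ⟨G', hG', hm, hV, hl⟩ := hG.isMultigraph.exists_identify h
  have push : ∀ f a b, G.IsLink f a b → a ≠ y → b ≠ y → G'.IsLink f a b := by
    intro f a b hf ha hb
    refine (hl f a b).2 ⟨a, b, hf, fun hf' => ?_, if_neg ha, if_neg hb⟩
    rcases hf.eq_and_eq_or_eq_and_eq hf' with ⟨-, h⟩ | ⟨h, -⟩
    · exact hb h
    · exact ha h
  have push' : ∀ f b, G.IsLink f y b → b ≠ x → G'.IsLink f x b := by
    intro f b hf hb
    refine (hl f x b).2 ⟨y, b, hf, fun hf' => ?_, if_pos rfl, if_neg (hG.ne ⟨f, hf⟩).symm⟩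
    rcases hf.eq_and_eq_or_eq_and_eq hf' with ⟨h, -⟩ | ⟨-, h⟩
    · exact hxy h.symm
    · exact hb h
  refine ⟨G', ⟨hm, fun h => hG.C2C2 (h.trans_reflTransGen hG'),
    fun h => hG.C2Star (h.trans_reflTransGen hG'), fun h => hG.StarStar (h.trans_reflTransGen hG'),
    fun h => hG.C4 (h.trans_reflTransGen hG'), fun h => hG.H1 (h.trans_reflTransGen hG'),
    fun h => hG.H2 (h.trans_reflTransGen hG'), fun h => hG.H3 (h.trans_reflTransGen hG'),
    fun h => hG.H4 (h.trans_reflTransGen hG'), fun h => hG.H5 (h.trans_reflTransGen hG'),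
    fun h => hG.Star4 (h.trans_reflTransGen hG'), fun h => hG.LongY (h.trans_reflTransGen hG')⟩,
    hV, ?_, ?_, ?_, ?_, ?_⟩
  · rintro a b ⟨f, hf⟩ ha hb
    exact ⟨f, push f a b hf ha hb⟩
  · rintro b ⟨f, hf⟩ hb
    exact ⟨f, push' f b hf hb⟩
  · rintro a b ⟨f, hf⟩
    obtain ⟨a₀, b₀, h1, h2, h3, h4⟩ := (hl f a b).1 hf
    split_ifs at h3 h4 with h5 h6 h6
    · subst h5 h6
      exact absurd h1 hG.isMultigraph.not_isLink_self
    · subst h5 h3 h4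
      exact Or.inr (Or.inl ⟨rfl, f, h1⟩)
    · subst h6 h3 h4
      exact Or.inr (Or.inr ⟨rfl, f, h1⟩)
    · subst h3 h4
      exact Or.inl ⟨f, h1⟩
  · rintro a b ⟨e, f, hef, he, hf⟩ ha hb
    exact ⟨e, f, hef, push e a b he ha hb, push f a b hf ha hb⟩
  · intro b hx hy
    have hbx := (hG.ne hx).symm
    have hby := (hG.ne hy).symm
    obtain ⟨e, he⟩ := hx
    obtain ⟨f, hf⟩ := hy
    refine ⟨e, f, ?_, push e x b he hxy hby, push' f b hf hbx⟩
    rintro rfl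
    exact hxy (he.left_unique hf)

/-! ### Cycles and stars in graphs without obstructions -/

/-- Long cycles have a `C₄`-minor, so there are only triangles: a finite set each of whose members
has two neighbours in the set contains a triangle. Otherwise, two adjacent members of the set may be
identified without destroying this property. -/
theorem exists_triangle (S : Finset α) (hG : G.ExcludesObstructions) (hne : S.Nonempty)
    (hS : ∀ x ∈ S, ∃ y ∈ S, ∃ z ∈ S, y ≠ z ∧ G.Adj x y ∧ G.Adj x z) :
    ∃ x ∈ S, ∃ y ∈ S, ∃ z ∈ S, G.Adj x y ∧ G.Adj y z ∧ G.Adj x z := by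
  classical
  induction S using Finset.strongInduction generalizing G with
  | H S ih =>
  by_contra! hT
  obtain ⟨x, hx⟩ := hne
  obtain ⟨y, hy, -, -, -, hxy, -⟩ := hS x hx
  have hxyne := hG.ne hxy
  obtain ⟨G', hG', -, push, push', pull, -, -⟩ := hG.exists_identify hxy
  have hother : ∀ v ∈ S, ∀ u, ∃ w ∈ S, w ≠ u ∧ G.Adj v w := by
    intro v hv u
    obtain ⟨p, hp, q, hq, hpq, hvp, hvq⟩ := hS v hv
    by_cases hpu : p = u
    · exact ⟨q, hq, fun h => hpq (hpu.trans h.symm), hvq⟩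
    · exact ⟨p, hp, hpu, hvp⟩
  have hxS : x ∈ S.erase y := Finset.mem_erase.2 ⟨hxyne, hx⟩
  obtain ⟨p, hp, q, hq, r, hr, hpq, hqr, hpr⟩ := ih (S.erase y) (Finset.erase_ssubset hy) hG'
    ⟨x, hxS⟩ (by
      intro v hv
      obtain ⟨hvy, hvS⟩ := Finset.mem_erase.1 hv
      by_cases hvx : v = x
      · subst hvx
        obtain ⟨a, ha, hay, hva⟩ := hother v hx y
        obtain ⟨b, hb, hbv, hyb⟩ := hother y hy v
        refine ⟨a, Finset.mem_erase.2 ⟨hay, ha⟩, b, Finset.mem_erase.2 ⟨(hG.ne hyb).symm, hb⟩, ?_,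
          push _ _ hva hvy hay, push' _ hyb hbv⟩
        rintro rfl
        exact hT v hx y hy a ha hxy hyb hva
      · obtain ⟨a, ha, b, hb, hab, hva, hvb⟩ := hS v hvS
        have key : ∀ c ∈ S, c ≠ y → G.Adj v c → G.Adj v y →
            ∃ s ∈ S.erase y, ∃ t ∈ S.erase y, s ≠ t ∧ G'.Adj v s ∧ G'.Adj v t := by
          intro c hc hcy hvc hvy'
          refine ⟨x, hxS, c, Finset.mem_erase.2 ⟨hcy, hc⟩, ?_, (push' v hvy'.symm hvx).symm,
            push _ _ hvc hvy hcy⟩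
          rintro rfl
          exact hT v hvS x hx y hy hvc hxy hvy'
        by_cases hay : a = y
        · subst hay
          exact key b hb hab.symm hvb hva
        · by_cases hby : b = y
          · subst hby
            exact key a ha hab hva hvb
          · exact ⟨a, Finset.mem_erase.2 ⟨hay, ha⟩, b, Finset.mem_erase.2 ⟨hby, hb⟩, hab,
              push _ _ hva hvy hay, push _ _ hvb hvy hby⟩)
  -- A triangle at `x` that arises from the identification comes from a `4`-cycle through `x y`.
  have atx : ∀ q r, q ∈ S.erase y → r ∈ S.erase y → G'.Adj x q → G'.Adj x r → G'.Adj q r →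
      False := by
    intro q r hq hr hxq hxr hqr
    have hqx := (hG'.ne hxq).symm
    have hrx := (hG'.ne hxr).symm
    obtain ⟨hqy, hq⟩ := Finset.mem_erase.1 hq
    obtain ⟨hry, hr⟩ := Finset.mem_erase.1 hr
    have hqr' : G.Adj q r := by
      rcases pull _ _ hqr with h | ⟨h, -⟩ | ⟨h, -⟩
      · exact h
      · exact absurd h hqx
      · exact absurd h hrx
    have h1 : G.Adj x q ∨ G.Adj y q := by
      rcases pull _ _ hxq with h | ⟨-, h⟩ | ⟨h, -⟩
      · exact Or.inl h
      · exact Or.inr h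
      · exact absurd h hqx
    have h2 : G.Adj x r ∨ G.Adj y r := by
      rcases pull _ _ hxr with h | ⟨-, h⟩ | ⟨h, -⟩
      · exact Or.inl h
      · exact Or.inr h
      · exact absurd h hrx
    rcases h1 with h1 | h1 <;> rcases h2 with h2 | h2
    · exact hT x hx q hq r hr h1 hqr' h2
    · exact hG.no_C4 h1 hqr' h2.symm hxy.symm hrx.symm hqy
    · exact hG.no_C4 h2 hqr'.symm h1.symm hxy.symm hqx.symm hry
    · exact hT y hy q hq r hr h1 hqr' h2
  by_cases hpx : p = x
  · subst hpx
    exact atx q r hq hr hpq hpr hqr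
  by_cases hqx : q = x
  · subst hqx
    exact atx p r hp hr hpq.symm hqr hpr
  by_cases hrx : r = x
  · subst hrx
    exact atx p q hp hq hpr.symm hqr.symm hpq
  have old : ∀ a b, a ≠ x → b ≠ x → G'.Adj a b → G.Adj a b := by
    intro a b ha hb hab
    rcases pull _ _ hab with h | ⟨h, -⟩ | ⟨h, -⟩
    · exact h
    · exact absurd h ha
    · exact absurd h hb
  exact hT p (Finset.mem_of_mem_erase hp) q (Finset.mem_of_mem_erase hq) r
    (Finset.mem_of_mem_erase hr) (old _ _ hpx hqx hpq) (old _ _ hqx hrx hqr) (old _ _ hpx hrx hpr)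

/-- Contracting the edge between two vertices of degree at least `3` gives a `K_{1,4}`. -/
theorem no_doubleStar (hG : G.ExcludesObstructions) {c d a a' b b' : α} (h : G.Adj c d)
    (h1 : G.Adj c a) (h2 : G.Adj c a') (h3 : G.Adj d b) (h4 : G.Adj d b')
    (hn : [c, d, a, a', b, b'].Nodup) : False := by
  simp only [List.nodup_cons, List.mem_cons, List.not_mem_nil, or_false, not_or] at hn
  obtain ⟨G', hG', -, push, push', -⟩ := hG.exists_identify h
  exact hG'.no_Star4 (push _ _ h1 (by grind) (by grind)) (push _ _ h2 (by grind) (by grind))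
    (push' _ h3 (by grind)) (push' _ h4 (by grind)) (by
    simp only [List.nodup_cons, List.mem_cons, List.not_mem_nil, or_false, not_or]
    grind)

theorem no_doubleStar_of_common_neighbor (hG : G.ExcludesObstructions) {c m d a a' b b' : α}
    (h : G.Adj c m) (h' : G.Adj m d) (h1 : G.Adj c a) (h2 : G.Adj c a') (h3 : G.Adj d b)
    (h4 : G.Adj d b') (hn : [c, m, d, a, a', b, b'].Nodup) : False := by
  simp only [List.nodup_cons, List.mem_cons, List.not_mem_nil, or_false, not_or] at hn
  obtain ⟨G', hG', -, push, push', -⟩ := hG.exists_identify h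
  exact hG'.no_doubleStar (push' _ h' (by grind)) (push _ _ h1 (by grind) (by grind))
    (push _ _ h2 (by grind) (by grind)) (push _ _ h3 (by grind) (by grind))
    (push _ _ h4 (by grind) (by grind)) (by
    simp only [List.nodup_cons, List.mem_cons, List.not_mem_nil, or_false, not_or]
    grind)

/-- Contracting an edge of the triangle gives `C₂ ⊔ C₂`. -/
theorem no_triangle_thick (hG : G.ExcludesObstructions) {x y z a b : α} (h1 : G.Adj x y)
    (h2 : G.Adj y z) (h3 : G.Adj x z) (h4 : G.Thick a b) (hn : [x, y, z, a, b].Nodup) :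
    False := by
  simp only [List.nodup_cons, List.mem_cons, List.not_mem_nil, or_false, not_or] at hn
  obtain ⟨G', hG', -, -, -, -, pushT, merge⟩ := hG.exists_identify h1
  exact hG'.no_C2C2 (merge _ h3 h2) (pushT _ _ h4 (by grind) (by grind)) (by
    simp only [List.nodup_cons, List.mem_cons, List.not_mem_nil, or_false, not_or]
    grind)

/-- Contracting an edge of the triangle gives `C₂ ⊔ K_{1,3}`. -/
theorem no_triangle_star (hG : G.ExcludesObstructions) {x y z c u v w : α} (h1 : G.Adj x y)
    (h2 : G.Adj y z) (h3 : G.Adj x z) (h4 : G.Adj c u) (h5 : G.Adj c v) (h6 : G.Adj c w)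
    (hn : [x, y, z, c, u, v, w].Nodup) : False := by
  simp only [List.nodup_cons, List.mem_cons, List.not_mem_nil, or_false, not_or] at hn
  obtain ⟨G', hG', -, push, -, -, -, merge⟩ := hG.exists_identify h1
  exact hG'.no_C2Star (merge _ h3 h2) (push _ _ h4 (by grind) (by grind))
    (push _ _ h5 (by grind) (by grind)) (push _ _ h6 (by grind) (by grind)) (by
    simp only [List.nodup_cons, List.mem_cons, List.not_mem_nil, or_false, not_or]
    grind)

theorem no_disjoint_triangles (hG : G.ExcludesObstructions) {x y z p q r : α} (h1 : G.Adj x y)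
    (h2 : G.Adj y z) (h3 : G.Adj x z) (h4 : G.Adj p q) (h5 : G.Adj q r) (h6 : G.Adj p r)
    (hn : [x, y, z, p, q, r].Nodup) : False := by
  simp only [List.nodup_cons, List.mem_cons, List.not_mem_nil, or_false, not_or] at hn
  obtain ⟨G', hG', -, push, -, -, -, merge⟩ := hG.exists_identify h1
  exact hG'.no_triangle_thick (push _ _ h4 (by grind) (by grind)) (push _ _ h5 (by grind) (by grind))
    (push _ _ h6 (by grind) (by grind)) (merge _ h3 h2) (by
    simp only [List.nodup_cons, List.mem_cons, List.not_mem_nil, or_false, not_or]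
    grind)

/-- Contracting an edge of the triangle of a `3`-sun gives `H₄`. -/
theorem no_threeSun (hG : G.ExcludesObstructions) {x y z a b c : α} (h1 : G.Adj x y)
    (h2 : G.Adj y z) (h3 : G.Adj x z) (h4 : G.Adj x a) (h5 : G.Adj y b) (h6 : G.Adj z c)
    (hn : [x, y, z, a, b, c].Nodup) : False := by
  simp only [List.nodup_cons, List.mem_cons, List.not_mem_nil, or_false, not_or] at hn
  obtain ⟨G', hG', -, push, push', -, -, merge⟩ := hG.exists_identify h1
  exact hG'.no_H4 (merge _ h3 h2) (push _ _ h4 (by grind) (by grind)) (push' _ h5 (by grind))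
    (push _ _ h6 (by grind) (by grind)) (by
    simp only [List.nodup_cons, List.mem_cons, List.not_mem_nil, or_false, not_or]
    grind)

/-! ### Graphs without obstructions are near-paths -/

theorem exists_layout (hG : G.ExcludesObstructions) (S : Finset α)
    (deg : ∀ x ∈ S, ∀ a ∈ S, ∀ b ∈ S, ∀ c ∈ S, G.Adj x a → G.Adj x b → G.Adj x c →
      a = b ∨ a = c ∨ b = c)
    (triangle : ∀ x ∈ S, ∀ y ∈ S, ∀ z ∈ S, G.Adj x y → G.Adj y z → G.Adj x z → False) :
    ∃ f : α → ℤ, Set.InjOn f S ∧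
      ∀ x ∈ S, ∀ y ∈ S, G.Adj x y → f x = f y + 1 ∨ f y = f x + 1 := by
  refine exists_linear_layout (fun _ _ h => h.symm) (fun x h => hG.ne h rfl) S deg ?_
  intro T hT hne
  by_contra! hT2
  obtain ⟨x, hx, y, hy, z, hz, h1, h2, h3⟩ := exists_triangle T hG hne fun x hx => by
    obtain ⟨y, hy, z, hz, h1, h2, h3⟩ := hT2 x hx
    exact ⟨y, hy, z, hz, h3, h1, h2⟩
  exact triangle x (hT hx) y (hT hy) z (hT hz) h1 h2 h3

/-- If a vertex `w` has no neighbours outside an edge `s t` or a single vertex `s = t`, and the rest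
of the graph is a linear forest, then the graph is a near-path, `w` being the apex. -/
theorem isNearPath_of_apex (hG : G.ExcludesObstructions) {w s t : α} (hs : s ∈ G.vertexSet)
    (ht : t ∈ G.vertexSet) (hsw : s ≠ w) (htw : t ≠ w) (hst : s = t ∨ G.Adj s t)
    (hw : ∀ x, G.Adj w x → x = s ∨ x = t)
    (thick : ∀ a b, a ≠ w → b ≠ w → ¬ G.Thick a b)
    (deg : ∀ x, x ≠ w → ∀ a b c, a ≠ w → b ≠ w → c ≠ w → G.Adj x a → G.Adj x b → G.Adj x c →
      a = b ∨ a = c ∨ b = c)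
    (triangle : ∀ x y z, x ≠ w → y ≠ w → z ≠ w → G.Adj x y → G.Adj y z → G.Adj x z → False) :
    G.IsNearPath := by
  classical
  set S : Finset α := hG.isMultigraph.finite_vertexSet.toFinset.erase w with hS
  have memS : ∀ x, x ∈ S ↔ x ≠ w ∧ x ∈ G.vertexSet := by simp [hS]
  obtain ⟨f₀, hf₀, hadj₀⟩ := hG.exists_layout S
    (fun x hx a ha b hb c hc => deg x ((memS x).1 hx).1 a b c ((memS a).1 ha).1 ((memS b).1 hb).1
      ((memS c).1 hc).1)
    (fun x hx y hy z hz => triangle x y z ((memS x).1 hx).1 ((memS y).1 hy).1 ((memS z).1 hz).1)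
  -- Translate and reflect the layout so that `s` and `t` are on the spots `0` and `1`.
  obtain ⟨f, hf, hadj, hfs, hft⟩ : ∃ f : α → ℤ, Set.InjOn f S ∧
      (∀ x ∈ S, ∀ y ∈ S, G.Adj x y → f x = f y + 1 ∨ f y = f x + 1) ∧
      (f s = 0 ∨ f s = 1) ∧ (f t = 0 ∨ f t = 1) := by
    have h : f₀ t = f₀ s ∨ f₀ t = f₀ s + 1 ∨ f₀ t = f₀ s - 1 := by
      rcases hst with rfl | hst
      · exact Or.inl rfl
      · have := hadj₀ s ((memS s).2 ⟨hsw, hs⟩) t ((memS t).2 ⟨htw, ht⟩) hst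
        omega
    refine ⟨fun x => if f₀ t = f₀ s - 1 then f₀ s - f₀ x else f₀ x - f₀ s, ?_, ?_, ?_, ?_⟩
    · intro a ha b hb hab
      refine hf₀ ha hb ?_
      dsimp only at hab
      split_ifs at hab <;> omega
    · intro a ha b hb hab
      have := hadj₀ a ha b hb hab
      dsimp only
      split_ifs <;> omega
    · left
      simp
    · dsimp only
      split_ifs <;> omega
  refine ⟨true, fun x => if x = w then none else some (f x), ?_, ?_, ?_⟩
  · intro x hx y hy hxy
    by_cases hxw : x = w <;> by_cases hyw : y = w <;> simp only [hxw, hyw, if_true, if_false,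
      reduceCtorEq, Option.some.injEq] at hxy
    · rw [hxw, hyw]
    · exact hf ((memS x).2 ⟨hxw, hx⟩) ((memS y).2 ⟨hyw, hy⟩) hxy
  · intro e x y he
    have hxy : G.Adj x y := ⟨e, he⟩
    by_cases hxw : x = w <;> by_cases hyw : y = w <;> simp only [hxw, hyw, if_true, if_false]
    · exact absurd (hxw.trans hyw.symm) (hG.ne hxy)
    · refine ⟨rfl, ?_⟩
      rw [hxw] at hxy
      rcases hw y hxy with rfl | rfl
      · exact hfs
      · exact hft
    · refine ⟨rfl, ?_⟩
      rw [hyw] at hxy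
      rcases hw x hxy.symm with rfl | rfl
      · exact hfs
      · exact hft
    · exact hadj x ((memS x).2 ⟨hxw, he.left_mem⟩) y ((memS y).2 ⟨hyw, he.right_mem⟩) hxy
  · intro e f x y he hf hef
    refine Or.inl ⟨rfl, ?_⟩
    by_contra! hne
    have hxw : x ≠ w := fun h => hne.1 (if_pos h)
    have hyw : y ≠ w := fun h => hne.2 (if_pos h)
    exact thick x y hxw hyw ⟨e, f, hef, he, hf⟩

/-- A linear forest with thick edges: there is at most one thick edge, or there are two that share a
vertex, which becomes the apex. -/
theorem isNearPath_of_degree_le_two (hG : G.ExcludesObstructions)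
    (deg : ∀ x a b c, G.Adj x a → G.Adj x b → G.Adj x c → a = b ∨ a = c ∨ b = c)
    (triangle : ∀ x y z, G.Adj x y → G.Adj y z → G.Adj x z → False) : G.IsNearPath := by
  classical
  set S : Finset α := hG.isMultigraph.finite_vertexSet.toFinset with hS
  have memS : ∀ x, x ∈ S ↔ x ∈ G.vertexSet := by simp [hS]
  obtain ⟨f, hf, hadj⟩ := hG.exists_layout S (fun x _ a _ b _ c _ => deg x a b c)
    (fun x _ y _ z _ => triangle x y z)
  have hf : ∀ x ∈ G.vertexSet, ∀ y ∈ G.vertexSet, f x = f y → x = y := fun x hx y hy h =>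
    hf ((memS x).2 hx) ((memS y).2 hy) h
  have hadj : ∀ x y, G.Adj x y → f x = f y + 1 ∨ f y = f x + 1 := fun x y h =>
    hadj x ((memS x).2 h.left_mem) y ((memS y).2 h.right_mem) h
  by_cases h2 : ∃ c x y, x ≠ y ∧ G.Thick c x ∧ G.Thick c y
  · obtain ⟨c, x, y, hxy, hcx, hcy⟩ := h2
    have hcx' := hG.ne hcx.adj
    have hcy' := hG.ne hcy.adj
    have hc : ∀ p q, G.Thick p q → p = c ∨ q = c := by
      intro p q hpq
      by_contra! hne
      have hpq' := hG.ne hpq.adj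
      have h1 : p = x ∨ q = x := by
        by_contra! h
        exact hG.no_C2C2 hcx hpq (by grind)
      have h2 : p = y ∨ q = y := by
        by_contra! h
        exact hG.no_C2C2 hcy hpq (by grind)
      have hxy' : G.Adj x y := by
        rcases h1 with rfl | rfl <;> rcases h2 with rfl | rfl
        · exact absurd rfl hxy
        · exact hpq.adj
        · exact hpq.adj.symm
        · exact absurd rfl hxy
      exact triangle c x y hcx.adj hxy' hcy.adj
    refine ⟨true, fun v => if v = c then none else
      some (if f v < f c then f v - f c + 1 else f v - f c), ?_, ?_, ?_⟩
    · intro a ha b hb hab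
      by_cases hac : a = c <;> by_cases hbc : b = c <;> simp only [hac, hbc, if_true, if_false,
        reduceCtorEq, Option.some.injEq] at hab
      · rw [hac, hbc]
      · have hac' : f a ≠ f c := fun h => hac (hf a ha c hcx.adj.left_mem h)
        have hbc' : f b ≠ f c := fun h => hbc (hf b hb c hcx.adj.left_mem h)
        refine hf a ha b hb ?_
        split_ifs at hab <;> omega
    · intro e a b he
      have hab : G.Adj a b := ⟨e, he⟩
      have h1 := hadj a b hab
      by_cases hac : a = c <;> by_cases hbc : b = c <;> simp only [hac, hbc, if_true, if_false]
      · exact absurd (hac.trans hbc.symm) (hG.ne hab)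
      · refine ⟨rfl, ?_⟩
        rw [hac] at h1
        split_ifs <;> omega
      · refine ⟨rfl, ?_⟩
        rw [hbc] at h1
        split_ifs <;> omega
      · have hac' : f a ≠ f c := fun h => hac (hf a he.left_mem c hcx.adj.left_mem h)
        have hbc' : f b ≠ f c := fun h => hbc (hf b he.right_mem c hcx.adj.left_mem h)
        simp only [HostAdj]
        split_ifs <;> omega
    · intro e e' a b he he' hee'
      refine Or.inl ⟨rfl, ?_⟩
      rcases hc a b ⟨e, e', hee', he, he'⟩ with h | h
      · exact Or.inl (if_pos h)
      · exact Or.inr (if_pos h)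
  · by_cases h1 : ∃ x y, G.Thick x y
    · obtain ⟨x, y, hxy⟩ := h1
      have hxy1 := hadj x y hxy.adj
      have honly : ∀ p q, G.Thick p q → (p = x ∧ q = y) ∨ (p = y ∧ q = x) := by
        intro p q hpq
        have hpq' := hG.ne hpq.adj
        have hxy' := hG.ne hxy.adj
        have key : ∀ c x y, G.Thick c x → G.Thick c y → x = y := fun c x y hx hy => by
          by_contra hne
          exact h2 ⟨c, x, y, hne, hx, hy⟩
        by_cases hpx : p = x
        · subst hpx
          exact Or.inl ⟨rfl, key _ _ _ hpq hxy⟩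
        by_cases hpy : p = y
        · subst hpy
          exact Or.inr ⟨rfl, key _ _ _ hpq hxy.symm⟩
        by_cases hqx : q = x
        · subst hqx
          exact Or.inr ⟨key _ _ _ hpq.symm hxy, rfl⟩
        by_cases hqy : q = y
        · subst hqy
          exact Or.inl ⟨key _ _ _ hpq.symm hxy.symm, rfl⟩
        exact (hG.no_C2C2 hpq hxy (by grind)).elim
      refine ⟨false, fun v => some (if f y = f x + 1 then f v - f x else f x - f v), ?_, ?_, ?_⟩
      · intro a ha b hb hab
        refine hf a ha b hb ?_
        simp only [Option.some.injEq] at hab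
        split_ifs at hab <;> omega
      · intro e a b he
        have := hadj a b ⟨e, he⟩
        simp only [HostAdj]
        split_ifs <;> omega
      · intro e e' a b he he' hee'
        simp only [HostThick, Bool.false_eq_true, false_and, true_and, false_or,
          Option.some.injEq]
        rcases honly a b ⟨e, e', hee', he, he'⟩ with ⟨rfl, rfl⟩ | ⟨rfl, rfl⟩ <;>
          split_ifs <;> omega
    · refine ⟨true, fun v => some (f v), ?_, ?_, ?_⟩
      · intro a ha b hb hab
        exact hf a ha b hb (Option.some.inj hab)
      · exact fun e a b he => hadj a b ⟨e, he⟩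
      · exact fun e e' a b he he' hee' => absurd ⟨a, b, e, e', hee', he, he'⟩ h1

/-- In a graph without triangles, there is only one vertex with three neighbours. -/
theorem eq_of_three_neighbors (hG : G.ExcludesObstructions)
    (triangle : ∀ x y z, G.Adj x y → G.Adj y z → G.Adj x z → False)
    {c a₁ a₂ a₃ d b₁ b₂ b₃ : α} (ha₁ : G.Adj c a₁) (ha₂ : G.Adj c a₂) (ha₃ : G.Adj c a₃)
    (ha : [a₁, a₂, a₃].Nodup) (hb₁ : G.Adj d b₁) (hb₂ : G.Adj d b₂) (hb₃ : G.Adj d b₃)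
    (hb : [b₁, b₂, b₃].Nodup) : d = c := by
  by_contra hdc
  -- Any given vertex leaves two of the neighbours of `c`, and likewise of `d`.
  have two : ∀ {c a₁ a₂ a₃ : α}, G.Adj c a₁ → G.Adj c a₂ → G.Adj c a₃ → [a₁, a₂, a₃].Nodup →
      ∀ m, ∃ a a', a ≠ a' ∧ a ≠ m ∧ a' ≠ m ∧ G.Adj c a ∧ G.Adj c a' := by
    intro c a₁ a₂ a₃ h1 h2 h3 hn m
    by_cases hm1 : a₁ = m
    · exact ⟨a₂, a₃, by grind, by grind, by grind, h2, h3⟩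
    · by_cases hm2 : a₂ = m
      · exact ⟨a₁, a₃, by grind, by grind, by grind, h1, h3⟩
      · exact ⟨a₁, a₂, by grind, by grind, by grind, h1, h2⟩
  by_cases hcd : G.Adj c d
  · obtain ⟨a, a', haa, had, had', hca, hca'⟩ := two ha₁ ha₂ ha₃ ha d
    obtain ⟨b, b', hbb, hbc, hbc', hdb, hdb'⟩ := two hb₁ hb₂ hb₃ hb c
    have hne : ∀ p q, G.Adj c p → G.Adj d q → p ≠ q := by
      rintro p q hp hq rfl
      exact triangle c d p hcd hq hp
    have := hne _ _ hca hdb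
    have := hne _ _ hca hdb'
    have := hne _ _ hca' hdb
    have := hne _ _ hca' hdb'
    have := hG.ne hca
    have := hG.ne hca'
    have := hG.ne hdb
    have := hG.ne hdb'
    exact hG.no_doubleStar hcd hca hca' hdb hdb' (by grind)
  · have hca : ∀ p, G.Adj c p → p ≠ d := by
      rintro p hp rfl
      exact hcd hp
    have hdb : ∀ p, G.Adj d p → p ≠ c := by
      rintro p hp rfl
      exact hcd hp.symm
    by_cases hm : ∃ m, G.Adj c m ∧ G.Adj d m
    · obtain ⟨m, hcm, hdm⟩ := hm
      obtain ⟨a, a', haa, ham, ham', hca1, hca'⟩ := two ha₁ ha₂ ha₃ ha m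
      obtain ⟨b, b', hbb, hbm, hbm', hdb1, hdb'⟩ := two hb₁ hb₂ hb₃ hb m
      have hne : ∀ p q, G.Adj c p → G.Adj d q → p ≠ m → p ≠ q := by
        rintro p q hp hq hpm rfl
        exact hG.no_C4 hcm hdm.symm hq hp.symm (Ne.symm hdc) hpm.symm
      have := hne _ _ hca1 hdb1 ham
      have := hne _ _ hca1 hdb' ham
      have := hne _ _ hca' hdb1 ham'
      have := hne _ _ hca' hdb' ham'
      have := hG.ne hca1
      have := hG.ne hca'
      have := hG.ne hdb1
      have := hG.ne hdb'
      have := hG.ne hcm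
      have := hG.ne hdm
      have := hca _ hca1
      have := hca _ hca'
      have := hdb _ hdb1
      have := hdb _ hdb'
      exact hG.no_doubleStar_of_common_neighbor hcm hdm.symm hca1 hca' hdb1 hdb' (by grind)
    · have hne : ∀ p q, G.Adj c p → G.Adj d q → p ≠ q := by
        rintro p q hp hq rfl
        exact hm ⟨p, hp, hq⟩
      have := hne _ _ ha₁ hb₁
      have := hne _ _ ha₁ hb₂
      have := hne _ _ ha₁ hb₃
      have := hne _ _ ha₂ hb₁
      have := hne _ _ ha₂ hb₂
      have := hne _ _ ha₂ hb₃
      have := hne _ _ ha₃ hb₁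
      have := hne _ _ ha₃ hb₂
      have := hne _ _ ha₃ hb₃
      have := hca _ ha₁
      have := hca _ ha₂
      have := hca _ ha₃
      have := hdb _ hb₁
      have := hdb _ hb₂
      have := hdb _ hb₃
      have := hG.ne ha₁
      have := hG.ne ha₂
      have := hG.ne ha₃
      have := hG.ne hb₁
      have := hG.ne hb₂
      have := hG.ne hb₃
      exact hG.no_StarStar ha₁ ha₂ ha₃ hb₁ hb₂ hb₃ (by grind)

/-- A graph without triangles but with a vertex `c` that has three neighbours: one of these has no
other neighbours than `c` and carries all thick edges, and it becomes the apex. -/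
theorem isNearPath_of_three_neighbors (hG : G.ExcludesObstructions)
    (triangle : ∀ x y z, G.Adj x y → G.Adj y z → G.Adj x z → False)
    {c a₁ a₂ a₃ : α} (ha₁ : G.Adj c a₁) (ha₂ : G.Adj c a₂) (ha₃ : G.Adj c a₃)
    (ha : [a₁, a₂, a₃].Nodup) : G.IsNearPath := by
  have h1 := hG.ne ha₁
  have h2 := hG.ne ha₂
  have h3 := hG.ne ha₃
  obtain ⟨ha12, ha13, ha23⟩ : a₁ ≠ a₂ ∧ a₁ ≠ a₃ ∧ a₂ ≠ a₃ := by grind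
  -- It suffices to find the apex among the neighbours of `c`.
  have finish : ∀ w, G.Adj c w → (∀ x, G.Adj w x → x = c) → (∀ a, a ≠ w → ¬ G.Thick c a) →
      (∀ p q, G.Thick p q → p = c ∨ q = c) → G.IsNearPath := by
    intro w hcw hw hthick hthick'
    have hcw' := hG.ne hcw
    refine hG.isNearPath_of_apex (w := w) (s := c) (t := c) hcw.left_mem hcw.left_mem hcw' hcw'
      (Or.inl rfl) (fun x hx => Or.inl (hw x hx)) ?_ ?_ fun x y z _ _ _ => triangle x y z
    · intro p q hp hq hpq
      rcases hthick' p q hpq with rfl | rfl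
      · exact hthick q hq hpq
      · exact hthick p hp hpq.symm
    · intro x hxw p q r hp hq hr hxp hxq hxr
      by_contra! hne
      obtain rfl := hG.eq_of_three_neighbors triangle ha₁ ha₂ ha₃ ha hxp hxq hxr (by grind)
      exact hG.no_Star4 hcw hxp hxq hxr (by grind)
  have nbr : ∀ x, G.Adj c x → x = a₁ ∨ x = a₂ ∨ x = a₃ := by
    intro x hx
    by_contra! hne
    exact hG.no_Star4 hx ha₁ ha₂ ha₃ (by grind)
  -- A thick edge away from `c` would give `C₂ ⊔ K_{1,3}` or `H₅`.
  have key : ∀ p q a b, G.Thick p q → q ≠ c → G.Adj c p → G.Adj c a → G.Adj c b →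
      [p, a, b].Nodup → False := by
    intro p q a b hpq hqc hp ha hb hn
    have := hG.ne hpq.adj
    have := hG.ne hp
    have := hG.ne ha
    have := hG.ne hb
    have : q ≠ a := by
      rintro rfl
      exact triangle c p q hp hpq.adj ha
    have : q ≠ b := by
      rintro rfl
      exact triangle c p q hp hpq.adj hb
    exact hG.no_H5 ha hb hp hpq (by grind)
  have key' : ∀ p q, G.Thick p q → q ≠ c → ¬ G.Adj c p := by
    intro p q hpq hqc hp
    rcases nbr p hp with rfl | rfl | rfl
    · exact key p q a₂ a₃ hpq hqc hp ha₂ ha₃ ha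
    · exact key p q a₁ a₃ hpq hqc hp ha₁ ha₃ (by grind)
    · exact key p q a₁ a₂ hpq hqc hp ha₁ ha₂ (by grind)
  have hthick' : ∀ p q, G.Thick p q → p = c ∨ q = c := by
    intro p q hpq
    by_contra! hne
    have := hG.ne hpq.adj
    have hp := key' p q hpq hne.2
    have hq := key' q p hpq.symm hne.1
    have far : ∀ a, G.Adj c a → p ≠ a ∧ q ≠ a := by
      intro a ha
      constructor
      · rintro rfl
        exact hp ha
      · rintro rfl
        exact hq ha
    have := far _ ha₁
    have := far _ ha₂
    have := far _ ha₃
    exact hG.no_C2Star hpq ha₁ ha₂ ha₃ (by grind)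
  by_cases ht : ∃ a, G.Thick c a
  · obtain ⟨a, hca⟩ := ht
    have hca' := hG.ne hca.adj
    have two : ∀ m, ∃ b b', b ≠ b' ∧ b ≠ m ∧ b' ≠ m ∧ G.Adj c b ∧ G.Adj c b' := by
      intro m
      by_cases hm1 : a₁ = m
      · exact ⟨a₂, a₃, by grind, by grind, by grind, ha₂, ha₃⟩
      · by_cases hm2 : a₂ = m
        · exact ⟨a₁, a₃, by grind, by grind, by grind, ha₁, ha₃⟩
        · exact ⟨a₁, a₂, by grind, by grind, by grind, ha₁, ha₂⟩
    obtain ⟨b, b', hbb, hba, hba', hcb, hcb'⟩ := two a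
    refine finish a hca.adj ?_ ?_ hthick'
    · intro x hax
      by_contra hxc
      have hxa := hG.ne hax
      have far : ∀ y, G.Adj c y → x ≠ y := by
        rintro y hy rfl
        exact triangle c a x hca.adj hax hy
      have := far _ hcb
      have := far _ hcb'
      have := hG.ne hcb
      have := hG.ne hcb'
      exact hG.no_H4 hca hcb hcb' hax (by
        simp only [List.nodup_cons, List.mem_cons, List.not_mem_nil, or_false, not_or,
          List.nodup_nil, not_false_eq_true, and_true]
        and_intros <;> first | assumption | (apply Ne.symm; assumption))
    · intro a' ha' hca''
      by_cases hba'' : b = a'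
      · exact hG.no_H2 hca hca'' hcb' (by grind)
      · exact hG.no_H2 hca hca'' hcb (by grind)
  · have hthick : ∀ w a, a ≠ w → ¬ G.Thick c a := fun _ a _ h => ht ⟨a, h⟩
    by_cases hw : ∃ w, G.Adj c w ∧ ∀ x, G.Adj w x → x = c
    · obtain ⟨w, hcw, hw⟩ := hw
      exact finish w hcw hw (hthick w) hthick'
    · -- Without a leaf next to `c`, there is a long `Y`.
      push Not at hw
      obtain ⟨b₁, hb₁, hbc₁⟩ := hw a₁ ha₁
      obtain ⟨b₂, hb₂, hbc₂⟩ := hw a₂ ha₂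
      obtain ⟨b₃, hb₃, hbc₃⟩ := hw a₃ ha₃
      have hnot : ∀ a b a', G.Adj c a → G.Adj a b → G.Adj c a' → b ≠ a' := by
        rintro a b a' h h' h'' rfl
        exact triangle c a b h h' h''
      have hdis : ∀ a b a' b', G.Adj c a → G.Adj a b → G.Adj c a' → G.Adj a' b' → a ≠ a' →
          b ≠ c → b ≠ b' := by
        rintro a b a' b' h h' h'' h''' hne hbc rfl
        exact hG.no_C4 h h' h'''.symm h''.symm (Ne.symm hbc) hne
      have := hnot _ _ _ ha₁ hb₁ ha₁
      have := hnot _ _ _ ha₁ hb₁ ha₂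
      have := hnot _ _ _ ha₁ hb₁ ha₃
      have := hnot _ _ _ ha₂ hb₂ ha₁
      have := hnot _ _ _ ha₂ hb₂ ha₂
      have := hnot _ _ _ ha₂ hb₂ ha₃
      have := hnot _ _ _ ha₃ hb₃ ha₁
      have := hnot _ _ _ ha₃ hb₃ ha₂
      have := hnot _ _ _ ha₃ hb₃ ha₃
      have := hdis _ _ _ _ ha₁ hb₁ ha₂ hb₂ ha12 hbc₁
      have := hdis _ _ _ _ ha₁ hb₁ ha₃ hb₃ ha13 hbc₁
      have := hdis _ _ _ _ ha₂ hb₂ ha₃ hb₃ ha23 hbc₂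
      exact (hG.no_LongY ha₁ hb₁ ha₂ hb₂ ha₃ hb₃ (by
        simp only [List.nodup_cons, List.mem_cons, List.not_mem_nil, or_false, not_or,
          List.nodup_nil, not_false_eq_true, and_true]
        and_intros <;> first | assumption | (apply Ne.symm; assumption))).elim

/-- If a vertex `w` of a triangle `w s t` has no neighbours outside the triangle and the opposite
edge is not thick, then `w` can be taken for the apex. -/
theorem isNearPath_of_triangle_of_apex (hG : G.ExcludesObstructions) {w s t : α}
    (hws : G.Adj w s) (hst : G.Adj s t) (hwt : G.Adj w t) (hw : ∀ x, G.Adj w x → x = s ∨ x = t)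
    (hthick : ¬ G.Thick s t) : G.IsNearPath := by
  have h1 := hG.ne hws
  have h2 := hG.ne hst
  have h3 := hG.ne hwt
  refine hG.isNearPath_of_apex (w := w) (s := s) (t := t) hst.left_mem hst.right_mem h1.symm h3.symm
    (Or.inr hst) hw ?_ ?_ ?_
  · intro a b haw hbw hab
    have hab' := hG.ne hab.adj
    have key : ∀ a b, G.Thick a b → a ≠ w → b ≠ w → a ≠ b → a = s ∨ a = t := by
      intro a b hab haw hbw hab'
      by_contra! hne
      by_cases hbs : b = s
      · subst hbs
        exact hG.no_H3 hst hwt.symm hws hab.symm hne.2 haw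
      · by_cases hbt : b = t
        · subst hbt
          exact hG.no_H3 hst.symm hws.symm hwt hab.symm hne.1 haw
        · exact hG.no_triangle_thick hws hst hwt hab (by grind)
    rcases key a b hab haw hbw hab' with rfl | rfl <;>
      rcases key b a hab.symm hbw haw hab'.symm with rfl | rfl
    · exact hab' rfl
    · exact hthick hab
    · exact hthick hab.symm
    · exact hab' rfl
  · intro d hdw p q r hp hq hr hdp hdq hdr
    by_contra! hne
    by_cases hds : d = s
    · subst hds
      exact hG.no_Star4 hws.symm hdp hdq hdr (by grind)
    by_cases hdt : d = t
    · subst hdt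
      exact hG.no_Star4 hwt.symm hdp hdq hdr (by grind)
    have := hG.ne hdp
    have := hG.ne hdq
    have := hG.ne hdr
    -- A vertex outside a triangle has at most one neighbour in the triangle.
    have one : ∀ a b c, G.Adj a b → G.Adj b c → G.Adj a c → d ≠ c → G.Adj d a → ¬ G.Adj d b := by
      intro a b c hab hbc hac hdc hda hdb
      exact hG.no_C4 hda hac hbc.symm hdb.symm hdc (hG.ne hab)
    have key : ∀ a b, G.Adj w a → G.Adj a b → G.Adj w b → d ≠ a → d ≠ b → ∀ p q, G.Adj d a →
        G.Adj d p → G.Adj d q → p ≠ w → q ≠ w → p ≠ a → q ≠ a → p ≠ q → False := by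
      intro a b hwa hab hwb hda hdb p q hda' hdp hdq hpw hqw hpa hqa hpq
      have hb : ∀ x, G.Adj d x → x ≠ b := by
        rintro x hx rfl
        exact one a x w hab hwb.symm hwa.symm hdw hda' hx
      have := hb _ hdp
      have := hb _ hdq
      have := hG.ne hwa
      have := hG.ne hab
      have := hG.ne hwb
      have := hG.ne hdp
      have := hG.ne hdq
      exact hG.no_doubleStar hda' hdp hdq hwa.symm hab (by
        simp only [List.nodup_cons, List.mem_cons, List.not_mem_nil, or_false, not_or]
        tauto)
    have key' : ∀ p q r, G.Adj d p → G.Adj d q → G.Adj d r → p ≠ w → q ≠ w → r ≠ w →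
        p ≠ q → p ≠ r → q ≠ r → p ≠ s ∧ p ≠ t := by
      intro p q r hdp hdq hdr hp hq hr hpq hpr hqr
      constructor
      · rintro rfl
        exact key p t hws hst hwt hds hdt q r hdp hdq hdr hq hr hpq.symm hpr.symm hqr
      · rintro rfl
        exact key p s hwt hst.symm hws hdt hds q r hdp hdq hdr hq hr hpq.symm hpr.symm hqr
    have := key' p q r hdp hdq hdr hp hq hr hne.1 hne.2.1 hne.2.2
    have := key' q p r hdq hdp hdr hq hp hr hne.1.symm hne.2.2 hne.2.1
    have := key' r p q hdr hdp hdq hr hp hq hne.2.1.symm hne.2.2.symm hne.1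
    exact hG.no_triangle_star hws hst hwt hdp hdq hdr (by
        simp only [List.nodup_cons, List.mem_cons, List.not_mem_nil, or_false, not_or]
        tauto)
  · intro x y z hx hy hz hxy hyz hxz
    have := hG.ne hxy
    have := hG.ne hyz
    have := hG.ne hxz
    have ats : ∀ y z, G.Adj s y → G.Adj y z → G.Adj s z → y ≠ w → z ≠ w → False := by
      intro y z hsy hyz hsz hyw hzw
      have := hG.ne hsy
      have := hG.ne hsz
      have hyz' := hG.ne hyz
      by_cases hyt : y = t
      · subst hyt
        exact hG.no_C4 hws hsz hyz.symm hwt.symm hzw.symm h2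
      · by_cases hzt : z = t
        · subst hzt
          exact hG.no_C4 hws hsy hyz hwt.symm hyw.symm h2
        · exact hG.no_Star4 hws.symm hst hsy hsz (by grind)
    have att : ∀ y z, G.Adj t y → G.Adj y z → G.Adj t z → y ≠ w → z ≠ w → False := by
      intro y z hsy hyz hsz hyw hzw
      have := hG.ne hsy
      have := hG.ne hsz
      have hyz' := hG.ne hyz
      by_cases hyt : y = s
      · subst hyt
        exact hG.no_C4 hwt hsz hyz.symm hws.symm hzw.symm h2.symm
      · by_cases hzt : z = s
        · subst hzt
          exact hG.no_C4 hwt hsy hyz hws.symm hyw.symm h2.symm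
        · exact hG.no_Star4 hwt.symm hst.symm hsy hsz (by grind)
    by_cases hxs : x = s
    · subst hxs
      exact ats y z hxy hyz hxz hy hz
    by_cases hys : y = s
    · subst hys
      exact ats x z hxy.symm hxz hyz hx hz
    by_cases hzs : z = s
    · subst hzs
      exact ats x y hxz.symm hxy hyz.symm hx hy
    by_cases hxt : x = t
    · subst hxt
      exact att y z hxy hyz hxz hy hz
    by_cases hyt : y = t
    · subst hyt
      exact att x z hxy.symm hxz hyz hx hz
    by_cases hzt : z = t
    · subst hzt
      exact att x y hxz.symm hxy hyz.symm hx hy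
    exact hG.no_disjoint_triangles hws hst hwt hxy hyz hxz (by grind)

/-- A triangle has a vertex without neighbours outside the triangle, since there is no `3`-sun. If
the opposite edge is thick, another vertex of the triangle can take its role. -/
theorem isNearPath_of_triangle (hG : G.ExcludesObstructions) {x y z : α} (hxy : G.Adj x y)
    (hyz : G.Adj y z) (hxz : G.Adj x z) : G.IsNearPath := by
  have h1 := hG.ne hxy
  have h2 := hG.ne hyz
  have h3 := hG.ne hxz
  have outside : ∀ w s t, ¬ (∀ v, G.Adj w v → v = s ∨ v = t) → ∃ b, G.Adj w b ∧ b ≠ s ∧ b ≠ t := by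
    intro w s t h
    push Not at h
    exact h
  have distinct : ∀ {a b c p q}, G.Adj a b → G.Adj b c → G.Adj a c → G.Adj a p → G.Adj b q →
      p ≠ c → p ≠ q := by
    rintro a b c p q hab hbc hac hap hbq hpc rfl
    exact hG.no_C4 hap hbq.symm hbc hac.symm (hG.ne hab) hpc
  -- If `z` has no neighbours outside the triangle and `x z` is not thick, then one of `x`, `y`, `z`
  -- is the apex.
  have almost : ∀ x y z, G.Adj x y → G.Adj y z → G.Adj x z → (∀ v, G.Adj z v → v = x ∨ v = y) →
      ¬ G.Thick x z → G.IsNearPath := by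
    intro x y z hxy hyz hxz hz hthick
    have h1 := hG.ne hxy
    have h2 := hG.ne hyz
    have h3 := hG.ne hxz
    by_cases hT : G.Thick x y
    · by_cases hy : ∀ v, G.Adj y v → v = x ∨ v = z
      · exact hG.isNearPath_of_triangle_of_apex hxy.symm hxz hyz hy hthick
      obtain ⟨b, hyb, hbx, hbz⟩ := outside _ _ _ hy
      have := hG.ne hyb
      by_cases hx : ∀ v, G.Adj x v → v = y ∨ v = z
      · by_cases hT' : G.Thick y z
        · exact (hG.no_H2 hT.symm hT' hyb (by
        simp only [List.nodup_cons, List.mem_cons, List.not_mem_nil, or_false, not_or]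
        tauto)).elim
        · exact hG.isNearPath_of_triangle_of_apex hxy hyz hxz hx hT'
      · obtain ⟨a, hxa, hay, haz⟩ := outside _ _ _ hx
        have := hG.ne hxa
        have := distinct hxy hyz hxz hxa hyb haz
        exact (hG.no_H4 hT hxz hxa hyb (by
        simp only [List.nodup_cons, List.mem_cons, List.not_mem_nil, or_false, not_or]
        tauto)).elim
    · exact hG.isNearPath_of_triangle_of_apex hxz.symm hxy hyz.symm hz hT
  have almost' : ∀ x y z, G.Adj x y → G.Adj y z → G.Adj x z → (∀ v, G.Adj z v → v = x ∨ v = y) →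
      G.IsNearPath := by
    intro x y z hxy hyz hxz hz
    by_cases hT : G.Thick x z
    · by_cases hT' : G.Thick y z
      · have hT'' : ¬ G.Thick x y := fun h => hG.no_H1 h hT' hT.symm
        exact hG.isNearPath_of_triangle_of_apex hxz.symm hxy hyz.symm hz hT''
      · exact almost y x z hxy.symm hxz hyz (fun v hv => (hz v hv).symm) hT'
    · exact almost x y z hxy hyz hxz hz hT
  by_cases hz : ∀ v, G.Adj z v → v = x ∨ v = y
  · exact almost' x y z hxy hyz hxz hz
  by_cases hy : ∀ v, G.Adj y v → v = x ∨ v = z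
  · exact almost' x z y hxz hyz.symm hxy hy
  by_cases hx : ∀ v, G.Adj x v → v = y ∨ v = z
  · exact almost' y z x hyz hxz.symm hxy.symm hx
  obtain ⟨c, hzc, hcx, hcy⟩ := outside _ _ _ hz
  obtain ⟨b, hyb, hbx, hbz⟩ := outside _ _ _ hy
  obtain ⟨a, hxa, hay, haz⟩ := outside _ _ _ hx
  have := hG.ne hxa
  have := hG.ne hyb
  have := hG.ne hzc
  have := distinct hxy hyz hxz hxa hyb haz
  have := distinct hxz hyz.symm hxy hxa hzc hay
  have := distinct hyz hxz.symm hxy.symm hyb hzc hbx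
  exact (hG.no_threeSun hxy hyz hxz hxa hyb hzc (by
        simp only [List.nodup_cons, List.mem_cons, List.not_mem_nil, or_false, not_or]
        tauto)).elim

/-- The structure theorem: graphs without any of the eleven obstructions as a minor are
near-paths. -/
theorem isNearPath (hG : G.ExcludesObstructions) : G.IsNearPath := by
  by_cases ht : ∃ x y z, G.Adj x y ∧ G.Adj y z ∧ G.Adj x z
  · obtain ⟨x, y, z, hxy, hyz, hxz⟩ := ht
    exact hG.isNearPath_of_triangle hxy hyz hxz
  have triangle : ∀ x y z, G.Adj x y → G.Adj y z → G.Adj x z → False :=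
    fun x y z h1 h2 h3 => ht ⟨x, y, z, h1, h2, h3⟩
  by_cases hd : ∃ x a b c, G.Adj x a ∧ G.Adj x b ∧ G.Adj x c ∧ a ≠ b ∧ a ≠ c ∧ b ≠ c
  · obtain ⟨x, a, b, c, ha, hb, hc, h⟩ := hd
    exact hG.isNearPath_of_three_neighbors triangle ha hb hc (by grind)
  · refine hG.isNearPath_of_degree_le_two (fun x a b c ha hb hc => ?_) triangle
    by_contra! hne
    exact hd ⟨x, a, b, c, ha, hb, hc, hne⟩

end ExcludesObstructions

end Graph

theorem mainTheorem3 {α β : Type*} (G : Graph α β) (hG : G.IsMultigraph) :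
    G.IsMinorMinimalWithSpectatorFloor 2 ↔
      G.Isomorphic (Graph.graphC2.disjointUnion Graph.graphC2) ∨
      G.Isomorphic (Graph.graphC2.disjointUnion (Graph.star 3)) ∨
      G.Isomorphic ((Graph.star 3).disjointUnion (Graph.star 3)) ∨
      G.Isomorphic Graph.graphC4 ∨
      G.Isomorphic Graph.graphH1 ∨
      G.Isomorphic Graph.graphH2 ∨
      G.Isomorphic Graph.graphH3 ∨
      G.Isomorphic Graph.graphH4 ∨
      G.Isomorphic Graph.graphH5 ∨
      G.Isomorphic (Graph.star 4) ∨
      G.Isomorphic Graph.longY := by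
  constructor
  · intro h
    by_contra! hne
    obtain ⟨h1, h2, h3, h4, h5, h6, h7, h8, h9, h10, h11⟩ := hne
    have excl : G.ExcludesObstructions :=
      ⟨hG,
        fun hm => h1 ((Graph.isObstruction_endsC2C2.isomorphic h hm).trans
          Graph.isomorphic_C2C2.symm),
        fun hm => h2 ((Graph.isObstruction_endsC2Star.isomorphic h hm).trans
          Graph.isomorphic_C2Star.symm),
        fun hm => h3 ((Graph.isObstruction_endsStarStar.isomorphic h hm).trans
          Graph.isomorphic_StarStar.symm),
        fun hm => h4 ((Graph.isObstruction_endsC4.isomorphic h hm).trans Graph.isomorphic_C4.symm),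
        fun hm => h5 ((Graph.isObstruction_endsH1.isomorphic h hm).trans Graph.isomorphic_H1.symm),
        fun hm => h6 ((Graph.isObstruction_endsH2.isomorphic h hm).trans Graph.isomorphic_H2.symm),
        fun hm => h7 ((Graph.isObstruction_endsH3.isomorphic h hm).trans Graph.isomorphic_H3.symm),
        fun hm => h8 ((Graph.isObstruction_endsH4.isomorphic h hm).trans Graph.isomorphic_H4.symm),
        fun hm => h9 ((Graph.isObstruction_endsH5.isomorphic h hm).trans Graph.isomorphic_H5.symm),
        fun hm => h10 ((Graph.isObstruction_endsStar4.isomorphic h hm).trans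
          Graph.isomorphic_Star4.symm),
        fun hm => h11 ((Graph.isObstruction_endsLongY.isomorphic h hm).trans
          Graph.isomorphic_LongY.symm)⟩
    have hle := excl.isNearPath.spectatorFloor_le_one hG.finite_vertexSet hG.finite_edgeSet
    have heq := h.1
    omega
  · rintro (h | h | h | h | h | h | h | h | h | h | h)
    · exact Graph.isObstruction_endsC2C2.isMinorMinimal hG (h.trans Graph.isomorphic_C2C2)
    · exact Graph.isObstruction_endsC2Star.isMinorMinimal hG (h.trans Graph.isomorphic_C2Star)
    · exact Graph.isObstruction_endsStarStar.isMinorMinimal hG (h.trans Graph.isomorphic_StarStar)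
    · exact Graph.isObstruction_endsC4.isMinorMinimal hG (h.trans Graph.isomorphic_C4)
    · exact Graph.isObstruction_endsH1.isMinorMinimal hG (h.trans Graph.isomorphic_H1)
    · exact Graph.isObstruction_endsH2.isMinorMinimal hG (h.trans Graph.isomorphic_H2)
    · exact Graph.isObstruction_endsH3.isMinorMinimal hG (h.trans Graph.isomorphic_H3)
    · exact Graph.isObstruction_endsH4.isMinorMinimal hG (h.trans Graph.isomorphic_H4)
    · exact Graph.isObstruction_endsH5.isMinorMinimal hG (h.trans Graph.isomorphic_H5)
    · exact Graph.isObstruction_endsStar4.isMinorMinimal hG (h.trans Graph.isomorphic_Star4)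
    · exact Graph.isObstruction_endsLongY.isMinorMinimal hG (h.trans Graph.isomorphic_LongY)
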